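/- Words are finite sequences of letters. A circular word \([w]\) is the class of a word \(w\) modulo cyclic permutations of its letters, \([X]=\{[w]: w\in X\}\) for a set \(X\) of words, and \([v]^p=[v^p]\). A factor of \([w]\) is a (contiguous) factor of a representative of \([w]\). A circular word is balanced if it is non-empty and, for each of its representatives, for any two factors \(u,v\) of that representative of equal length and any letter \(a\), the numbers of occurrences of \(a\) in \(u\) and in \(v\) differ by at most \(1\). The abelian complexity of \([w]\) at \(n\), \(1\le n\le |w|\), is the number of distinct Parikh vectors (vectors counting the occurrences of each letter) of the factors of \([w]\) of length \(n\); \([w]\) is abelian-\(3\)-bounded if the maximum over \(n\) of its abelian complexity is \(3\). Let \([\mathcal M_3]\) (respectively \([\mathcal B_3]\)) be the set of abelian-\(3\)-bounded (respectively balanced) circular words over \(\{0,1,2\}\) in which all three letters occur. For coprime positive integers \(k,h\) let \(C(k,h)\) be the (lower) Christoffel word: the word over \(\{0,1\}\) of length \(k+h\) that codes the lattice path from \((0,0)\) to \((k,h)\), with horizontal unit steps coded by \(0\) and vertical unit steps coded by \(1\), in which a vertical step is made whenever it does not lead strictly above the line \(y=(h/k)x\), and a horizontal step otherwise. It has the form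 \(0Q1\). Let \(\mathcal C^{\mathrm{tw}}\) be the set of twisted words: the words obtained from a power \(C(k,h)^p=(0Q1)^p\) with \(p\ge 2\) and \(k\) even (so that \(C(k,h)\) has an even number of \(0\)s) by replacing \(10\) by \(01\) at one or more of the \(p-1\) borders between consecutive factors \(0Q1\). Let \(\phi\) be the map that sends a word over \(\{0,1\}\) to the word over \(\{0,1,2\}\) obtained by substituting \(2\) for each \(1\), and \(1\) for each \(0\) that is the second, fourth, sixth, \(\dots\) occurrence of \(0\) in the word. The symmetric group \(\mathfrak S_3\) acts on circular words over \(\{0,1,2\}\) by permuting the letters; for a set \(X\) of circular words, \(\mathfrak S_3X\) is the set of all images of elements of \(X\). Let \([\mathcal D_3]\) be the set of all powers, with exponent \(p\ge 1\), of the elements of \(\mathfrak S_3\{[01210]\}\). Theorem. \([\mathcal M_3]\) is the disjoint union \[[\mathcal M_3]=[\mathcal B_3]\sqcup\mathfrak S_3\big[\phi(\mathcal C^{\mathrm{tw}})\big]\sqcup[\mathcal D_3],\] that is, \([\mathcal M_3]\) is the union of the three sets on the right, and these are pairwise disjoint. -/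

import Mathlib

namespace CircularWords

/-- Words over the `N`-letter alphabet `{0, 1, …, N - 1}`. -/
abbrev Word (N : ℕ) : Type := List (Fin N)

/-- Circular words: words up to cyclic permutations of their letters. -/
abbrev CircWord (N : ℕ) : Type := Cycle (Fin N)

/-- The set `[X]` of the circular words that have a representative in `X`. -/
def circ {N : ℕ} (X : Set (Word N)) : Set (CircWord N) :=
  {c | ∃ w ∈ X, (w : CircWord N) = c}

/-- The `p`th power of a word. -/
def wordPow {N : ℕ} (v : Word N) (p : ℕ) : Word N := (List.replicate p v).flatten

/-- The circular word `c` is the `p`th power of the circular word `d`. -/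
def IsCircPow {N : ℕ} (c d : CircWord N) (p : ℕ) : Prop :=
  ∀ w : Word N, (w : CircWord N) = c → ∃ v : Word N, (v : CircWord N) = d ∧ w = wordPow v p

/-- The images of the elements of `X` under all permutations of the alphabet. -/
def permImages {N : ℕ} (X : Set (CircWord N)) : Set (CircWord N) :=
  {c | ∃ σ : Equiv.Perm (Fin N), ∃ d ∈ X, c = Cycle.map σ d}

/-- The Parikh vector: the number of occurrences of each letter. -/
def parikh {N : ℕ} (w : Word N) : Fin N → ℕ := fun a => w.count a

/-- Balanced words; `u <:+: w` says that `u` is a (contiguous) factor of `w`. -/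
def IsBalanced {N : ℕ} (w : Word N) : Prop :=
  w ≠ [] ∧ ∀ u v : Word N, u <:+: w → v <:+: w → u.length = v.length →
    ∀ a : Fin N, |(parikh u a : ℤ) - (parikh v a : ℤ)| ≤ 1

/-- A circular word is balanced if all its representatives are. -/
def IsCircBalanced {N : ℕ} (c : CircWord N) : Prop :=
  ∀ w : Word N, (w : CircWord N) = c → IsBalanced w

/-- The `n`-spectrum of a word: the Parikh vectors of its factors of length `n`. -/
def spec {N : ℕ} (n : ℕ) (w : Word N) : Set (Fin N → ℕ) :=
  {x | ∃ u : Word N, u <:+: w ∧ u.length = n ∧ parikh u = x}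

/-- The `n`-spectrum of a circular word: the union of those of its representatives. -/
def circSpec {N : ℕ} (n : ℕ) (c : CircWord N) : Set (Fin N → ℕ) :=
  {x | ∃ w : Word N, (w : CircWord N) = c ∧ x ∈ spec n w}

/-- The abelian complexity of a word. -/
noncomputable def ab {N : ℕ} (n : ℕ) (w : Word N) : ℕ∞ := (spec n w).encard

/-- The abelian complexity of a circular word. -/
noncomputable def circAb {N : ℕ} (n : ℕ) (c : CircWord N) : ℕ∞ := (circSpec n c).encard

/-- `c` is abelian-`p`-bounded: `p` is the least integer that bounds the abelian complexity. -/
def IsAbelianBounded {N : ℕ} (p : ℕ) (c : CircWord N) : Prop :=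
  IsLeast {q : ℕ | ∀ n : ℕ, 1 ≤ n → n ≤ c.length → circAb n c ≤ (q : ℕ∞)} p

/-- The words in which all the `N` letters occur. -/
def fullWords (N : ℕ) : Set (Word N) := {w | ab 1 w = (N : ℕ∞)}

/-- The balanced circular words in which all the `N` letters occur. -/
def balancedCircWords (N : ℕ) : Set (CircWord N) :=
  {c | c ∈ circ (fullWords N) ∧ IsCircBalanced c}

/-- The abelian-`p`-bounded circular words in which all the `N` letters occur. -/
def abelianBoundedCircWords (N p : ℕ) : Set (CircWord N) :=
  {c | c ∈ circ (fullWords N) ∧ IsAbelianBounded p c}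

/-- The first `n` letters, read from the lattice point `(x, y)` on, of the path below the line
`y = (h / k) x`: the vertical step `1` is made whenever it does not lead strictly above the line,
i.e. whenever `y + 1 ≤ (h / k) x`, and the horizontal step `0` otherwise. -/
def lowerPath (k h : ℕ) : (n x y : ℕ) → Word 2
  | 0, _, _ => []
  | n + 1, x, y =>
    if k * (y + 1) ≤ h * x then 1 :: lowerPath k h n x (y + 1)
    else 0 :: lowerPath k h n (x + 1) y

/-- The (lower) Christoffel word `C(k, h)`, for coprime positive `k` and `h`: the path from
`(0, 0)` to `(k, h)`, which is the next lattice point on the line. -/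
def christoffel (k h : ℕ) : Word 2 := lowerPath k h (k + h) 0 0

/-- Auxiliary to `phi`; the flag records whether the next `0` is an even one. -/
def phiAux : Bool → Word 2 → Word 3
  | _, [] => []
  | b, a :: w =>
    if a = 1 then 2 :: phiAux b w
    else (if b then 1 else 0) :: phiAux (!b) w

/-- The map `φ`: each `1` is replaced by `2`, and the second, fourth, sixth, … `0` by `1`. -/
def phi (w : Word 2) : Word 3 := phiAux false w

/-- The power `(0 Q 1)^p`, `p = s.length + 1`, with `10` replaced by `01` at those of the `p - 1`
borders between consecutive factors `0 Q 1` where the list `s` has the entry `true`. -/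
def twist (Q : Word 2) (s : List Bool) : Word 2 :=
  [0] ++ Q ++ s.flatMap (fun t => (if t then [0, 1] else [1, 0]) ++ Q) ++ [1]

/-- The twisted words: powers of a Christoffel word `0 Q 1` with an even number of `0`s, with
`10` replaced by `01` at one or more of the borders between consecutive factors. -/
def twistedWords : Set (Word 2) :=
  {w | ∃ k h : ℕ, 0 < k ∧ 0 < h ∧ Nat.Coprime k h ∧ Even k ∧
    ∃ Q : Word 2, christoffel k h = [0] ++ Q ++ [1] ∧
      ∃ s : List Bool, true ∈ s ∧ w = twist Q s}

/-- The circular words obtained from `[01210]` by permutations of the alphabet. -/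
def exceptionalPrimitive : Set (CircWord 3) :=
  permImages {(([0, 1, 2, 1, 0] : Word 3) : CircWord 3)}

/-- All the powers of the words in `exceptionalPrimitive`. -/
def exceptionalCircWords : Set (CircWord 3) :=
  {c | ∃ d ∈ exceptionalPrimitive, ∃ p : ℕ, 1 ≤ p ∧ IsCircPow c d p}

end CircularWords

/-! ### Letter counts in windows of bi-infinite words. -/

namespace CircularWords

/-! A circular word of length `N` is read as an `N`-periodic function `f` on `ℤ`; boundedness and
balance become the statements `AtMostThree` and `BalancedAt` about windows. Balance implies at most
three Parikh vectors (`BalancedAt.atMostThree`): each count takes two consecutive values, and the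
counts have a fixed sum.

Conversely, let `f` have at most three vectors at each length, and let `n` be the least length at
which balance fails. Sliding a window by one place exchanges at most one letter for another, so
three vectors in which some letter, say 0, varies by two form a path low, middle, high
(`exists_path_of_not_balanced`). The letters that 0 replaces in the two steps of this path are
different (`Bent`) or equal (`Straight`).

Bent case. If `n = 2`, the lengths 3 and 4 force the period 00212 (`Bent.two`). If `n > 2`, the 2s
of the word can be matched with those of its shift by `n` so that partners have `v1` letters 1
between them (`Bent.matching`). Summing over a period gives `v1 * |w|₂ = v2 * |w|₁`, whereas
averaging the counts over all windows gives a strict inequality (`Bent.false_of_balanced`).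

Straight case. The number of 1s is constant, so the 1s recur with period `n`, and the lengths `n -
1`, `n + 1` and 2 determine the letters around the extremal windows (`Straight.letters`). Since
shorter windows are balanced, the surplus of a high window over a low one splits evenly between
prefix and suffix; hence the prefix counts are roundings of linear functions (`Twisted.two_bounds`,
`Twisted.zero_bounds`). An argument modulo `n` shows that 1 is as frequent as 0 or 2
(`frequencies`). If it is as frequent as 0, the extremal windows lie in one residue class modulo
`n`; all blocks between these borders agree, and at the borders only 20 and 02 alternate. This is
the image under `φ` of a twisted Christoffel path (`Twisted.eq_twistedLetter`).

For the other inclusions, twisted paths still rise by two consecutive amounts over lengths that are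
not multiples of `n` (`twistedHeight_sub`), which leaves three vectors
(`atMostThree_twistedLetter`); the exceptional word is checked modulo 5. Twisted words are
unbalanced at length `n`, exceptional ones at length 2, and the doubled letter of 00212 separates
these two classes. -/

/-- The indicator of `b = a`. -/
def ind {N : ℕ} (b a : Fin N) : ℤ := if b = a then 1 else 0

/-- The number of occurrences of `a` in `f 0, …, f (x - 1)`, extended to negative `x` so that
the differences count the occurrences between two positions. -/
noncomputable def prefixCount {N : ℕ} (f : ℤ → Fin N) (a : Fin N) (x : ℤ) : ℤ :=
  ∑ i ∈ Finset.Ico 0 x, ind (f i) a - ∑ i ∈ Finset.Ico x 0, ind (f i) a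

/-- The number of occurrences of `a` in the window of length `m` that starts at `x`. -/
noncomputable def wc {N : ℕ} (f : ℤ → Fin N) (a : Fin N) (m x : ℤ) : ℤ :=
  prefixCount f a (x + m) - prefixCount f a x

section counts
variable {N : ℕ} (f : ℤ → Fin N) (a : Fin N)

theorem prefixCount_succ (x : ℤ) : prefixCount f a (x + 1) = prefixCount f a x + ind (f x) a := by
  unfold prefixCount
  rcases le_or_gt 0 x with h | h
  · have h1 : Finset.Ico 0 (x + 1) = insert x (Finset.Ico 0 x) := by
      ext i; simp only [Finset.mem_Ico, Finset.mem_insert]; omega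
    rw [h1, Finset.sum_insert (by simp), Finset.Ico_eq_empty (a := x) (by omega),
      Finset.Ico_eq_empty (a := x + 1) (by omega)]
    simp only [Finset.sum_empty]; ring
  · have h1 : Finset.Ico x 0 = insert x (Finset.Ico (x + 1) 0) := by
      ext i; simp only [Finset.mem_Ico, Finset.mem_insert]; omega
    rw [h1, Finset.sum_insert (by simp), Finset.Ico_eq_empty (b := x) (by omega),
      Finset.Ico_eq_empty (b := x + 1) (by omega)]
    simp only [Finset.sum_empty]; ring

theorem wc_zero (x : ℤ) : wc f a 0 x = 0 := by simp [wc]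

theorem wc_succ (m x : ℤ) : wc f a (m + 1) x = wc f a m x + ind (f (x + m)) a := by
  unfold wc; rw [← add_assoc, prefixCount_succ]; ring

theorem wc_succ' (m x : ℤ) : wc f a (m + 1) x = ind (f x) a + wc f a m (x + 1) := by
  unfold wc
  rw [prefixCount_succ, show x + (m + 1) = x + 1 + m by ring]; ring

theorem wc_shift (m x : ℤ) :
    wc f a m (x + 1) = wc f a m x + ind (f (x + m)) a - ind (f x) a := by
  have h1 := wc_succ f a m x
  have h2 := wc_succ' f a m x
  omega

theorem wc_add (m k x : ℤ) : wc f a (m + k) x = wc f a m x + wc f a k (x + m) := by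
  unfold wc; rw [← add_assoc]; ring

theorem wc_one (x : ℤ) : wc f a 1 x = ind (f x) a := by
  have := wc_succ f a 0 x; simpa [wc_zero] using this

theorem wc_two (x : ℤ) : wc f a 2 x = ind (f x) a + ind (f (x + 1)) a := by
  have := wc_succ f a 1 x; rw [wc_one] at this; simpa using this

theorem wc_pred (m x : ℤ) : wc f a (m - 1) x = wc f a m x - ind (f (x + m - 1)) a := by
  have := wc_succ f a (m - 1) x
  rw [sub_add_cancel, show x + (m - 1) = x + m - 1 by ring] at this; omega

theorem wc_pred' (m x : ℤ) : wc f a (m - 1) (x + 1) = wc f a m x - ind (f x) a := by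
  have := wc_succ' f a (m - 1) x
  rw [sub_add_cancel] at this; omega

/-- A function on `ℤ` with vanishing differences is constant. -/
theorem eq_of_forall_succ_eq {α : Type*} {D : ℤ → α} (h : ∀ x, D (x + 1) = D x) (x y : ℤ) :
    D x = D y := by
  have : ∀ x, D x = D 0 := fun x => by
    induction x using Int.induction_on with
    | zero => rfl
    | succ i ih => rw [h, ih]
    | pred i ih => rw [← ih, ← h (-(i : ℤ) - 1), sub_add_cancel]
  rw [this x, this y]

variable {f}

theorem wc_periodic {q : ℤ} (hq : ∀ x, f (x + q) = a ↔ f x = a) (m x : ℤ) :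
    wc f a m (x + q) = wc f a m x := by
  have h1 : ∀ x, (fun x => prefixCount f a (x + q) - prefixCount f a x) (x + 1) =
      (fun x => prefixCount f a (x + q) - prefixCount f a x) x := fun x => by
    simp only
    rw [show x + 1 + q = x + q + 1 by ring, prefixCount_succ, prefixCount_succ]
    have : ind (f (x + q)) a = ind (f x) a := by simp only [ind, hq x]
    omega
  have := eq_of_forall_succ_eq
    (D := fun x => prefixCount f a (x + q) - prefixCount f a x) h1 (x + m) x
  unfold wc
  rw [show x + q + m = x + m + q by ring]; omega

/-- The number of occurrences in a window of the length of a period is constant. -/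
theorem wc_const_of_periodic {q : ℤ} (hq : ∀ x, f (x + q) = a ↔ f x = a) (x y : ℤ) :
    wc f a q x = wc f a q y := by
  apply eq_of_forall_succ_eq (D := wc f a q)
  intro x
  have : ind (f (x + q)) a = ind (f x) a := by simp only [ind, hq x]
  rw [wc_shift]; omega

variable (f)
theorem ind_nonneg (b : Fin N) : 0 ≤ ind b a := by unfold ind; split <;> omega
theorem ind_le_one (b : Fin N) : ind b a ≤ 1 := by unfold ind; split <;> omega
theorem ind_eq_one {a b : Fin N} : ind b a = 1 ↔ b = a := by unfold ind; split <;> simp_all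
theorem ind_eq_zero {a b : Fin N} : ind b a = 0 ↔ b ≠ a := by unfold ind; split <;> simp_all

theorem wc_le_wc_of_le {m k : ℤ} (x : ℤ) (h : m ≤ k) : wc f a m x ≤ wc f a k x := by
  obtain ⟨d, rfl⟩ := Int.le.dest h
  induction d with
  | zero => simp
  | succ d ih =>
    have := wc_succ f a (m + d) x
    have h2 := ind_nonneg a (f (x + (m + d)))
    have := ih (by omega)
    push_cast; rw [← add_assoc]; omega

theorem wc_nonneg {m : ℤ} (hm : 0 ≤ m) (x : ℤ) : 0 ≤ wc f a m x := by
  have := wc_le_wc_of_le f a x hm; rwa [wc_zero] at this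

theorem wc_pos {m x i : ℤ} (h0 : 0 ≤ i) (h : i < m) (hi : f (x + i) = a) : 0 < wc f a m x := by
  have h1 := wc_le_wc_of_le f a x (show i + 1 ≤ m by omega)
  have h2 := wc_succ f a i x
  have h3 := wc_nonneg f a h0 x
  rw [ind_eq_one.2 hi] at h2; omega

end counts

/-- The four indicators at a letter of a ternary alphabet. -/
theorem letter_cases (b : Fin 3) :
    (b = 0 ∧ ind b 0 = 1 ∧ ind b 1 = 0 ∧ ind b 2 = 0) ∨
    (b = 1 ∧ ind b 0 = 0 ∧ ind b 1 = 1 ∧ ind b 2 = 0) ∨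
    (b = 2 ∧ ind b 0 = 0 ∧ ind b 1 = 0 ∧ ind b 2 = 1) := by
  revert b; decide

theorem wc_sum (f : ℤ → Fin 3) (m x : ℤ) : wc f 0 m x + wc f 1 m x + wc f 2 m x = m := by
  have h : ∀ m, (fun m => wc f 0 m x + wc f 1 m x + wc f 2 m x - m) (m + 1) =
      (fun m => wc f 0 m x + wc f 1 m x + wc f 2 m x - m) m := fun m => by
    simp only [wc_succ]
    have := letter_cases (f (x + m)); omega
  have := eq_of_forall_succ_eq
    (D := fun m => wc f 0 m x + wc f 1 m x + wc f 2 m x - m) h m 0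
  simp only [wc_zero] at this; omega

/-- The Parikh vector of the window of length `m` that starts at `x`. -/
noncomputable def vec {N : ℕ} (f : ℤ → Fin N) (m x : ℤ) : Fin N → ℤ := fun a => wc f a m x

/-- The windows of length `m` have at most three Parikh vectors. -/
def AtMostThree {N : ℕ} (f : ℤ → Fin N) (m : ℤ) : Prop :=
  ∀ x y z t : ℤ, vec f m x ≠ vec f m y → vec f m x ≠ vec f m z → vec f m y ≠ vec f m z →
    vec f m t = vec f m x ∨ vec f m t = vec f m y ∨ vec f m t = vec f m z

/-- The numbers of occurrences of a letter in two windows of length `m` differ by at most one. -/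
def BalancedAt {N : ℕ} (f : ℤ → Fin N) (m : ℤ) : Prop :=
  ∀ (a : Fin N) (x y : ℤ), wc f a m x ≤ wc f a m y + 1

theorem vec_eq_iff {f : ℤ → Fin 3} {m x y : ℤ} : vec f m x = vec f m y ↔
    wc f 0 m x = wc f 0 m y ∧ wc f 1 m x = wc f 1 m y ∧ wc f 2 m x = wc f 2 m y := by
  constructor
  · intro h; exact ⟨congrFun h 0, congrFun h 1, congrFun h 2⟩
  · rintro ⟨h0, h1, h2⟩; funext a; fin_cases a <;> assumption

/-- Permuting the letters permutes the numbers of occurrences. -/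
theorem wc_perm {N : ℕ} (σ : Equiv.Perm (Fin N)) (f : ℤ → Fin N) (a : Fin N) (m x : ℤ) :
    wc (fun i => σ (f i)) (σ a) m x = wc f a m x := by
  have h : ∀ b c : Fin N, ind (σ b) (σ c) = ind b c := fun b c => by simp [ind]
  simp only [wc, prefixCount, h]

theorem wc_perm' {N : ℕ} (σ : Equiv.Perm (Fin N)) (f : ℤ → Fin N) (a : Fin N) (m x : ℤ) :
    wc (fun i => σ (f i)) a m x = wc f (σ.symm a) m x := by
  rw [← wc_perm σ f, Equiv.apply_symm_apply]

theorem vec_perm {N : ℕ} (σ : Equiv.Perm (Fin N)) (f : ℤ → Fin N) (m x y : ℤ) :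
    vec (fun i => σ (f i)) m x = vec (fun i => σ (f i)) m y ↔ vec f m x = vec f m y := by
  constructor
  · intro h; funext a
    have := congrFun h (σ a); simpa only [vec, wc_perm] using this
  · intro h; funext a
    have := congrFun h (σ.symm a); simpa only [vec, wc_perm'] using this

theorem AtMostThree.perm {N : ℕ} {f : ℤ → Fin N} {m : ℤ} (h : AtMostThree f m)
    (σ : Equiv.Perm (Fin N)) : AtMostThree (fun i => σ (f i)) m := by
  intro x y z t
  simp only [ne_eq, vec_perm]
  exact h x y z t

theorem BalancedAt.perm {N : ℕ} {f : ℤ → Fin N} {m : ℤ} (h : BalancedAt f m)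
    (σ : Equiv.Perm (Fin N)) : BalancedAt (fun i => σ (f i)) m := by
  intro a x y
  rw [wc_perm', wc_perm']; exact h _ x y

/-! ### Crossing arguments and the shape of an unbalanced spectrum. -/

/-- A property that holds at some integer and fails at a later one fails for the first time. -/
theorem exists_switch {p : ℤ → Prop} {y z : ℤ} (hy : p y) (hz : ¬ p z) (h : y ≤ z) :
    ∃ x, y ≤ x ∧ x < z ∧ p x ∧ ¬ p (x + 1) := by
  by_contra! hc
  have : ∀ d : ℕ, y + d ≤ z → p (y + d) := fun d => by
    induction d with
    | zero => intro _; simpa using hy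
    | succ d ih =>
      intro hd; push_cast at hd ⊢; rw [← add_assoc]
      exact hc _ (by omega) (by omega) (ih (by omega))
  have h2 := this (z - y).toNat (by omega)
  rw [show y + ((z - y).toNat : ℤ) = z by omega] at h2
  exact hz h2

theorem periodic_mul {α : Type*} {f : ℤ → α} {N : ℤ} (hf : ∀ x, f (x + N) = f x) (x k : ℤ) :
    f (x + k * N) = f x := by
  induction k using Int.induction_on with
  | zero => simp
  | succ i ih => rw [← ih, ← hf (x + i * N)]; congr 1; ring
  | pred i ih => rw [← ih, ← hf (x + (-(i : ℤ) - 1) * N)]; congr 1; ring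

/-- A periodic property that holds somewhere and fails somewhere fails for the first time
somewhere. -/
theorem exists_switch_of_periodic {p : ℤ → Prop} {N : ℤ} (hN : 0 < N) (hp : ∀ x, p (x + N) ↔ p x)
    {y z : ℤ} (hy : p y) (hz : ¬ p z) : ∃ x, p x ∧ ¬ p (x + 1) := by
  have h : ∀ x k, p (x + k * N) = p x := periodic_mul (fun x => propext (hp x))
  -- Moving `z` by `|y - z|` periods brings it to the right of `y`.
  obtain ⟨x, -, -, h1, h2⟩ := exists_switch (p := p) (y := y) (z := z + |y - z| * N) hy
    (by rw [h]; exact hz) (by nlinarith [le_abs_self (y - z), abs_nonneg (y - z)])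
  exact ⟨x, h1, h2⟩

/-- A periodic property that is inherited by the successor holds everywhere. -/
theorem forall_of_periodic {p : ℤ → Prop} {N : ℤ} (hN : 0 < N) (hp : ∀ x, p (x + N) ↔ p x)
    {y : ℤ} (hy : p y) (h : ∀ x, p x → p (x + 1)) (z : ℤ) : p z := by
  by_contra hz
  obtain ⟨x, h1, h2⟩ := exists_switch_of_periodic hN hp hy hz
  exact h2 (h x h1)

/-- The Parikh vectors of the windows of length `n` are `v - e₀ + e₁`, `v` and `v + e₀ - e₂`. -/
structure Bent (f : ℤ → Fin 3) (n v0 v1 v2 : ℤ) : Prop where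
  state : ∀ x, (wc f 0 n x = v0 - 1 ∧ wc f 1 n x = v1 + 1 ∧ wc f 2 n x = v2) ∨
    (wc f 0 n x = v0 ∧ wc f 1 n x = v1 ∧ wc f 2 n x = v2) ∨
    (wc f 0 n x = v0 + 1 ∧ wc f 1 n x = v1 ∧ wc f 2 n x = v2 - 1)
  low : ∃ x, wc f 0 n x = v0 - 1
  high : ∃ x, wc f 0 n x = v0 + 1

/-- The Parikh vectors of the windows of length `n` are `v - e₀ + e₂`, `v` and `v + e₀ - e₂`. -/
structure Straight (f : ℤ → Fin 3) (n v0 v1 v2 : ℤ) : Prop where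
  state : ∀ x, (wc f 0 n x = v0 - 1 ∧ wc f 1 n x = v1 ∧ wc f 2 n x = v2 + 1) ∨
    (wc f 0 n x = v0 ∧ wc f 1 n x = v1 ∧ wc f 2 n x = v2) ∨
    (wc f 0 n x = v0 + 1 ∧ wc f 1 n x = v1 ∧ wc f 2 n x = v2 - 1)
  low : ∃ x, wc f 0 n x = v0 - 1
  high : ∃ x, wc f 0 n x = v0 + 1

theorem exists_perm_bent : ∀ a b c : Fin 3, b ≠ a → c ≠ a → b ≠ c →
    ∃ σ : Equiv.Perm (Fin 3), σ.symm 0 = a ∧ σ.symm 1 = b ∧ σ.symm 2 = c := by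
  decide

theorem exists_perm_straight : ∀ a b : Fin 3, b ≠ a →
    ∃ σ : Equiv.Perm (Fin 3), σ.symm 0 = a ∧ σ.symm 1 ≠ a ∧ σ.symm 1 ≠ b ∧ σ.symm 2 = b := by
  decide

/-- Three Parikh vectors that are not balanced form a path. -/
theorem exists_path_of_not_balanced {f : ℤ → Fin 3} {N n : ℤ} (hN : 0 < N)
    (hf : ∀ x, f (x + N) = f x) (h3 : AtMostThree f n) (hb : ¬ BalancedAt f n) :
    ∃ σ : Equiv.Perm (Fin 3), ∃ v0 v1 v2 : ℤ,
      Bent (fun i => σ (f i)) n v0 v1 v2 ∨ Straight (fun i => σ (f i)) n v0 v1 v2 := by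
  unfold BalancedAt at hb
  push Not at hb
  obtain ⟨a, x, y, hxy⟩ := hb
  have hper : ∀ c x, wc f c n (x + N) = wc f c n x := fun c x =>
    wc_periodic c (fun x => by rw [hf]) n x
  obtain ⟨z, hz1, hz2⟩ := exists_switch_of_periodic
    (p := fun z => wc f a n z ≤ wc f a n y) hN (fun x => by rw [hper]) (y := y) (z := x) le_rfl
    (by omega)
  obtain ⟨z', hz1', hz2'⟩ := exists_switch_of_periodic
    (p := fun z => wc f a n z ≤ wc f a n y + 1) hN (fun x => by rw [hper]) (y := y) (z := x)
    (by omega) (by omega)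
  simp only [not_le] at hz1 hz2 hz1' hz2'
  have s1 := wc_shift f a n z
  have s2 := wc_shift f a n z'
  have b1 := ind_le_one a (f (z + n))
  have b2 := ind_le_one a (f (z' + n))
  have b3 := ind_nonneg a (f z)
  have b4 := ind_nonneg a (f z')
  have e1 : f (z + n) = a := ind_eq_one.1 (by omega)
  have e2 : f (z' + n) = a := ind_eq_one.1 (by omega)
  have e3 : f z ≠ a := ind_eq_zero.1 (by omega)
  have e4 : f z' ≠ a := ind_eq_zero.1 (by omega)
  have ne : ∀ s t, wc f a n s ≠ wc f a n t → vec f n s ≠ vec f n t :=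
    fun s t h h' => h (congrFun h' a)
  -- The count of `a` at `z`, `z + 1`, `z' + 1` takes three consecutive values, starting with that
  -- at `y`; these windows exhaust the spectrum.
  have hall := fun t => h3 z (z + 1) (z' + 1) t (ne _ _ (by omega)) (ne _ _ (by omega))
    (ne _ _ (by omega))
  have hmid : vec f n z' = vec f n (z + 1) := by
    rcases hall z' with h | h | h
    · exact absurd h (ne _ _ (by omega))
    · exact h
    · exact absurd h (ne _ _ (by omega))
  have k1 : ∀ d, wc f d n z = wc f d n (z + 1) - ind a d + ind (f z) d := fun d => by
    rw [wc_shift, e1]; ring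
  have k2 : ∀ d, wc f d n (z' + 1) = wc f d n (z + 1) + ind a d - ind (f z') d := fun d => by
    rw [wc_shift, e2, show wc f d n z' = wc f d n (z + 1) from congrFun hmid d]
  have key : ∀ t, (∀ d, wc f d n t = wc f d n (z + 1) - ind a d + ind (f z) d) ∨
      (∀ d, wc f d n t = wc f d n (z + 1)) ∨
      (∀ d, wc f d n t = wc f d n (z + 1) + ind a d - ind (f z') d) := fun t => by
    rcases hall t with h | h | h
    · left; intro d; rw [← k1]; exact congrFun h d
    · right; left; intro d; exact congrFun h d
    · right; right; intro d; rw [← k2]; exact congrFun h d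
  -- `f z` and `f z'` are the letters that `a` replaces on the way from low to middle and from
  -- middle to high.
  by_cases hbc : f z = f z'
  · obtain ⟨σ, p0, p1, p1', p2⟩ := exists_perm_straight a (f z) e3
    have i0 : ind a (σ.symm 0) = 1 := ind_eq_one.2 p0.symm
    have i1 : ind a (σ.symm 1) = 0 := ind_eq_zero.2 p1.symm
    have i2 : ind a (σ.symm 2) = 0 := ind_eq_zero.2 (by rw [p2]; exact e3.symm)
    have j0 : ind (f z) (σ.symm 0) = 0 := ind_eq_zero.2 (by rw [p0]; exact e3)
    have j1 : ind (f z) (σ.symm 1) = 0 := ind_eq_zero.2 p1'.symm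
    have j2 : ind (f z) (σ.symm 2) = 1 := ind_eq_one.2 p2.symm
    refine ⟨σ, wc f (σ.symm 0) n (z + 1), wc f (σ.symm 1) n (z + 1), wc f (σ.symm 2) n (z + 1),
      Or.inr ⟨fun t => ?_, ⟨z, ?_⟩, ⟨z' + 1, ?_⟩⟩⟩
    · simp only [wc_perm']
      rcases key t with h | h | h
      · left; rw [h, h, h]; omega
      · right; left; rw [h, h, h]; omega
      · right; right; rw [h, h, h, ← hbc]; omega
    · rw [wc_perm', k1]; omega
    · rw [wc_perm', k2, ← hbc]; omega
  · obtain ⟨σ, p0, p1, p2⟩ := exists_perm_bent a (f z) (f z') e3 e4 hbc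
    have i0 : ind a (σ.symm 0) = 1 := ind_eq_one.2 p0.symm
    have i1 : ind a (σ.symm 1) = 0 := ind_eq_zero.2 (by rw [p1]; exact e3.symm)
    have i2 : ind a (σ.symm 2) = 0 := ind_eq_zero.2 (by rw [p2]; exact e4.symm)
    have j0 : ind (f z) (σ.symm 0) = 0 := ind_eq_zero.2 (by rw [p0]; exact e3)
    have j1 : ind (f z) (σ.symm 1) = 1 := ind_eq_one.2 p1.symm
    have j2 : ind (f z) (σ.symm 2) = 0 := ind_eq_zero.2 (by rw [p2]; exact hbc)
    have l0 : ind (f z') (σ.symm 0) = 0 := ind_eq_zero.2 (by rw [p0]; exact e4)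
    have l1 : ind (f z') (σ.symm 1) = 0 := ind_eq_zero.2 (by rw [p1]; exact Ne.symm hbc)
    have l2 : ind (f z') (σ.symm 2) = 1 := ind_eq_one.2 p2.symm
    refine ⟨σ, wc f (σ.symm 0) n (z + 1), wc f (σ.symm 1) n (z + 1), wc f (σ.symm 2) n (z + 1),
      Or.inl ⟨fun t => ?_, ⟨z, ?_⟩, ⟨z' + 1, ?_⟩⟩⟩
    · simp only [wc_perm']
      rcases key t with h | h | h
      · left; rw [h, h, h]; omega
      · right; left; rw [h, h, h]; omega
      · right; right; rw [h, h, h]; omega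
    · rw [wc_perm', k1]; omega
    · rw [wc_perm', k2]; omega

/-- In a window set with three Parikh vectors, given by three windows, there are no others. -/
theorem AtMostThree.elim {f : ℤ → Fin 3} {m : ℤ} (h : AtMostThree f m) {x y z : ℤ}
    (hxy : vec f m x ≠ vec f m y) (hxz : vec f m x ≠ vec f m z) (hyz : vec f m y ≠ vec f m z)
    (t : ℤ) :
    (wc f 0 m t = wc f 0 m x ∧ wc f 1 m t = wc f 1 m x ∧ wc f 2 m t = wc f 2 m x) ∨
    (wc f 0 m t = wc f 0 m y ∧ wc f 1 m t = wc f 1 m y ∧ wc f 2 m t = wc f 2 m y) ∨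
    (wc f 0 m t = wc f 0 m z ∧ wc f 1 m t = wc f 1 m z ∧ wc f 2 m t = wc f 2 m z) := by
  have := h x y z t hxy hxz hyz
  simpa only [vec_eq_iff] using this

theorem vec_ne_of {f : ℤ → Fin 3} {m x y : ℤ} (a : Fin 3) (h : wc f a m x ≠ wc f a m y) :
    vec f m x ≠ vec f m y := fun h' => h (congrFun h' a)

/-- The possible indicators at a letter of a ternary alphabet. -/
theorem ind_cases (b : Fin 3) :
    (ind b 0 = 1 ∧ ind b 1 = 0 ∧ ind b 2 = 0) ∨ (ind b 0 = 0 ∧ ind b 1 = 1 ∧ ind b 2 = 0) ∨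
    (ind b 0 = 0 ∧ ind b 1 = 0 ∧ ind b 2 = 1) := by
  revert b; decide

theorem sum_ind {N : ℕ} (f : ℤ → Fin N) (a : Fin N) (M : ℕ) (x : ℤ) :
    ∑ i ∈ Finset.range M, ind (f (x + i)) a = wc f a M x := by
  induction M with
  | zero => simp [wc_zero]
  | succ M ih => rw [Finset.sum_range_succ, ih]; push_cast; rw [wc_succ]

/-- Double counting of the occurrences of a letter in the windows of a periodic word. -/
theorem sum_wc {N : ℕ} {f : ℤ → Fin N} {M : ℕ} (hf : ∀ x, f (x + M) = f x) (a : Fin N)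
    (n y : ℤ) : ∑ i ∈ Finset.range M, wc f a n (y + i) = n * wc f a M y := by
  have h : ∀ n, (fun n => ∑ i ∈ Finset.range M, wc f a n (y + i) - n * wc f a M y) (n + 1) =
      (fun n => ∑ i ∈ Finset.range M, wc f a n (y + i) - n * wc f a M y) n := fun n => by
    have h1 : ∑ i ∈ Finset.range M, ind (f (y + i + n)) a = wc f a M y := by
      rw [← wc_const_of_periodic a (fun x => by rw [hf]) (y + n) y, ← sum_ind]
      exact Finset.sum_congr rfl fun i _ => by rw [add_right_comm]
    simp only [wc_succ, Finset.sum_add_distrib, h1]; ring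
  have := eq_of_forall_succ_eq
    (D := fun n => ∑ i ∈ Finset.range M, wc f a n (y + i) - n * wc f a M y) h n 0
  simp only [wc_zero] at this
  simp only [Finset.sum_const_zero] at this
  omega

/-! ### Bent spectra at lengths above two. -/

section
variable {f : ℤ → Fin 3} {n v0 v1 v2 : ℤ} {N : ℕ}

theorem wc_periodic_of {f : ℤ → Fin 3} {N : ℤ} (hf : ∀ x, f (x + N) = f x) (a : Fin 3)
    (m x : ℤ) : wc f a m (x + N) = wc f a m x :=
  wc_periodic a (fun x => by rw [hf]) m x

theorem Bent.exists_leave_low (h : Bent f n v0 v1 v2) (hN : 0 < N) (hf : ∀ x, f (x + N) = f x) :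
    ∃ z, wc f 0 n z = v0 - 1 ∧ ind (f z) 1 = 1 ∧ ind (f (z + n)) 0 = 1 := by
  obtain ⟨x, hx⟩ := h.low
  obtain ⟨y, hy⟩ := h.high
  obtain ⟨z, h1, h2⟩ := exists_switch_of_periodic (p := fun z => wc f 0 n z = v0 - 1)
    (Int.natCast_pos.2 hN) (fun x => by rw [wc_periodic_of hf]) hx (z := y) (by omega)
  refine ⟨z, h1, ?_⟩
  have := ind_cases (f z)
  have := ind_cases (f (z + n))
  have := h.state z
  have := h.state (z + 1)
  have := wc_shift f 0 n z
  have := wc_shift f 1 n z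
  have := wc_shift f 2 n z
  omega

theorem Bent.exists_enter_low (h : Bent f n v0 v1 v2) (hN : 0 < N) (hf : ∀ x, f (x + N) = f x) :
    ∃ z, wc f 0 n z = v0 ∧ ind (f z) 0 = 1 ∧ ind (f (z + n)) 1 = 1 := by
  obtain ⟨x, hx⟩ := h.low
  obtain ⟨y, hy⟩ := h.high
  obtain ⟨z, h1, h2⟩ := exists_switch_of_periodic (p := fun z => wc f 0 n z ≠ v0 - 1)
    (Int.natCast_pos.2 hN) (fun x => by rw [wc_periodic_of hf]) (y := y) (z := x) (by omega)
    (by omega)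
  refine ⟨z, ?_⟩
  have := ind_cases (f z)
  have := ind_cases (f (z + n))
  have := h.state z
  have := h.state (z + 1)
  have := wc_shift f 0 n z
  have := wc_shift f 1 n z
  have := wc_shift f 2 n z
  omega

theorem Bent.exists_enter_high (h : Bent f n v0 v1 v2) (hN : 0 < N) (hf : ∀ x, f (x + N) = f x) :
    ∃ z, wc f 0 n z = v0 ∧ wc f 0 n (z + 1) = v0 + 1 ∧ ind (f z) 2 = 1 ∧
      ind (f (z + n)) 0 = 1 := by
  obtain ⟨x, hx⟩ := h.low
  obtain ⟨y, hy⟩ := h.high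
  obtain ⟨z, h1, h2⟩ := exists_switch_of_periodic (p := fun z => wc f 0 n z ≠ v0 + 1)
    (Int.natCast_pos.2 hN) (fun x => by rw [wc_periodic_of hf]) (y := x) (z := y) (by omega)
    (by omega)
  refine ⟨z, ?_⟩
  have := ind_cases (f z)
  have := ind_cases (f (z + n))
  have := h.state z
  have := h.state (z + 1)
  have := wc_shift f 0 n z
  have := wc_shift f 1 n z
  have := wc_shift f 2 n z
  omega

/-- Windows of length `n - 1` that are balanced determine the first letter of the windows of
length `n`. -/
theorem Bent.first_letter (h : Bent f n v0 v1 v2) (hN : 0 < N) (hf : ∀ x, f (x + N) = f x)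
    (hb : BalancedAt f (n - 1)) (x : ℤ) :
    (wc f 0 n x = v0 + 1 → ind (f x) 0 = 1) ∧ (wc f 0 n x = v0 - 1 → ind (f x) 0 = 0) := by
  obtain ⟨y, hy1, hy2, hy3⟩ := h.exists_leave_low hN hf
  obtain ⟨z, hz1, hz0, hz2, hz3⟩ := h.exists_enter_high hN hf
  have := ind_cases (f x)
  have := ind_cases (f y)
  have := ind_cases (f z)
  have := h.state x
  have := h.state y
  have := h.state z
  have e := fun a t => wc_pred' f a n t
  have := hb 0 (x + 1) (y + 1)
  have := hb 1 (x + 1) (y + 1)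
  have := hb 2 (x + 1) (y + 1)
  have := hb 0 (y + 1) (x + 1)
  have := hb 0 (x + 1) (z + 1)
  have := hb 1 (x + 1) (z + 1)
  have := hb 2 (x + 1) (z + 1)
  have := hb 0 (z + 1) (x + 1)
  have := hb 2 (z + 1) (x + 1)
  simp only [e] at *
  constructor <;> intro _ <;> omega

theorem ind_eq_of_one {b : Fin 3} :
    (ind b 0 = 1 → ind b 1 = 0 ∧ ind b 2 = 0) ∧ (ind b 1 = 1 → ind b 0 = 0 ∧ ind b 2 = 0) ∧
    (ind b 2 = 1 → ind b 0 = 0 ∧ ind b 1 = 0) := by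
  revert b; decide

theorem Bent.vals (h : Bent f n v0 v1 v2) (x : ℤ) :
    (wc f 0 n x = v0 - 1 → wc f 1 n x = v1 + 1 ∧ wc f 2 n x = v2) ∧
    (wc f 0 n x = v0 → wc f 1 n x = v1 ∧ wc f 2 n x = v2) ∧
    (wc f 0 n x = v0 + 1 → wc f 1 n x = v1 ∧ wc f 2 n x = v2 - 1) := by
  have := h.state x
  refine ⟨?_, ?_, ?_⟩ <;> intro _ <;> omega

/-- A window of low state that starts with the letter `2` keeps its state. -/
theorem Bent.low_two_step (h : Bent f n v0 v1 v2) {x : ℤ} (hx : wc f 0 n x = v0 - 1)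
    (hx2 : ind (f x) 2 = 1) : ind (f (x + n)) 2 = 1 ∧ wc f 0 n (x + 1) = v0 - 1 := by
  have := ind_eq_of_one.2.2 hx2
  have := ind_cases (f (x + n))
  have := (h.vals x).1 hx
  have := h.state (x + 1)
  have := wc_shift f 0 n x
  have := wc_shift f 1 n x
  have := wc_shift f 2 n x
  omega

/-- The given window produces a third vector `v - e₀ + e₁ + e₂` at length `n + 1`, besides `v + e₀`
(on entering high) and `v + e₁` (on entering low). No other extension is then allowed. -/
theorem Bent.upper_of_low_two (h : Bent f n v0 v1 v2) (hN : 0 < N) (hf : ∀ x, f (x + N) = f x)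
    (h3 : AtMostThree f (n + 1)) {x : ℤ} (hx : wc f 0 n x = v0 - 1) (hx2 : ind (f x) 2 = 1)
    (t : ℤ) : (wc f 0 n t = v0 → ind (f (t + n)) 2 = 0) ∧
      (wc f 0 n t = v0 + 1 → ind (f (t + n)) 2 = 1) := by
  obtain ⟨z, hz1, hz0, hz2, hz3⟩ := h.exists_enter_high hN hf
  obtain ⟨w, hw1, hw2, hw3⟩ := h.exists_enter_low hN hf
  obtain ⟨hxn, -⟩ := h.low_two_step hx hx2
  obtain ⟨x1, x2⟩ := (h.vals x).1 hx
  obtain ⟨z1, z2⟩ := (h.vals z).2.1 hz1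
  obtain ⟨w1, w2⟩ := (h.vals w).2.1 hw1
  obtain ⟨x3, x4⟩ := ind_eq_of_one.2.2 hxn
  obtain ⟨z3, z4⟩ := ind_eq_of_one.1 hz3
  obtain ⟨w3, w4⟩ := ind_eq_of_one.2.1 hw3
  have upper := h3.elim (x := z) (y := w) (z := x)
    (vec_ne_of 0 (by rw [wc_succ, wc_succ]; omega)) (vec_ne_of 0 (by rw [wc_succ, wc_succ]; omega))
    (vec_ne_of 0 (by rw [wc_succ, wc_succ]; omega)) t
  simp only [wc_succ, hz1, hz3, hw1, hw3, hx, hxn, x1, x2, x3, x4, z1, z2, z3, z4, w1, w2, w3, w4]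
    at upper
  have c := ind_cases (f (t + n))
  constructor <;> intro ht
  · obtain ⟨t1, t2⟩ := (h.vals t).2.1 ht
    rw [ht, t1, t2] at upper
    clear * - upper c
    omega
  · obtain ⟨t1, t2⟩ := (h.vals t).2.2 ht
    rw [ht, t1, t2] at upper
    clear * - upper c
    omega

/-- At length `n - 1` the vectors `v - e₂`, `v - e₀` and `v - e₀ + e₁ - e₂` occur, which leaves no
room for `v - e₁`. -/
theorem Bent.lower_of_low_two (h : Bent f n v0 v1 v2) (hN : 0 < N) (hf : ∀ x, f (x + N) = f x)
    (h3 : AtMostThree f (n - 1)) {x : ℤ} (hx : wc f 0 n x = v0 - 1) (hx2 : ind (f x) 2 = 1)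
    (t : ℤ) (ht : wc f 0 n t = v0) : ind (f t) 1 = 0 := by
  obtain ⟨z, hz1, hz0, hz2, hz3⟩ := h.exists_enter_high hN hf
  obtain ⟨w, hw1, hw2, hw3⟩ := h.exists_leave_low hN hf
  obtain ⟨x1, x2⟩ := (h.vals x).1 hx
  obtain ⟨z1, z2⟩ := (h.vals z).2.1 hz1
  obtain ⟨w1, w2⟩ := (h.vals w).1 hw1
  obtain ⟨x3, x4⟩ := ind_eq_of_one.2.2 hx2
  obtain ⟨z3, z4⟩ := ind_eq_of_one.2.2 hz2
  obtain ⟨w3, w4⟩ := ind_eq_of_one.2.1 hw2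
  have lower := h3.elim (x := z + 1) (y := w + 1) (z := x + 1)
    (vec_ne_of 0 (by rw [wc_pred', wc_pred']; omega))
    (vec_ne_of 0 (by rw [wc_pred', wc_pred']; omega))
    (vec_ne_of 1 (by rw [wc_pred', wc_pred']; omega)) (t + 1)
  obtain ⟨t1, t2⟩ := (h.vals t).2.1 ht
  simp only [wc_pred', hz1, hz2, hw1, hw2, hx, hx2, x1, x2, x3, x4, z1, z2, z3, z4, w1, w2, w3, w4,
    ht, t1, t2] at lower
  have c := ind_cases (f t)
  clear * - lower c
  omega

/-- Windows of low state do not start with the letter `2`. -/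
theorem Bent.low_letter_ne_two (h : Bent f n v0 v1 v2) (hN : 0 < N) (hf : ∀ x, f (x + N) = f x)
    (hb : BalancedAt f (n - 1)) (hb2 : BalancedAt f 2) (h3 : AtMostThree f (n + 1))
    (h3' : AtMostThree f (n - 1)) {x : ℤ} (hx : wc f 0 n x = v0 - 1) : ind (f x) 2 ≠ 1 := by
  intro hx2
  have upper := h.upper_of_low_two hN hf h3 hx hx2
  have lower := h.lower_of_low_two hN hf h3' hx hx2
  have hx1 := (h.first_letter hN hf hb (x + 1)).2 (h.low_two_step hx hx2).2
  -- The factor at `x` consists of a 2 and of the first letter of a low window, so it has no 0;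
  -- balance at length two then excludes 00.
  have no00 : ∀ t, ind (f t) 0 + ind (f (t + 1)) 0 ≤ 1 := fun t => by
    have := hb2 0 t x
    rw [wc_two, wc_two, hx1, (ind_eq_of_one.2.2 hx2).1] at this
    omega
  obtain ⟨u, hu⟩ := h.high
  -- A high window loses a 0 and gains a 2; the exclusions then force it to lose a 2 and gain a 0.
  -- So high and middle alternate forever and low is never reached.
  have := forall_of_periodic
    (p := fun t => wc f 0 n t = v0 + 1 ∨ (wc f 0 n t = v0 ∧ wc f 0 n (t - 1) = v0 + 1))
    (Int.natCast_pos.2 hN) (fun t => by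
      rw [wc_periodic_of hf, show t + N - 1 = t - 1 + N by ring, wc_periodic_of hf])
    (y := u) (Or.inl hu) (fun t ht => by
      rw [add_sub_cancel_right]
      have e := wc_shift f 0 n t
      rcases ht with ht | ⟨ht, ht'⟩
      · right
        have h1 := (h.first_letter hN hf hb t).1 ht
        have h2 := ind_eq_of_one.2.2 ((upper t).2 ht)
        clear * - h1 h2 e ht
        omega
      · left
        have h1 := (upper t).1 ht
        have h2 := no00 (t - 1)
        have h3 := (h.first_letter hN hf hb (t - 1)).1 ht'
        have h4 := ind_cases (f t)
        have h5 := ind_cases (f (t + n))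
        have h6 := h.state (t + 1)
        have h8 := wc_shift f 2 n t
        have h9 := (h.vals t).2.1 ht
        have h10 := lower t ht
        rw [sub_add_cancel] at h2
        clear * - h1 h2 h3 h4 h5 h6 h8 h9 h10 ht e
        omega) x
  omega

/-- Windows of low state start with the letter `1` and are left immediately. -/
theorem Bent.low_step (h : Bent f n v0 v1 v2) (hN : 0 < N) (hf : ∀ x, f (x + N) = f x)
    (hb : BalancedAt f (n - 1)) (hb2 : BalancedAt f 2) (h3 : AtMostThree f (n + 1))
    (h3' : AtMostThree f (n - 1)) {x : ℤ} (hx : wc f 0 n x = v0 - 1) :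
    ind (f x) 1 = 1 ∧ ind (f (x + n)) 0 = 1 := by
  have key : ∀ t, wc f 0 n t = v0 - 1 → ind (f t) 1 = 1 := fun t ht => by
    have h1 := h.low_letter_ne_two hN hf hb hb2 h3 h3' ht
    have h2 := (h.first_letter hN hf hb t).2 ht
    have h3 := ind_cases (f t)
    clear * - h1 h2 h3
    omega
  refine ⟨key x hx, ?_⟩
  by_contra hn
  have h1 := ind_eq_of_one.2.1 (key x hx)
  have h2 := h.state (x + 1)
  have h4 := ind_cases (f (x + n))
  have h5 := wc_shift f 0 n x
  have h6 : wc f 0 n (x + 1) = v0 - 1 := by clear * - hn h1 h2 h4 h5 hx; omega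
  obtain ⟨z, hz1, hz0, hz2, hz3⟩ := h.exists_enter_high hN hf
  -- Entering high state exhibits the factor 20, which has no 1; so 11 would break balance at length
  -- two.
  have h7 := (ind_eq_of_one (b := f z)).2.2 hz2
  have h8 := ind_eq_of_one.1 ((h.first_letter hN hf hb (z + 1)).1 hz0)
  have h9 := hb2 1 x z
  rw [wc_two, wc_two, key x hx, key (x + 1) h6, h7.2, h8.1] at h9
  omega

end

section
variable {f : ℤ → Fin 3} {n v0 v1 v2 : ℤ} {N : ℕ}

/-- The occurrences of `2` in a word and in its shift by `n` are matched, with the same number of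
occurrences of `1` before them. -/
theorem Bent.matching (h : Bent f n v0 v1 v2)
    (hlow : ∀ x, wc f 0 n x = v0 - 1 → ind (f x) 1 = 1 ∧ ind (f (x + n)) 0 = 1)
    (hhigh : ∀ x, wc f 0 n x = v0 + 1 → ind (f x) 0 = 1) {y : ℤ} (hy : wc f 0 n y = v0) (m : ℕ) :
    (∑ i ∈ Finset.range m, ((prefixCount f 1 (y + i + n) - v1) * ind (f (y + i + n)) 2
      - prefixCount f 1 (y + i) * ind (f (y + i)) 2)) =
      if wc f 0 n (y + m) = v0 + 1 then -prefixCount f 1 (y + m) else 0 := by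
  induction m with
  | zero =>
    rw [if_neg (by simp [hy])]; simp
  | succ m ih =>
    rw [Finset.sum_range_succ, ih]
    push_cast
    rw [← add_assoc]
    generalize y + (m : ℤ) = x
    have hp : prefixCount f 1 (x + n) = prefixCount f 1 x + wc f 1 n x := by unfold wc; ring
    have hp' := prefixCount_succ f 1 x
    have e0 := wc_shift f 0 n x
    have e1 := wc_shift f 1 n x
    have e2 := wc_shift f 2 n x
    have s := h.state (x + 1)
    have c := ind_cases (f x)
    have c' := ind_cases (f (x + n))
    -- The right-hand side records a 2 that left the window on entering high state and has no
    -- partner yet. High windows start with 0, so the number of preceding 1s does not change until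
    -- the partner enters.
    rcases h.state x with ⟨s0, s1, s2⟩ | ⟨s0, s1, s2⟩ | ⟨s0, s1, s2⟩
    · obtain ⟨h1, h2⟩ := hlow x s0
      rw [if_neg (by omega), if_neg (by omega), (ind_eq_of_one.2.1 h1).2, (ind_eq_of_one.1 h2).2]
      ring
    · rw [if_neg (by omega)]
      have h12 : ind (f (x + n)) 2 = 1 → ind (f x) 2 = 1 := by omega
      rcases c with ⟨c0, c1, c2⟩ | ⟨c0, c1, c2⟩ | ⟨c0, c1, c2⟩
      · have : ind (f (x + n)) 2 = 0 := by omega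
        rw [if_neg (by omega), this, c2]; ring
      · have : ind (f (x + n)) 2 = 0 := by omega
        rw [if_neg (by omega), this, c2]; ring
      · by_cases h3 : ind (f (x + n)) 2 = 1
        · rw [if_neg (by omega), h3, c2, hp, s1]; ring
        · have h4 : ind (f (x + n)) 2 = 0 := by omega
          rw [if_pos (by omega), h4, c2, hp', c1]; ring
    · obtain ⟨h1, h2⟩ := ind_eq_of_one.1 (hhigh x s0)
      rw [if_pos s0, h2, hp, hp', h1, s1]
      by_cases h3 : ind (f (x + n)) 2 = 1
      · rw [if_neg (by omega), h3]; ring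
      · have h4 : ind (f (x + n)) 2 = 0 := by omega
        rw [if_pos (by omega), h4]; ring

/-- The sum `A` of the numbers of 1s before the 2s of a period is compared with that of the shifted
period in two ways. -/
theorem Bent.false_of_balanced (h : Bent f n v0 v1 v2) (hn : 0 ≤ n) (hN : 0 < N)
    (hf : ∀ x, f (x + N) = f x)
    (hb : BalancedAt f (n - 1)) (hb2 : BalancedAt f 2) (h3 : AtMostThree f (n + 1))
    (h3' : AtMostThree f (n - 1)) : False := by
  obtain ⟨y, hy, -⟩ := h.exists_enter_high hN hf
  obtain ⟨xl, hxl⟩ := h.low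
  obtain ⟨xh, hxh⟩ := h.high
  have hmatch := h.matching (fun x hx => h.low_step hN hf hb hb2 h3 h3' hx)
    (fun x hx => (h.first_letter hN hf hb x).1 hx) hy N
  rw [wc_periodic_of hf, if_neg (by omega)] at hmatch
  set A : ℤ → ℤ := fun x => ∑ i ∈ Finset.range N, prefixCount f 1 (x + i) * ind (f (x + i)) 2
    with hA
  -- By the matching, the shift adds `v1` for every 2 of the period.
  have h1 : A (y + n) - A y = v1 * wc f 2 N y := by
    have : wc f 2 N y = ∑ i ∈ Finset.range N, ind (f (y + i + n)) 2 := by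
      rw [← wc_const_of_periodic 2 (fun x => by rw [hf]) (y + n) y, ← sum_ind]
      exact Finset.sum_congr rfl fun i _ => by rw [add_right_comm]
    rw [this, Finset.mul_sum, hA]
    simp only
    rw [← sub_eq_zero, ← hmatch, ← Finset.sum_sub_distrib, ← Finset.sum_sub_distrib]
    refine Finset.sum_congr rfl fun i _ => ?_
    rw [show y + n + (i : ℤ) = y + i + n by ring]; ring
  -- Moving the start of the period past a 2 replaces that 2 by its copy one period later, a gain of
  -- all the 1s of a period; `n` moves pass `v2` such letters.
  have h2 : A (y + n) - A y = wc f 1 N y * v2 := by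
    have hs : ∀ x, (fun x => A x - wc f 1 N y * prefixCount f 2 x) (x + 1) =
        (fun x => A x - wc f 1 N y * prefixCount f 2 x) x := fun x => by
      have e1 := Finset.sum_range_succ
        (fun i : ℕ => prefixCount f 1 (x + i) * ind (f (x + i)) 2) N
      have e2 := Finset.sum_range_succ'
        (fun i : ℕ => prefixCount f 1 (x + i) * ind (f (x + i)) 2) N
      have e3 : ∑ i ∈ Finset.range N, prefixCount f 1 (x + (i + 1 : ℕ)) *
          ind (f (x + (i + 1 : ℕ))) 2 = A (x + 1) := Finset.sum_congr rfl fun i _ => by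
        push_cast; rw [show x + ((i : ℤ) + 1) = x + 1 + i by ring]
      have e4 : prefixCount f 1 (x + N) = prefixCount f 1 x + wc f 1 N y := by
        rw [wc_const_of_periodic 1 (fun x => by rw [hf]) y x]; unfold wc; ring
      rw [e3] at e2
      have e5 : A x = ∑ i ∈ Finset.range N, prefixCount f 1 (x + i) * ind (f (x + i)) 2 := rfl
      rw [← e5, hf, e4] at e1
      simp only [Nat.cast_zero, add_zero] at e2
      simp only [prefixCount_succ]
      linear_combination e1 - e2
    have := eq_of_forall_succ_eq (D := fun x => A x - wc f 1 N y * prefixCount f 2 x) hs (y + n) y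
    have h2 := ((h.vals y).2.1 hy).2
    unfold wc at h2 this ⊢
    rw [← h2]; linear_combination this
  -- Averaging over all windows: a bound that holds everywhere and is strict somewhere is strict on
  -- average. Low windows have an extra 1, high windows lack a 2.
  have key : ∀ (a : Fin 3) (b : ℤ) (xs : ℤ), (∀ x, b ≤ wc f a n x) → b < wc f a n xs →
      N * b < n * wc f a N y := fun a b xs hb hs => by
    have e : wc f a N y = wc f a N xs := wc_const_of_periodic a (fun x => by rw [hf]) y xs
    rw [e, ← sum_wc hf]
    calc (N : ℤ) * b = ∑ i ∈ Finset.range N, b := by simp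
      _ < _ := Finset.sum_lt_sum (fun i _ => hb _) ⟨0, by simpa using hN, by simpa using hs⟩
  have key' : ∀ (a : Fin 3) (b : ℤ) (xs : ℤ), (∀ x, wc f a n x ≤ b) → wc f a n xs < b →
      n * wc f a N y < N * b := fun a b xs hb hs => by
    have e : wc f a N y = wc f a N xs := wc_const_of_periodic a (fun x => by rw [hf]) y xs
    rw [e, ← sum_wc hf]
    calc _ < ∑ i ∈ Finset.range N, b :=
          Finset.sum_lt_sum (fun i _ => hb _) ⟨0, by simpa using hN, by simpa using hs⟩
      _ = _ := by simp
  have k1 := key 1 v1 xl (fun x => by have := h.state x; omega)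
    (by have := (h.vals xl).1 hxl; omega)
  have k2 := key' 2 v2 xh (fun x => by have := h.state x; omega)
    (by have := (h.vals xh).2.2 hxh; omega)
  have p1 : 0 ≤ v1 := by
    have := wc_nonneg f 1 hn y
    have := (h.vals y).2.1 hy; omega
  have p2 : 1 ≤ v2 := by
    have := wc_nonneg f 2 hn xh
    have := (h.vals xh).2.2 hxh; omega
  have e : v1 * wc f 2 N y = wc f 1 N y * v2 := h1.symm.trans h2
  nlinarith [mul_lt_mul_of_pos_right k1 (by omega : 0 < v2), mul_le_mul_of_nonneg_left k2.le p1]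

/-! ### Bent spectra at length two. -/

theorem wc_three (f : ℤ → Fin 3) (a : Fin 3) (x : ℤ) :
    wc f a 3 x = ind (f x) a + ind (f (x + 1)) a + ind (f (x + 2)) a := by
  rw [show (3 : ℤ) = 2 + 1 by norm_num, wc_succ, wc_two]

theorem wc_four (f : ℤ → Fin 3) (a : Fin 3) (x : ℤ) :
    wc f a 4 x = ind (f x) a + ind (f (x + 1)) a + ind (f (x + 2)) a + ind (f (x + 3)) a := by
  rw [show (4 : ℤ) = 3 + 1 by norm_num, wc_succ, wc_three]

/-- The factors of length two of a word with a bent spectrum at length two. -/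
theorem Bent.two_cases (h : Bent f 2 v0 v1 v2) (x : ℤ) :
    (ind (f x) 0 = 1 ∧ ind (f (x + 1)) 0 = 1) ∨ (ind (f x) 0 = 1 ∧ ind (f (x + 1)) 2 = 1) ∨
    (ind (f x) 2 = 1 ∧ ind (f (x + 1)) 0 = 1) ∨ (ind (f x) 2 = 1 ∧ ind (f (x + 1)) 1 = 1) ∨
    (ind (f x) 1 = 1 ∧ ind (f (x + 1)) 2 = 1) := by
  obtain ⟨y, hy⟩ := h.low
  obtain ⟨z, hz⟩ := h.high
  have h1 := (h.vals y).1 hy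
  have h2 := (h.vals z).2.2 hz
  have h3 := wc_sum f 2 z
  have h4 := wc_nonneg f 0 (by norm_num : (0 : ℤ) ≤ 2) y
  have h5 := wc_nonneg f 2 (by norm_num : (0 : ℤ) ≤ 2) z
  have h6 := wc_nonneg f 1 (by norm_num : (0 : ℤ) ≤ 2) z
  have h7 : v0 = 1 ∧ v1 = 0 ∧ v2 = 1 := by omega
  have h8 := h.state x
  rw [wc_two, wc_two, wc_two, h7.1, h7.2.1, h7.2.2] at h8
  have c := ind_cases (f x)
  have c' := ind_cases (f (x + 1))
  clear * - h8 c c'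
  omega

theorem Bent.two_exists (h : Bent f 2 v0 v1 v2) (hN : 0 < N) (hf : ∀ x, f (x + N) = f x) :
    (∃ x, ind (f x) 1 = 1) ∧
    (∃ x, ind (f x) 0 = 1 ∧ ind (f (x + 1)) 0 = 1 ∧ ind (f (x + 2)) 2 = 1) ∧
    (∃ x, ind (f x) 1 = 1 ∧ ind (f (x + 1)) 2 = 1 ∧ ind (f (x + 2)) 0 = 1) := by
  obtain ⟨x, -, hx1, -⟩ := h.exists_leave_low hN hf
  have hper : ∀ t : ℤ, f (t + N + 1) = f (t + 1) := fun t => by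
    rw [show t + N + 1 = t + 1 + N by ring, hf]
  obtain ⟨u, hu0, hu1⟩ : ∃ u, ind (f u) 0 = 1 ∧ ind (f (u + 1)) 0 = 1 := by
    obtain ⟨y, hy⟩ := h.low
    obtain ⟨z, hz⟩ := h.high
    refine ⟨z, ?_⟩
    have := h.two_cases z
    have := h.two_cases y
    have := wc_nonneg f 0 (by norm_num : (0 : ℤ) ≤ 2) y
    have := wc_two f 0 z
    have := ind_cases (f z)
    have := ind_cases (f (z + 1))
    omega
  refine ⟨⟨x, hx1⟩, ?_, ?_⟩
  · obtain ⟨t, ht1, ht2⟩ := exists_switch_of_periodic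
      (p := fun t => ind (f t) 0 = 1 ∧ ind (f (t + 1)) 0 = 1) (Int.natCast_pos.2 hN)
      (fun t => by rw [hf, hper]) ⟨hu0, hu1⟩ (z := x)
      (by have := ind_eq_of_one.2.1 hx1; omega)
    rw [show t + 1 + 1 = t + 2 by ring] at ht2
    have := h.two_cases (t + 1)
    rw [show t + 1 + 1 = t + 2 by ring] at this
    have := ind_cases (f (t + 1))
    exact ⟨t, by omega⟩
  · obtain ⟨t, ht1, ht2⟩ := exists_switch_of_periodic
      (p := fun t => ind (f t) 1 = 1 ∨ ind (f (t + 1)) 1 = 1) (Int.natCast_pos.2 hN)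
      (fun t => by rw [hf, hper]) (Or.inl hx1) (z := u)
      (by have := ind_eq_of_one.1 hu0; have := ind_eq_of_one.1 hu1; omega)
    rw [show t + 1 + 1 = t + 2 by ring] at ht2
    have h1 := h.two_cases (t + 1)
    have h2 := h.two_cases t
    rw [show t + 1 + 1 = t + 2 by ring] at h1
    have := ind_cases (f t)
    have := ind_cases (f (t + 1))
    have := ind_cases (f (t + 2))
    exact ⟨t, by omega⟩

/-- The factors 212 (around a 1), 002 and 120 occur and have different Parikh vectors. -/
theorem Bent.two_spec_three (h : Bent f 2 v0 v1 v2) (hN : 0 < N) (hf : ∀ x, f (x + N) = f x)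
    (h3 : AtMostThree f 3) (t : ℤ) :
    (wc f 0 3 t = 0 ∧ wc f 1 3 t = 1 ∧ wc f 2 3 t = 2) ∨
    (wc f 0 3 t = 2 ∧ wc f 1 3 t = 0 ∧ wc f 2 3 t = 1) ∨
    (wc f 0 3 t = 1 ∧ wc f 1 3 t = 1 ∧ wc f 2 3 t = 1) := by
  obtain ⟨⟨x, hx⟩, ⟨y, y0, y1, y2⟩, ⟨z, z0, z1, z2⟩⟩ := h.two_exists hN hf
  have a1 := h.two_cases (x - 1)
  have a2 := h.two_cases x
  have c := ind_cases (f x)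
  have c' := ind_cases (f (x + 1))
  have c'' := ind_cases (f (x - 1))
  have e : ∀ a, wc f a 3 (x - 1) = ind (f (x - 1)) a + ind (f x) a + ind (f (x + 1)) a :=
    fun a => by
      rw [wc_three, sub_add_cancel, show x - 1 + 2 = x + 1 by ring]
  rw [sub_add_cancel] at a1
  have X : wc f 0 3 (x - 1) = 0 ∧ wc f 1 3 (x - 1) = 1 ∧ wc f 2 3 (x - 1) = 2 := by
    rw [e, e, e]; omega
  have Y : wc f 0 3 y = 2 ∧ wc f 1 3 y = 0 ∧ wc f 2 3 y = 1 := by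
    have := ind_eq_of_one.1 y0
    have := ind_eq_of_one.1 y1
    have := ind_eq_of_one.2.2 y2
    rw [wc_three, wc_three, wc_three]; omega
  have Z : wc f 0 3 z = 1 ∧ wc f 1 3 z = 1 ∧ wc f 2 3 z = 1 := by
    have := ind_eq_of_one.2.1 z0
    have := ind_eq_of_one.2.2 z1
    have := ind_eq_of_one.1 z2
    rw [wc_three, wc_three, wc_three]; omega
  have := h3.elim (x := x - 1) (y := y) (z := z) (vec_ne_of 0 (by omega))
    (vec_ne_of 0 (by omega)) (vec_ne_of 0 (by omega)) t
  rwa [X.1, X.2.1, X.2.2, Y.1, Y.2.1, Y.2.2, Z.1, Z.2.1, Z.2.2] at this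

/-- The factors 1200, 2120 and 2002 occur: they extend 120 and 002 in the only way that the lengths
two and three permit. -/
theorem Bent.two_spec_four (h : Bent f 2 v0 v1 v2) (hN : 0 < N) (hf : ∀ x, f (x + N) = f x)
    (h3 : AtMostThree f 3) (h4 : AtMostThree f 4) (t : ℤ) :
    (wc f 0 4 t = 2 ∧ wc f 1 4 t = 1 ∧ wc f 2 4 t = 1) ∨
    (wc f 0 4 t = 1 ∧ wc f 1 4 t = 1 ∧ wc f 2 4 t = 2) ∨
    (wc f 0 4 t = 2 ∧ wc f 1 4 t = 0 ∧ wc f 2 4 t = 2) := by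
  obtain ⟨-, ⟨y, y0, y1, y2⟩, ⟨z, z0, z1, z2⟩⟩ := h.two_exists hN hf
  have R := h.two_spec_three hN hf h3
  have z0' := ind_eq_of_one.2.1 z0
  have z1' := ind_eq_of_one.2.2 z1
  have z2' := ind_eq_of_one.1 z2
  have y0' := ind_eq_of_one.1 y0
  have y1' := ind_eq_of_one.1 y1
  have y2' := ind_eq_of_one.2.2 y2
  have X : wc f 0 4 z = 2 ∧ wc f 1 4 z = 1 ∧ wc f 2 4 z = 1 := by
    have a1 := R (z + 1)
    have a2 := h.two_cases (z + 2)
    rw [wc_three, wc_three, wc_three, show z + 1 + 1 = z + 2 by ring,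
      show z + 1 + 2 = z + 3 by ring] at a1
    rw [show z + 2 + 1 = z + 3 by ring] at a2
    have c := ind_cases (f (z + 3))
    rw [wc_four, wc_four, wc_four]
    clear * - a1 a2 c z0 z1 z2 z0' z1' z2'
    omega
  have Y : wc f 0 4 (z - 1) = 1 ∧ wc f 1 4 (z - 1) = 1 ∧ wc f 2 4 (z - 1) = 2 := by
    have a2 := h.two_cases (z - 1)
    rw [sub_add_cancel] at a2
    have c := ind_cases (f (z - 1))
    rw [wc_four, wc_four, wc_four, sub_add_cancel, show z - 1 + 2 = z + 1 by ring,
      show z - 1 + 3 = z + 2 by ring]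
    clear * - a2 c z0 z1 z2 z0' z1' z2'
    omega
  have Z : wc f 0 4 (y - 1) = 2 ∧ wc f 1 4 (y - 1) = 0 ∧ wc f 2 4 (y - 1) = 2 := by
    have a1 := R (y - 1)
    rw [wc_three, wc_three, wc_three, sub_add_cancel, show y - 1 + 2 = y + 1 by ring] at a1
    have a2 := h.two_cases (y - 1)
    rw [sub_add_cancel] at a2
    have c := ind_cases (f (y - 1))
    rw [wc_four, wc_four, wc_four, sub_add_cancel, show y - 1 + 2 = y + 1 by ring,
      show y - 1 + 3 = y + 2 by ring]
    clear * - a1 a2 c y0 y1 y2 y0' y1' y2'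
    omega
  have := h4.elim (x := z) (y := z - 1) (z := y - 1) (vec_ne_of 0 (by omega))
    (vec_ne_of 1 (by omega)) (vec_ne_of 0 (by omega)) t
  rwa [X.1, X.2.1, X.2.2, Y.1, Y.2.1, Y.2.2, Z.1, Z.2.1, Z.2.2] at this

/-- Words with a bent spectrum at length two are periodic with period `00212`. -/
theorem Bent.two (h : Bent f 2 v0 v1 v2) (hN : 0 < N)
    (hf : ∀ x, f (x + N) = f x) (h3 : AtMostThree f 3) (h4 : AtMostThree f 4) :
    ∃ x, ∀ k : ℕ, f (x + 5 * k) = 0 ∧ f (x + 5 * k + 1) = 0 ∧ f (x + 5 * k + 2) = 2 ∧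
      f (x + 5 * k + 3) = 1 ∧ f (x + 5 * k + 4) = 2 := by
  have R3 := h.two_spec_three hN hf h3
  have R4 := h.two_spec_four hN hf h3 h4
  -- After 00 the spectra of lengths two to four leave one choice for each of the next five letters,
  -- and 00 returns.
  have step : ∀ x, ind (f x) 0 = 1 → ind (f (x + 1)) 0 = 1 → ind (f (x + 2)) 2 = 1 ∧
      ind (f (x + 3)) 1 = 1 ∧ ind (f (x + 4)) 2 = 1 ∧ ind (f (x + 5)) 0 = 1 ∧
      ind (f (x + 6)) 0 = 1 := fun x x0 x1 => by
    have x0' := ind_eq_of_one.1 x0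
    have x1' := ind_eq_of_one.1 x1
    have p1 := h.two_cases (x + 1)
    have p2 := h.two_cases (x + 2)
    have p3 := h.two_cases (x + 3)
    have p4 := h.two_cases (x + 4)
    have p5 := h.two_cases (x + 5)
    have q0 := R3 x
    have q3 := R3 (x + 3)
    have q4 := R3 (x + 4)
    have r0 := R4 x
    simp only [wc_three, wc_four, add_assoc] at *
    norm_num at *
    have c2 := ind_cases (f (x + 2))
    have c3 := ind_cases (f (x + 3))
    have c4 := ind_cases (f (x + 4))
    have c5 := ind_cases (f (x + 5))
    have c6 := ind_cases (f (x + 6))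
    have s2 : ind (f (x + 2)) 2 = 1 := by
      clear * - x0' x1' x0 x1 p1 q0 c2; omega
    have s2' := ind_eq_of_one.2.2 s2
    have s3 : ind (f (x + 3)) 1 = 1 := by
      clear * - x0' x1' x0 x1 s2 s2' p2 r0 c3; omega
    have s3' := ind_eq_of_one.2.1 s3
    have s4 : ind (f (x + 4)) 2 = 1 := by
      clear * - s3 s3' p3 c4; omega
    have s4' := ind_eq_of_one.2.2 s4
    have s5 : ind (f (x + 5)) 0 = 1 := by
      clear * - s3 s3' s4 s4' p4 q3 c5; omega
    have s5' := ind_eq_of_one.1 s5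
    have s6 : ind (f (x + 6)) 0 = 1 := by
      clear * - s5 s5' s4 s4' p5 q4 c6; omega
    exact ⟨s2, s3, s4, s5, s6⟩
  obtain ⟨-, ⟨x, x0, x1, -⟩, -⟩ := h.two_exists hN hf
  have key : ∀ k : ℕ, ind (f (x + 5 * k)) 0 = 1 ∧ ind (f (x + 5 * k + 1)) 0 = 1 := fun k => by
    induction k with
    | zero => simpa using ⟨x0, x1⟩
    | succ k ih =>
      obtain ⟨-, -, -, h5, h6⟩ := step _ ih.1 ih.2
      push_cast
      rw [show x + 5 * ((k : ℤ) + 1) = x + 5 * k + 5 by ring,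
        show x + 5 * (k : ℤ) + 5 + 1 = x + 5 * k + 6 by ring]
      exact ⟨h5, h6⟩
  refine ⟨x, fun k => ?_⟩
  obtain ⟨k0, k1⟩ := key k
  obtain ⟨h2, h3, h4, -, -⟩ := step _ k0 k1
  exact ⟨ind_eq_one.1 k0, ind_eq_one.1 k1, ind_eq_one.1 h2, ind_eq_one.1 h3, ind_eq_one.1 h4⟩

end

/-! ### Straight spectra. -/

section
variable {f : ℤ → Fin 3} {n v0 v1 v2 : ℤ} {N : ℕ}

theorem Straight.vals (h : Straight f n v0 v1 v2) (x : ℤ) :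
    (wc f 0 n x = v0 - 1 → wc f 2 n x = v2 + 1) ∧
    (wc f 0 n x = v0 → wc f 2 n x = v2) ∧
    (wc f 0 n x = v0 + 1 → wc f 2 n x = v2 - 1) ∧ wc f 1 n x = v1 := by
  have := h.state x
  refine ⟨?_, ?_, ?_, ?_⟩
  · intro _; omega
  · intro _; omega
  · intro _; omega
  · omega

theorem Straight.swap (h : Straight f n v0 v1 v2) :
    Straight (fun i => Equiv.swap 0 2 (f i)) n v2 v1 v0 := by
  have e0 : ∀ x, wc (fun i => Equiv.swap (0 : Fin 3) 2 (f i)) 0 n x = wc f 2 n x := fun x => by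
    rw [wc_perm']; rfl
  have e1 : ∀ x, wc (fun i => Equiv.swap (0 : Fin 3) 2 (f i)) 1 n x = wc f 1 n x := fun x => by
    rw [wc_perm']; rfl
  have e2 : ∀ x, wc (fun i => Equiv.swap (0 : Fin 3) 2 (f i)) 2 n x = wc f 0 n x := fun x => by
    rw [wc_perm']; rfl
  obtain ⟨x, hx⟩ := h.low
  obtain ⟨y, hy⟩ := h.high
  refine ⟨fun z => ?_, ⟨y, ?_⟩, ⟨x, ?_⟩⟩
  · rw [e0, e1, e2]; have := h.state z; omega
  · rw [e0]; exact (h.vals y).2.2.1 hy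
  · rw [e0]; exact (h.vals x).1 hx

theorem ind_swap (b : Fin 3) : ind (Equiv.swap (0 : Fin 3) 2 b) 0 = ind b 2 ∧
    ind (Equiv.swap (0 : Fin 3) 2 b) 1 = ind b 1 ∧
    ind (Equiv.swap (0 : Fin 3) 2 b) 2 = ind b 0 := by
  revert b; decide

/-- The number of 1s in windows of length `n` is constant, so the letters that leave and enter are
both 1 or both not 1. -/
theorem Straight.ind_one (h : Straight f n v0 v1 v2) (x : ℤ) :
    ind (f (x + n)) 1 = ind (f x) 1 := by
  have := wc_shift f 1 n x
  have := (h.vals x).2.2.2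
  have := (h.vals (x + 1)).2.2.2
  omega

theorem Straight.exists_leave_low (h : Straight f n v0 v1 v2) (hN : 0 < N)
    (hf : ∀ x, f (x + N) = f x) :
    ∃ z, wc f 0 n z = v0 - 1 ∧ wc f 0 n (z + 1) = v0 ∧ ind (f z) 2 = 1 ∧
      ind (f (z + n)) 0 = 1 := by
  obtain ⟨x, hx⟩ := h.low
  obtain ⟨y, hy⟩ := h.high
  obtain ⟨z, h1, h2⟩ := exists_switch_of_periodic (p := fun z => wc f 0 n z = v0 - 1)
    (Int.natCast_pos.2 hN) (fun x => by rw [wc_periodic_of hf]) hx (z := y) (by omega)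
  refine ⟨z, h1, ?_⟩
  have := ind_cases (f z)
  have := ind_cases (f (z + n))
  have := h.state z
  have := h.state (z + 1)
  have := wc_shift f 0 n z
  have := wc_shift f 2 n z
  omega

theorem Straight.exists_enter_high (h : Straight f n v0 v1 v2) (hN : 0 < N)
    (hf : ∀ x, f (x + N) = f x) :
    ∃ z, wc f 0 n z = v0 ∧ wc f 0 n (z + 1) = v0 + 1 ∧ ind (f z) 2 = 1 ∧
      ind (f (z + n)) 0 = 1 := by
  obtain ⟨x, hx⟩ := h.low
  obtain ⟨y, hy⟩ := h.high
  obtain ⟨z, h1, h2⟩ := exists_switch_of_periodic (p := fun z => wc f 0 n z ≠ v0 + 1)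
    (Int.natCast_pos.2 hN) (fun x => by rw [wc_periodic_of hf]) (y := x) (z := y) (by omega)
    (by omega)
  refine ⟨z, ?_⟩
  have := ind_cases (f z)
  have := ind_cases (f (z + n))
  have := h.state z
  have := h.state (z + 1)
  have := wc_shift f 0 n z
  have := wc_shift f 2 n z
  omega

/-- Leaving low and entering high yield two vectors with `v1` letters 1. By `Straight.ind_one` the
window at `y` is followed by a 1, which yields a third. -/
theorem Straight.upper (h : Straight f n v0 v1 v2) (hN : 0 < N)
    (hf : ∀ x, f (x + N) = f x) (h3 : AtMostThree f (n + 1)) {y : ℤ} (hy : ind (f y) 1 = 1)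
    (t : ℤ) :
    (wc f 0 (n + 1) t = v0 ∧ wc f 1 (n + 1) t = v1 ∧ wc f 2 (n + 1) t = v2 + 1) ∨
    (wc f 0 (n + 1) t = v0 + 1 ∧ wc f 1 (n + 1) t = v1 ∧ wc f 2 (n + 1) t = v2) ∨
    (wc f 0 (n + 1) t = wc f 0 n y ∧ wc f 1 (n + 1) t = v1 + 1 ∧
      wc f 2 (n + 1) t = wc f 2 n y) := by
  obtain ⟨z, hz1, -, -, hz2⟩ := h.exists_leave_low hN hf
  obtain ⟨w, hw1, -, -, hw2⟩ := h.exists_enter_high hN hf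
  have y1 := (h.vals y).2.2.2
  have z1 := (h.vals z).2.2.2
  have w1 := (h.vals w).2.2.2
  have z2 := (h.vals z).1 hz1
  have w2 := (h.vals w).2.1 hw1
  have z3 := ind_eq_of_one.1 hz2
  have w3 := ind_eq_of_one.1 hw2
  have hy' : ind (f (y + n)) 1 = 1 := by rw [h.ind_one, hy]
  have y3 := ind_eq_of_one.2.1 hy'
  have := h3.elim (x := z) (y := w) (z := y)
    (vec_ne_of 0 (by rw [wc_succ, wc_succ]; omega)) (vec_ne_of 1 (by rw [wc_succ, wc_succ]; omega))
    (vec_ne_of 1 (by rw [wc_succ, wc_succ]; omega)) t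
  simp only [wc_succ] at this ⊢
  clear * - this y1 z1 w1 z2 w2 z3 w3 hy' y3 hz1 hz2 hw1 hw2
  omega

/-- The counterpart of `Straight.upper` for windows that lose their first letter. -/
theorem Straight.lower (h : Straight f n v0 v1 v2) (hN : 0 < N)
    (hf : ∀ x, f (x + N) = f x) (h3 : AtMostThree f (n - 1)) {y : ℤ} (hy : ind (f y) 1 = 1)
    (t : ℤ) :
    (wc f 0 (n - 1) t = v0 - 1 ∧ wc f 1 (n - 1) t = v1 ∧ wc f 2 (n - 1) t = v2) ∨
    (wc f 0 (n - 1) t = v0 ∧ wc f 1 (n - 1) t = v1 ∧ wc f 2 (n - 1) t = v2 - 1) ∨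
    (wc f 0 (n - 1) t = wc f 0 n y ∧ wc f 1 (n - 1) t = v1 - 1 ∧
      wc f 2 (n - 1) t = wc f 2 n y) := by
  obtain ⟨z, hz1, -, hz2, -⟩ := h.exists_leave_low hN hf
  obtain ⟨w, hw1, -, hw2, -⟩ := h.exists_enter_high hN hf
  have y1 := (h.vals y).2.2.2
  have z1 := (h.vals z).2.2.2
  have w1 := (h.vals w).2.2.2
  have z2 := (h.vals z).1 hz1
  have w2 := (h.vals w).2.1 hw1
  have z3 := ind_eq_of_one.2.2 hz2
  have w3 := ind_eq_of_one.2.2 hw2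
  have y3 := ind_eq_of_one.2.1 hy
  have := h3.elim (x := z + 1) (y := w + 1) (z := y + 1)
    (vec_ne_of 0 (by rw [wc_pred', wc_pred']; omega))
    (vec_ne_of 1 (by rw [wc_pred', wc_pred']; omega))
    (vec_ne_of 1 (by rw [wc_pred', wc_pred']; omega)) t
  rw [wc_pred', wc_pred', wc_pred', wc_pred', wc_pred', wc_pred', wc_pred', wc_pred',
    wc_pred'] at this
  clear * - this y1 z1 w1 z2 w2 z3 w3 hy y3 hz1 hz2 hw1 hw2
  omega

/-- The letters around windows of length `n` if the letter `1` occurs in low state. -/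
theorem Straight.letters_of_low_one (h : Straight f n v0 v1 v2) (hN : 0 < N)
    (hf : ∀ x, f (x + N) = f x) (h3 : AtMostThree f (n + 1)) (h3' : AtMostThree f (n - 1)) {y : ℤ}
    (hy : ind (f y) 1 = 1) (hy0 : wc f 0 n y = v0 - 1) (t : ℤ) :
    (wc f 0 n t = v0 + 1 → ind (f t) 0 = 1 ∧ ind (f (t - 1)) 2 = 1) ∧
    (wc f 0 n t = v0 - 1 → ind (f t) 0 = 0 ∧ ind (f (t - 1)) 2 = 0) ∧
    (wc f 0 n t = v0 → ind (f t) 1 = 0) := by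
  have y2 := (h.vals y).1 hy0
  have u := h.upper hN hf h3 hy (t - 1)
  have l := h.lower hN hf h3' hy (t + 1)
  have e := fun a => wc_succ' f a n (t - 1)
  simp only [sub_add_cancel] at e
  rw [e, e, e, hy0, y2] at u
  rw [wc_pred', wc_pred', wc_pred', hy0, y2] at l
  have c := ind_cases (f t)
  have c' := ind_cases (f (t - 1))
  obtain ⟨a1, a2, a3, a4⟩ := h.vals t
  rw [a4] at u l
  refine ⟨fun ht => ?_, fun ht => ?_, fun ht => ?_⟩
  · rw [ht, a3 ht] at u l
    clear * - u l c c'; omega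
  · rw [ht, a1 ht] at u l
    clear * - u l c c'; omega
  · rw [ht, a2 ht] at u l
    clear * - u l c c'; omega

/-- A 1 at the start of a low window would confine all 1s to low state. The letters around the
windows then force the factors 01, 12 and 20, and the word could never reach high state. -/
theorem Straight.one_not_low (h : Straight f n v0 v1 v2) (hN : 0 < N)
    (hf : ∀ x, f (x + N) = f x) (h3 : AtMostThree f (n + 1)) (h3' : AtMostThree f (n - 1))
    (h2 : AtMostThree f 2) {y : ℤ} (hy : ind (f y) 1 = 1) : wc f 0 n y ≠ v0 - 1 := by
  intro hy0
  have key := h.letters_of_low_one hN hf h3 h3' hy hy0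
  obtain ⟨xh, hxh⟩ := h.high
  have hper : ∀ t : ℤ, f (t + N + 1) = f (t + 1) := fun t => by
    rw [show t + N + 1 = t + 1 + N by ring, hf]
  have key1 : ∀ t, ind (f t) 1 = 1 → wc f 0 n t = v0 - 1 := fun t ht => by
    have := key t
    have := h.state t
    have := ind_eq_of_one.2.1 ht
    omega
  obtain ⟨hk1, hk2⟩ := (key xh).1 hxh
  -- the factors `01`, `12` and `20`
  obtain ⟨a, ha, ha'⟩ : ∃ a, ind (f a) 0 = 1 ∧ ind (f (a + 1)) 1 = 1 := by
    obtain ⟨a, h1, h2⟩ := exists_switch_of_periodic (p := fun t => ind (f t) 1 ≠ 1)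
      (Int.natCast_pos.2 hN) (fun t => by rw [hf]) (y := xh)
      (by have := ind_eq_of_one.1 hk1; omega) (z := y) (by omega)
    have h3 := key1 (a + 1) (by omega)
    have h4 := (key (a + 1)).2.1 h3
    rw [add_sub_cancel_right] at h4
    have h5 := ind_cases (f a)
    exact ⟨a, by omega, by omega⟩
  obtain ⟨b, hb, hb'⟩ : ∃ b, ind (f b) 1 = 1 ∧ ind (f (b + 1)) 2 = 1 := by
    obtain ⟨b, h1, h2⟩ := exists_switch_of_periodic (p := fun t => ind (f t) 1 = 1)
      (Int.natCast_pos.2 hN) (fun t => by rw [hf]) (y := y) hy (z := xh)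
      (by have := ind_eq_of_one.1 hk1; omega)
    have h3 := key1 b (by omega)
    have h4 := wc_shift f 0 n b
    have h5 := ind_eq_of_one.2.1 h1
    have h6 := h.ind_one b
    have h7 := ind_cases (f (b + n))
    have h8 := (key (b + 1)).2.1 (by omega)
    have h9 := ind_cases (f (b + 1))
    exact ⟨b, h1, by omega⟩
  have ha1 := ind_eq_of_one.1 ha
  have ha2 := ind_eq_of_one.2.1 ha'
  have hb1 := ind_eq_of_one.2.1 hb
  have hb2 := ind_eq_of_one.2.2 hb'
  have hk3 := ind_eq_of_one.1 hk1
  have hk4 := ind_eq_of_one.2.2 hk2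
  -- The factors 01, 12 and 20 exhaust the spectrum of length two, so 00 and 22 do not occur.
  have two : ∀ t, ind (f t) 0 + ind (f (t + 1)) 0 ≤ 1 ∧ ind (f t) 2 + ind (f (t + 1)) 2 ≤ 1 :=
    fun t => by
      have := h2.elim (x := a) (y := b) (z := xh - 1)
        (vec_ne_of 0 (by rw [wc_two, wc_two]; omega))
        (vec_ne_of 1 (by rw [wc_two, wc_two, sub_add_cancel]; omega))
        (vec_ne_of 1 (by rw [wc_two, wc_two, sub_add_cancel]; omega)) t
      simp only [wc_two, sub_add_cancel] at this
      clear * - this ha ha' hb hb' ha1 ha2 hb1 hb2 hk1 hk2 hk3 hk4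
      omega
  obtain ⟨u, hu⟩ := h.low
  -- Low state is left by losing 2 and gaining 0; as 22, 00 and 1 are excluded, the next step loses
  -- 0, gains 2 and returns to low.
  have := forall_of_periodic
    (p := fun t => wc f 0 n t = v0 - 1 ∨
      (wc f 0 n t = v0 ∧ ind (f (t - 1)) 2 = 1 ∧ ind (f (t + n - 1)) 0 = 1))
    (Int.natCast_pos.2 hN) (fun t => by
      rw [wc_periodic_of hf, show t + N - 1 = t - 1 + N by ring,
        show t + N + n - 1 = t + n - 1 + N by ring, hf, hf])
    (y := u) (Or.inl hu) (fun t ht => by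
      rw [add_sub_cancel_right, show t + 1 + n - 1 = t + n by ring]
      have e := wc_shift f 0 n t
      have s := h.state (t + 1)
      have i1 := h.ind_one t
      have c := ind_cases (f t)
      have c' := ind_cases (f (t + n))
      rcases ht with ht | ⟨ht, ht', ht''⟩
      · clear * - ht e s i1 c c'
        omega
      · left
        have h1 := (key t).2.2 ht
        have t1 := two (t - 1)
        have t2 := two (t + n - 1)
        rw [sub_add_cancel] at t1 t2
        clear * - ht ht' ht'' e s c c' i1 h1 t1 t2
        omega) xh
  omega

/-- The letter `1` occurs in neutral state only. -/
theorem Straight.one_mid (h : Straight f n v0 v1 v2) (hN : 0 < N)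
    (hf : ∀ x, f (x + N) = f x) (h3 : AtMostThree f (n + 1)) (h3' : AtMostThree f (n - 1))
    (h2 : AtMostThree f 2) {y : ℤ} (hy : ind (f y) 1 = 1) : wc f 0 n y = v0 := by
  have h4 := h.one_not_low hN hf h3 h3' h2 hy
  have h5 := h.swap.one_not_low hN (fun x => by simp only [hf]) (h3.perm _) (h3'.perm _)
    (h2.perm _) (y := y) (by rw [(ind_swap _).2.1, hy])
  rw [wc_perm'] at h5
  have h6 : wc f 2 n y ≠ v2 - 1 := h5
  have := h.state y
  omega

/-- The letters around the windows of length `n`. -/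
theorem Straight.letters (h : Straight f n v0 v1 v2) (hN : 0 < N)
    (hf : ∀ x, f (x + N) = f x) (h3 : AtMostThree f (n + 1)) (h3' : AtMostThree f (n - 1))
    (h2 : AtMostThree f 2) {y : ℤ} (hy : ind (f y) 1 = 1) (t : ℤ) :
    (wc f 0 n t = v0 + 1 → ind (f (t - 1)) 2 = 1 ∧ ind (f t) 0 = 1 ∧ ind (f (t + n - 1)) 0 = 1 ∧
      ind (f (t + n)) 2 = 1) ∧
    (wc f 0 n t = v0 - 1 → ind (f (t - 1)) 0 = 1 ∧ ind (f t) 2 = 1 ∧ ind (f (t + n - 1)) 2 = 1 ∧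
      ind (f (t + n)) 0 = 1) := by
  have y0 := h.one_mid hN hf h3 h3' h2 hy
  have y2 := (h.vals y).2.1 y0
  have u := h.upper hN hf h3 hy (t - 1)
  have u' := h.upper hN hf h3 hy t
  have l := h.lower hN hf h3' hy (t + 1)
  have l' := h.lower hN hf h3' hy t
  have e := fun a => wc_succ' f a n (t - 1)
  simp only [sub_add_cancel] at e
  rw [e, e, e, y0, y2] at u
  rw [wc_succ, wc_succ, wc_succ, y0, y2] at u'
  rw [wc_pred', wc_pred', wc_pred', y0, y2] at l
  rw [wc_pred, wc_pred, wc_pred, y0, y2] at l'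
  have c1 := ind_cases (f t)
  have c2 := ind_cases (f (t - 1))
  have c3 := ind_cases (f (t + n))
  have c4 := ind_cases (f (t + n - 1))
  obtain ⟨a1, a2, a3, a4⟩ := h.vals t
  rw [a4] at u l u' l'
  refine ⟨fun ht => ?_, fun ht => ?_⟩
  · rw [ht, a3 ht] at u l u' l'
    refine ⟨?_, ?_, ?_, ?_⟩
    · clear * - u c2; omega
    · clear * - l c1; omega
    · clear * - l' c4; omega
    · clear * - u' c3; omega
  · rw [ht, a1 ht] at u l u' l'
    refine ⟨?_, ?_, ?_, ?_⟩
    · clear * - u c2; omega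
    · clear * - l c1; omega
    · clear * - l' c4; omega
    · clear * - u' c3; omega

end

/-! ### Arithmetic of the letter frequencies. -/

theorem isCoprime_of_not_dvd {h n : ℤ} (hn : 0 < n) (H : ∀ m, 0 < m → m < n → ¬ n ∣ m * h) :
    IsCoprime h n := by
  rw [Int.isCoprime_iff_gcd_eq_one]
  by_contra hg
  obtain ⟨h', hh⟩ := Int.gcd_dvd_left (a := h) (b := n)
  obtain ⟨m, hm⟩ := Int.gcd_dvd_right (a := h) (b := n)
  have hg0 : 0 < (Int.gcd h n : ℤ) := by
    have := Int.gcd_pos_of_ne_zero_right h hn.ne'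
    omega
  have hg2 : 2 ≤ (Int.gcd h n : ℤ) := by omega
  have hm0 : 0 < m := by
    by_contra hc
    nlinarith
  refine H m hm0 (by nlinarith) ⟨h', ?_⟩
  generalize (Int.gcd h n : ℤ) = g at *
  rw [hm, hh]; ring

theorem eq_of_dvd_sub {n x y : ℤ} (h : n ∣ x - y) (hx : 0 < x) (hx' : x < n) (hy : 0 < y)
    (hy' : y < n) : x = y := by
  have := Int.eq_zero_of_abs_lt_dvd h (by rw [abs_lt]; constructor <;> linarith)
  linarith

/-- Two units `1` and `r` modulo `n` whose multiples stay close to each other. -/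
theorem two_or_half_of_close {n r : ℤ} {ρ : ℤ → ℤ} (_hn : 1 < n)
    (hρ : ∀ j, 0 < j → j < n → 0 < ρ j ∧ ρ j < n ∧ n ∣ ρ j - r * j ∧ 2 * (ρ j - j) < n)
    (hr0 : 0 < r) (hrn : r < n) : r = 1 ∨ r = 2 ∨ 2 * r = n + 1 := by
  -- `r * j` is the largest multiple of `r` below `n`, so `ρ j = r * j` without reduction.
  set j := (n - 1) / r with hj
  have e1 : r * j ≤ n - 1 := Int.mul_ediv_self_le hr0.ne'
  have e2 : n - 1 < (j + 1) * r := by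
    have := Int.lt_ediv_add_one_mul_self (n - 1) hr0; rwa [← hj] at this
  have j0 : 0 < j := by
    by_contra hc; nlinarith
  by_cases hr1 : r = 1
  · exact Or.inl hr1
  have r2 : 2 ≤ r := by omega
  have jn : j + 1 < n := by nlinarith
  obtain ⟨a1, a2, a3, a4⟩ := hρ j j0 (by omega)
  have a5 : ρ j = r * j := eq_of_dvd_sub a3 a1 a2 (by positivity) (by omega)
  obtain ⟨b1, b2, b3, -⟩ := hρ (j + 1) (by omega) jn
  have b4 : n ≠ (j + 1) * r := fun hc => by
    rw [show r * (j + 1) = n by rw [hc]; ring] at b3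
    have : n ∣ ρ (j + 1) := by simpa using dvd_add b3 (dvd_refl n)
    exact absurd (Int.le_of_dvd b1 this) (by omega)
  have b5 : n < (j + 1) * r := by omega
  rw [a5] at a4
  -- From `2 * (r * j - j) < n < (j + 1) * r`. As `r ≥ 2`, either `j = 1`, where `n < 2 * r < n +
  -- 2`, or `r = 2`.
  have h3 : (j - 1) * (r - 2) ≤ 0 := by nlinarith
  by_cases hj1 : j = 1
  · rw [hj1] at b5 a4
    right; right; omega
  · right; left
    by_contra hr
    have : 1 * 1 ≤ (j - 1) * (r - 2) := by gcongr <;> omega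
    omega

/-- The possible frequencies of the letters of a primitive balanced ternary word in which the
exchange of two letters is possible. -/
theorem frequencies {n a b h : ℤ} {u0 u1 u2 : ℤ → ℤ} (hn : 1 < n) (ha : 0 < a) (hb : 0 < b)
    (hh : 0 < h) (hs : a + b + h = n)
    (H0 : ∀ m, 0 < m → m < n → n * u0 m < m * a ∧ m * a < n * (u0 m + 1))
    (H2 : ∀ m, 0 < m → m < n → n * u2 m < m * h ∧ m * h < n * (u2 m + 1))
    (Hs : ∀ m, 0 < m → m < n → u0 m + 1 + u1 m + u2 m = m)
    (H1 : ∀ i j, 0 < i → i < n → 0 < j → j < n →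
      (n * u1 j - j * b) - (n * u1 i - i * b) < n) : b = a ∨ b = h := by
  have hcop : IsCoprime h n := isCoprime_of_not_dvd (by omega) fun m h0 h1 ⟨c, hc⟩ => by
    obtain ⟨p, q⟩ := H2 m h0 h1
    rw [hc] at p q
    have := lt_of_mul_lt_mul_left p (by omega)
    have := lt_of_mul_lt_mul_left q (by omega)
    omega
  obtain ⟨s, q, hsq⟩ := hcop
  have hX : ∀ j, 0 < j → j < n → 0 < (-s * j) % n ∧ (-s * j) % n < n ∧
      (-s * j) % n = -s * j - n * ((-s * j) / n) := fun j h0 h1 => by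
    have e := Int.emod_add_mul_ediv (-s * j) n
    refine ⟨?_, Int.emod_lt_of_pos _ (by omega), by omega⟩
    refine lt_of_le_of_ne (Int.emod_nonneg _ (by omega)) fun hc => ?_
    rw [← hc] at e
    have : n ∣ j := ⟨-h * ((-s * j) / n) + q * j, by
      linear_combination (h) * e - j * hsq⟩
    exact absurd (Int.le_of_dvd h0 this) (by omega)
  -- As `s` inverts `h` modulo `n`, `X j` is the length `m` with `m * h ≡ -j`, and `ρ j` is the
  -- residue of `m * a`. In these terms the deviation of letter 1 becomes `ρ j - j` (`hE`).
  set X : ℤ → ℤ := fun j => (-s * j) % n with hXdef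
  set ρ : ℤ → ℤ := fun j => X j * a - n * u0 (X j) with hρdef
  have hρ : ∀ j, 0 < j → j < n → 0 < ρ j ∧ ρ j < n ∧ n ∣ ρ j - (-s * a) * j := fun j h0 h1 => by
    obtain ⟨x1, x2, x3⟩ := hX j h0 h1
    obtain ⟨y1, y2⟩ := H0 (X j) x1 x2
    refine ⟨by simp only [hρdef]; linarith, by simp only [hρdef]; linarith, ?_⟩
    refine ⟨-((-s * j) / n) * a - u0 (X j), ?_⟩
    have : X j = -s * j - n * ((-s * j) / n) := x3
    simp only [hρdef]
    rw [show X j * a = (-s * j - n * ((-s * j) / n)) * a by rw [← this]]; ring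
  have hE : ∀ j, 0 < j → j < n → n * u1 (X j) - X j * b = ρ j - j := fun j h0 h1 => by
    obtain ⟨x1, x2, x3⟩ := hX j h0 h1
    obtain ⟨y1, y2⟩ := H2 (X j) x1 x2
    have h3 := Hs (X j) x1 x2
    have e1 : X j * h - n * u2 (X j) = n - j := by
      refine eq_of_dvd_sub (n := n) ?_ (by linarith) (by linarith) (by omega) (by omega)
      have : X j = -s * j - n * ((-s * j) / n) := x3
      refine ⟨-((-s * j) / n) * h - u2 (X j) - 1 + q * j, ?_⟩
      rw [show X j * h = (-s * j - n * ((-s * j) / n)) * h by rw [← this]]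
      linear_combination (-j) * hsq
    simp only [hρdef]
    have e2 : u1 (X j) = X j - 1 - u0 (X j) - u2 (X j) := by omega
    rw [e2]
    linear_combination e1 - X j * hs
  have hsymm : ∀ j, 0 < j → j < n → ρ (n - j) = n - ρ j := fun j h0 h1 => by
    obtain ⟨x1, x2, x3⟩ := hρ j h0 h1
    obtain ⟨y1, y2, y3⟩ := hρ (n - j) (by omega) (by omega)
    refine eq_of_dvd_sub (n := n) ?_ y1 y2 (by omega) (by omega)
    have := dvd_add (dvd_add x3 y3) (dvd_mul_right n (-s * a - 1))
    refine this.trans (dvd_of_eq ?_)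
    ring
  -- The deviations at `j` and `n - j` are opposite, so a bound on their difference bounds twice
  -- either of them.
  have hclose : ∀ j, 0 < j → j < n → 2 * (ρ j - j) < n := fun j h0 h1 => by
    have x := hX j h0 h1
    have y := hX (n - j) (by omega) (by omega)
    have := H1 (X (n - j)) (X j) y.1 y.2.1 x.1 x.2.1
    rw [hE j h0 h1, hE (n - j) (by omega) (by omega), hsymm j h0 h1] at this
    omega
  obtain ⟨r1, r2, r3⟩ := hρ 1 one_pos hn
  rw [mul_one] at r3
  have hr := two_or_half_of_close (ρ := ρ) (r := ρ 1) hn (fun j h0 h1 => by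
    obtain ⟨x1, x2, x3⟩ := hρ j h0 h1
    refine ⟨x1, x2, ?_, hclose j h0 h1⟩
    have := dvd_sub x3 (dvd_mul_of_dvd_left r3 j)
    refine this.trans (dvd_of_eq ?_)
    ring) r1 r2
  have key : ∀ k : ℤ, n ∣ k * ρ 1 * h + k * a := fun k => by
    have := dvd_add (dvd_mul_of_dvd_right r3 (k * h)) (dvd_mul_left n (k * a * q))
    refine this.trans (dvd_of_eq ?_)
    linear_combination (k * a) * hsq
  -- Modulo `n`, `ρ 1 * h ≡ -a`. The value 1 would give `n ∣ a + h`, which is too small; 2 gives `a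
  -- + 2 * h = n`; the half gives `2 * a + h = n`.
  rcases hr with hr | hr | hr
  · have := key 1
    rw [hr] at this
    exact absurd (Int.le_of_dvd (by omega) this) (by omega)
  · right
    have := key 1
    rw [hr] at this
    obtain ⟨c, hc⟩ := this
    have c1 : 0 < c := by by_contra h'; nlinarith
    have c2 : c < 2 := by by_contra h'; nlinarith
    have : c = 1 := by omega
    subst this
    omega
  · left
    have := key 2
    rw [show 2 * ρ 1 * h + 2 * a = n * h + (h + 2 * a) by rw [hr]; ring,
      dvd_add_right (dvd_mul_right n h)] at this
    obtain ⟨c, hc⟩ := this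
    have c1 : 0 < c := by by_contra h'; nlinarith
    have c2 : c < 2 := by by_contra h'; nlinarith
    have : c = 1 := by omega
    subst this
    omega

/-! ### Prefixes of extremal windows and letter frequencies. -/

section
variable {f : ℤ → Fin 3} {n v0 v1 v2 : ℤ} {N : ℕ}

/-- A straight spectrum of minimal length, with the letters around the windows. -/
structure Twisted (f : ℤ → Fin 3) (n v0 v1 v2 : ℤ) : Prop extends Straight f n v0 v1 v2 where
  around : ∀ t, (wc f 0 n t = v0 + 1 → ind (f (t - 1)) 2 = 1 ∧ ind (f t) 0 = 1 ∧
      ind (f (t + n - 1)) 0 = 1 ∧ ind (f (t + n)) 2 = 1) ∧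
    (wc f 0 n t = v0 - 1 → ind (f (t - 1)) 0 = 1 ∧ ind (f t) 2 = 1 ∧
      ind (f (t + n - 1)) 2 = 1 ∧ ind (f (t + n)) 0 = 1)
  balanced : ∀ m, 0 < m → m < n → BalancedAt f m
  one : ∃ y, ind (f y) 1 = 1
  one_lt : 1 < n

theorem Twisted.swap (h : Twisted f n v0 v1 v2) :
    Twisted (fun i => Equiv.swap 0 2 (f i)) n v2 v1 v0 where
  toStraight := h.toStraight.swap
  around t := by
    have e : wc (fun i => Equiv.swap (0 : Fin 3) 2 (f i)) 0 n t = wc f 2 n t := by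
      rw [wc_perm']; rfl
    have h1 := h.around t
    have h2 := h.state t
    rw [e]
    simp only [(ind_swap _).1, (ind_swap _).2.2]
    exact ⟨fun ht => h1.2 (by omega), fun ht => h1.1 (by omega)⟩
  balanced m h0 h1 := (h.balanced m h0 h1).perm _
  one := by
    obtain ⟨y, hy⟩ := h.one
    exact ⟨y, by rw [(ind_swap _).2.1, hy]⟩
  one_lt := h.one_lt

theorem quasiperiodic_mul {G : ℤ → ℤ} {n h : ℤ} (hG : ∀ x, G (x + n) = G x + h) (i k : ℤ) :
    G (i + k * n) = G i + k * h := by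
  have := eq_of_forall_succ_eq (D := fun k => G (i + k * n) - k * h) (fun k => by
    rw [show i + (k + 1) * n = i + k * n + n by ring, hG]; ring) k 0
  simp only [zero_mul, add_zero] at this
  omega

/-- A quasi-periodic function whose steps of length `m` are bounded from below. -/
theorem lt_of_steps {G : ℤ → ℤ} {n m h c i : ℤ} (hn : 0 < n) (hG : ∀ x, G (x + n) = G x + h)
    (hs : ∀ x, c ≤ G (x + m) - G x) (hi : c < G (i + m) - G i) : n * c < m * h := by
  have h2 : ∀ k : ℕ, G i + (k + 1) * c < G (i + (k + 1) * m) := fun k => by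
    induction k with
    | zero => simp only [Nat.cast_zero, zero_add, one_mul]; omega
    | succ k ih =>
      have := hs (i + (k + 1) * m)
      rw [show i + ((k : ℤ) + 1) * m + m = i + ((k + 1 : ℕ) + 1) * m by push_cast; ring] at this
      push_cast at this ⊢
      linarith
  have h3 := h2 (n - 1).toNat
  have h4 := quasiperiodic_mul hG i m
  rw [show (((n - 1).toNat : ℤ) + 1) = n by omega, show i + n * m = i + m * n by ring, h4] at h3
  linarith

section
variable (h : Twisted f n v0 v1 v2) {x y : ℤ} (hx : wc f 0 n x = v0 + 1)
  (hy : wc f 0 n y = v0 - 1)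
include h hx hy

/-- Over the whole windows the counts of 0 and 2 differ by two. Balance allows a difference of one
on the prefix and one on the suffix, so each takes exactly one; the count of 1 follows from the
lengths. -/
theorem Twisted.prefix_diff {m : ℤ} (h0 : 0 < m) (h1 : m < n) :
    wc f 0 m x = wc f 0 m y + 1 ∧ wc f 1 m x = wc f 1 m y ∧ wc f 2 m x = wc f 2 m y - 1 ∧
    wc f 0 (n - m) (x + m) = wc f 0 (n - m) (y + m) + 1 ∧
    wc f 1 (n - m) (x + m) = wc f 1 (n - m) (y + m) ∧
    wc f 2 (n - m) (x + m) = wc f 2 (n - m) (y + m) - 1 := by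
  have b1 := fun a => h.balanced m h0 h1 a x y
  have b2 := fun a => h.balanced m h0 h1 a y x
  have b3 := fun a => h.balanced (n - m) (by omega) (by omega) a (x + m) (y + m)
  have b4 := fun a => h.balanced (n - m) (by omega) (by omega) a (y + m) (x + m)
  have e1 := fun a => wc_add f a m (n - m) x
  have e2 := fun a => wc_add f a m (n - m) y
  simp only [add_sub_cancel] at e1 e2
  have x2 := h.vals x
  have y2 := h.vals y
  have x3 := x2.2.2.1 hx
  have y3 := y2.1 hy
  have s1 := wc_sum f m x
  have s2 := wc_sum f m y
  have := b1 0; have := b1 2; have := b2 0; have := b2 2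
  have := b3 0; have := b3 2; have := b4 0; have := b4 2
  have := e1 0; have := e1 1; have := e1 2
  have := e2 0; have := e2 1; have := e2 2
  clear * - x2 y2 x3 y3 s1 s2 hx hy this b1 b2 b3 b4 e1 e2
  have b10 := b1 0; have b12 := b1 2; have b20 := b2 0; have b22 := b2 2
  have b30 := b3 0; have b32 := b3 2; have b40 := b4 0; have b42 := b4 2
  have e10 := e1 0; have e11 := e1 1; have e12 := e1 2
  have e20 := e2 0; have e21 := e2 1; have e22 := e2 2
  have x4 := x2.2.2.2
  have y4 := y2.2.2.2
  clear b1 b2 b3 b4 e1 e2 x2 y2 this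
  omega

/-- The bounds for the number of occurrences of `2` in the windows of length `m`. -/
theorem Twisted.two_between {m : ℤ} (h0 : 0 < m) (h1 : m < n) (z : ℤ) :
    wc f 2 m x ≤ wc f 2 m z ∧ wc f 2 m z ≤ wc f 2 m x + 1 := by
  have := h.prefix_diff hx hy h0 h1
  have := h.balanced m h0 h1 2 z x
  have := h.balanced m h0 h1 2 y z
  omega

/-- The suffix of the high window has one 2 fewer than that of the low one, so it attains the
minimum for its length, as does the prefix of the same length. -/
theorem Twisted.two_complement {m : ℤ} (h0 : 0 < m) (h1 : m < n) :
    wc f 2 m x + wc f 2 (n - m) x = v2 - 1 := by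
  have h2 := h.prefix_diff hx hy h0 h1
  have h3 := h.two_between hx hy (m := n - m) (by omega) (by omega) (x + m)
  have h4 := h.two_between hx hy (m := n - m) (by omega) (by omega) (y + m)
  have e1 := wc_add f 2 m (n - m) x
  rw [add_sub_cancel] at e1
  have := (h.vals x).2.2.1 hx
  omega

/-- The frequency of the letter `2` lies strictly between the bounds given by the prefixes of the
window at `x`. -/
theorem Twisted.two_bounds {m : ℤ} (h0 : 0 < m) (h1 : m < n) :
    n * wc f 2 m x < m * v2 ∧ m * v2 < n * (wc f 2 m x + 1) := by
  have hn := h.one_lt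
  -- `G` counts the 2s in the periodic repetition of a low window whose final 2 is replaced by 0,
  -- which leaves `v2` of them per period.
  set G : ℤ → ℤ := fun i => i / n * v2 + if i % n = 0 then 0 else wc f 2 (i % n) x + 1 with hG
  have hper : ∀ i, G (i + n) = G i + v2 := fun i => by
    simp only [hG, Int.add_emod_right]
    rw [Int.add_ediv_of_dvd_right (dvd_refl n), Int.ediv_self (by omega)]; ring
  have heval : ∀ q r, 0 ≤ r → r < n → G (r + n * q) =
      q * v2 + if r = 0 then 0 else wc f 2 r x + 1 := fun q r r0 r1 => by
    simp only [hG, Int.add_mul_emod_self_left]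
    rw [Int.add_mul_ediv_left _ _ (by omega), Int.ediv_eq_zero_of_lt r0 r1,
      Int.emod_eq_of_lt r0 r1, zero_add]
  have hc := h.two_complement hx hy h0 h1
  have hstep : ∀ i, wc f 2 m x ≤ G (i + m) - G i ∧ G (i + m) - G i ≤ wc f 2 m x + 1 := fun i => by
    have e := Int.emod_add_mul_ediv i n
    have r0 := Int.emod_nonneg i (by omega : n ≠ 0)
    have r1 := Int.emod_lt_of_pos i (by omega : 0 < n)
    generalize i % n = r at *
    generalize i / n = q at *
    subst e
    rw [heval q r r0 r1]
    by_cases hr : r = 0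
    · rw [show r + n * q + m = m + n * q by omega, heval q m (by omega) h1, if_pos hr,
        if_neg (by omega)]
      constructor <;> omega
    rw [if_neg hr]
    rcases lt_trichotomy (r + m) n with h2 | h2 | h2
    · rw [show r + n * q + m = (r + m) + n * q by ring, heval q _ (by omega) h2,
        if_neg (by omega), wc_add]
      have := h.two_between hx hy h0 h1 (x + r)
      constructor <;> omega
    · have e : r + n * q + m = 0 + n * (q + 1) := by linarith
      rw [e, heval _ 0 le_rfl (by omega), if_pos rfl]
      have : r = n - m := by omega
      subst this
      rw [add_mul]
      constructor <;> omega
    · have e : r + n * q + m = (r + m - n) + n * (q + 1) := by ring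
      rw [e, heval _ _ (by omega) (by omega), if_neg (by omega), add_mul]
      have h3 := h.two_between hx hy (m := n - m) (by omega) (by omega) (x + (r + m - n))
      have h4 := wc_add f 2 (r + m - n) (n - m) x
      rw [show r + m - n + (n - m) = r by ring] at h4
      constructor <;> omega
  constructor
  · refine lt_of_steps (G := G) (i := 0) (by omega) hper (fun i => (hstep i).1) ?_
    have e1 := heval 0 m (by omega) h1
    have e2 := heval 0 0 le_rfl (by omega)
    rw [if_neg (by omega)] at e1
    simp only [mul_zero, add_zero, zero_mul, zero_add, if_true] at e1 e2
    rw [zero_add, e1, e2]; omega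
  -- The step ending at 0 misses the upper bound, as the step starting at 0 exceeds the lower one;
  -- this makes both estimates strict.
  · have := lt_of_steps (G := fun i => -G i) (n := n) (m := m) (h := -v2)
      (c := -(wc f 2 m x + 1)) (i := -m) (by omega) (fun i => by rw [hper]; ring)
      (fun i => by have := (hstep i).2; omega) (by
        have e1 := heval (-1) (n - m) (by omega) (by omega)
        have e2 := heval 0 0 le_rfl (by omega)
        rw [if_neg (by omega), show n - m + n * -1 = -m by ring] at e1
        simp only [mul_zero, add_zero, zero_mul, if_true] at e2
        rw [neg_add_cancel, e1, e2]; omega)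
    linarith

theorem Twisted.zero_bounds {m : ℤ} (h0 : 0 < m) (h1 : m < n) :
    n * (wc f 0 m x - 1) < m * v0 ∧ m * v0 < n * wc f 0 m x := by
  have e : ∀ m t, wc (fun i => Equiv.swap (0 : Fin 3) 2 (f i)) 0 m t = wc f 2 m t :=
    fun m t => by rw [wc_perm']; rfl
  have e' : ∀ m t, wc (fun i => Equiv.swap (0 : Fin 3) 2 (f i)) 2 m t = wc f 0 m t :=
    fun m t => by rw [wc_perm']; rfl
  have := h.swap.two_bounds (x := y) (y := x) (by rw [e]; exact (h.vals y).1 hy)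
    (by rw [e]; exact (h.vals x).2.2.1 hx) h0 h1
  rw [e'] at this
  rw [(h.prefix_diff hx hy h0 h1).1]
  rwa [add_sub_cancel_right]

end

/-- Balance bounds every step of length `m` by the count at `z` up to one, and the step at `z` makes
both bounds strict. -/
theorem Twisted.one_bounds (h : Twisted f n v0 v1 v2) {m : ℤ} (h0 : 0 < m) (h1 : m < n) (z : ℤ) :
    n * (wc f 1 m z - 1) < m * v1 ∧ m * v1 < n * (wc f 1 m z + 1) := by
  have hn := h.one_lt
  have hper : ∀ x, prefixCount f 1 (x + n) = prefixCount f 1 x + v1 := fun x => by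
    have := (h.vals x).2.2.2
    unfold wc at this; omega
  constructor
  · refine lt_of_steps (G := prefixCount f 1) (i := z) (by omega) hper (fun i => ?_) ?_
    · have := h.balanced m h0 h1 1 z i
      unfold wc at *; omega
    · unfold wc; omega
  · have := lt_of_steps (G := fun i => -prefixCount f 1 i) (n := n) (m := m) (h := -v1)
      (c := -(wc f 1 m z + 1)) (i := z) (by omega) (fun i => by rw [hper]; ring)
      (fun i => by
        have := h.balanced m h0 h1 1 i z
        unfold wc at *; omega)
      (by unfold wc; omega)
    linarith

theorem Twisted.pos (h : Twisted f n v0 v1 v2) : 0 < v0 ∧ 0 < v1 ∧ 0 < v2 ∧ v0 + v1 + v2 = n := by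
  obtain ⟨x, hx⟩ := h.high
  obtain ⟨y, hy⟩ := h.low
  obtain ⟨z, hz⟩ := h.one
  have hn := h.one_lt
  have h1 := wc_nonneg f 0 (by omega : 0 ≤ n) y
  have h2 := wc_nonneg f 2 (by omega : 0 ≤ n) x
  have h3 := wc_pos f 1 (x := z) (i := 0) (m := n) le_rfl (by omega) (by
    rw [add_zero]; exact ind_eq_one.1 hz)
  have h4 := (h.vals x).2.2.1 hx
  have h5 := (h.vals x).2.2.2
  have h6 := (h.vals z).2.2.2
  have h7 := wc_sum f n x
  omega

/-- The prefixes of a high window feed the arithmetic lemma: the deviations at two lengths differ by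
that of the window in between, which `Twisted.one_bounds` controls. -/
theorem Twisted.frequencies (h : Twisted f n v0 v1 v2) : v1 = v0 ∨ v1 = v2 := by
  obtain ⟨x, hx⟩ := h.high
  obtain ⟨y, hy⟩ := h.low
  obtain ⟨p0, p1, p2, ps⟩ := h.pos
  refine CircularWords.frequencies (u0 := fun m => wc f 0 m x - 1) (u1 := fun m => wc f 1 m x)
    (u2 := fun m => wc f 2 m x) h.one_lt p0 p1 p2 ps (fun m h0 h1 => ?_)
    (fun m h0 h1 => h.two_bounds hx hy h0 h1) (fun m h0 h1 => ?_) (fun i j i0 i1 j0 j1 => ?_)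
  · have := h.zero_bounds hx hy h0 h1
    rwa [sub_add_cancel]
  · have := wc_sum f m x
    omega
  · rcases lt_trichotomy i j with hij | hij | hij
    · have e := wc_add f 1 i (j - i) x
      rw [add_sub_cancel] at e
      have := (h.one_bounds (m := j - i) (by omega) (by omega) (x + i)).1
      rw [e]
      linarith
    · subst hij
      have := h.one_lt
      omega
    · have e := wc_add f 1 j (i - j) x
      rw [add_sub_cancel] at e
      have := (h.one_bounds (m := i - j) (by omega) (by omega) (x + j)).2
      rw [e]
      linarith

end

/-! ### Reconstruction of the word as a coded lattice path. -/

section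

/-- The height of the lower Christoffel path of slope `h / k` after `x` steps, lowered by one at the
lattice points of the line `y = (h / k) x` that `τ` selects. -/
def twistedHeight (k h : ℤ) (τ : ℤ → Bool) (x : ℤ) : ℤ :=
  h * x / (k + h) - if k + h ∣ x ∧ τ (x / (k + h)) = true then 1 else 0

/-- The letters of the path of `twistedHeight`. -/
def twistedStep (k h : ℤ) (τ : ℤ → Bool) (x : ℤ) : Fin 2 :=
  if twistedHeight k h τ x < twistedHeight k h τ (x + 1) then 1 else 0

/-- The image of the path of `twistedHeight` under `φ`. -/
def twistedLetter (k h : ℤ) (τ : ℤ → Bool) (x : ℤ) : Fin 3 :=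
  if twistedHeight k h τ x < twistedHeight k h τ (x + 1) then 2
  else if Even (x - twistedHeight k h τ x) then 0 else 1

theorem twistedHeight_mul {k h : ℤ} (τ : ℤ → Bool) (hL : 0 < k + h) (q : ℤ) :
    twistedHeight k h τ (q * (k + h)) = q * h - if τ q = true then 1 else 0 := by
  unfold twistedHeight
  rw [show h * (q * (k + h)) = q * h * (k + h) by ring, Int.mul_ediv_cancel _ hL.ne',
    Int.mul_ediv_cancel _ hL.ne']
  simp

theorem twistedHeight_of_pos {k h : ℤ} (τ : ℤ → Bool) (q : ℤ) {r : ℤ} (h0 : 0 < r)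
    (h1 : r < k + h) : twistedHeight k h τ (q * (k + h) + r) = q * h + h * r / (k + h) := by
  unfold twistedHeight
  rw [if_neg, show h * (q * (k + h) + r) = h * r + (k + h) * (q * h) by ring,
    Int.add_mul_ediv_left _ _ (by omega)]
  · ring
  · rintro ⟨hd, -⟩
    rw [dvd_add_right (dvd_mul_left _ _)] at hd
    exact absurd (Int.le_of_dvd h0 hd) (by omega)

variable {f : ℤ → Fin 3} {n v0 v1 v2 : ℤ} {N : ℕ}

/-- The strict inequalities of `Twisted.zero_bounds` keep `m * v0` away from the multiples of `n`.
-/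
theorem Twisted.isCoprime_zero (h : Twisted f n v0 v1 v2) : IsCoprime v0 n := by
  obtain ⟨x, hx⟩ := h.high
  obtain ⟨y, hy⟩ := h.low
  have hn := h.one_lt
  refine isCoprime_of_not_dvd (by omega) fun m h0 h1 ⟨c, hc⟩ => ?_
  obtain ⟨p, q⟩ := h.zero_bounds hx hy h0 h1
  rw [hc] at p q
  have p := lt_of_mul_lt_mul_left p (by omega)
  have q := lt_of_mul_lt_mul_left q (by omega)
  clear hc
  omega

theorem Twisted.isCoprime_two (h : Twisted f n v0 v1 v2) : IsCoprime v2 n :=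
  h.swap.isCoprime_zero

section
variable (h : Twisted f n v0 v1 v2) {x : ℤ} (hx : wc f 0 n x = v0 + 1)
include h hx

/-- The occurrences of the letter `1` in a window of extremal state. -/
theorem Twisted.ind_one_eq {z : ℤ} (hz : wc f 0 n z ≠ v0) {i : ℤ} (h0 : 0 ≤ i) (h1 : i < n) :
    ind (f (z + i)) 1 = ind (f (x + i)) 1 := by
  obtain ⟨y, hy⟩ := h.low
  have ax := (h.around x).1 hx
  rcases eq_or_lt_of_le h0 with rfl | h0
  · rw [add_zero, add_zero, (ind_eq_of_one.1 ax.2.1).1]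
    rcases h.state z with hs | hs | hs
    · exact (ind_eq_of_one.2.2 ((h.around z).2 hs.1).2.1).2
    · exact absurd hs.1 hz
    · exact (ind_eq_of_one.1 ((h.around z).1 hs.1).2.1).1
  rcases eq_or_lt_of_le (show i ≤ n - 1 by omega) with rfl | h1
  · rw [show x + (n - 1) = x + n - 1 by ring, show z + (n - 1) = z + n - 1 by ring,
      (ind_eq_of_one.1 ax.2.2.1).1]
    rcases h.state z with hs | hs | hs
    · exact (ind_eq_of_one.2.2 ((h.around z).2 hs.1).2.2.1).2
    · exact absurd hs.1 hz
    · exact (ind_eq_of_one.1 ((h.around z).1 hs.1).2.2.1).1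
  have key : ∀ a b, wc f 0 n a = v0 + 1 → wc f 0 n b = v0 - 1 →
      ind (f (a + i)) 1 = ind (f (b + i)) 1 := fun a b ha hb => by
    have e1 := wc_succ f 1 i a
    have e2 := wc_succ f 1 i b
    have e3 := (h.prefix_diff ha hb (m := i) (by omega) (by omega)).2.1
    have e4 := (h.prefix_diff ha hb (m := i + 1) (by omega) (by omega)).2.1
    omega
  rcases h.state z with hs | hs | hs
  · exact (key x z hx hs.1).symm
  · exact absurd hs.1 hz
  · rw [key z y hs.1 hy, key x y hx hy]

/-- The positions of the windows of extremal state are congruent modulo `n`. -/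
theorem Twisted.dvd_sub_of_extremal (hv : v1 = v0) {z : ℤ} (hz : wc f 0 n z ≠ v0) :
    n ∣ z - x := by
  have hn := h.one_lt
  have hmod : ∀ i k, ind (f (i + k * n)) 1 = ind (f i) 1 :=
    periodic_mul (f := fun i => ind (f i) 1) h.ind_one
  -- The 1s have period `n` and are placed alike in both extremal windows, so `z - x` is another
  -- period of theirs.
  have hq : ∀ i, ind (f (i + (z - x))) 1 = ind (f i) 1 := fun i => by
    have e := Int.emod_add_mul_ediv (i - x) n
    rw [show i = x + (i - x) % n + ((i - x) / n) * n by linarith, hmod,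
      show x + (i - x) % n + ((i - x) / n) * n + (z - x) =
        z + (i - x) % n + ((i - x) / n) * n by ring, hmod]
    exact h.ind_one_eq hx hz (Int.emod_nonneg _ (by omega)) (Int.emod_lt_of_pos _ (by omega))
  have h1 : ∀ i, prefixCount f 1 (i + (z - x)) = prefixCount f 1 i + wc f 1 (z - x) x := fun i => by
    rw [wc_const_of_periodic 1 (fun t => by rw [← ind_eq_one, ← ind_eq_one, hq]) x i]
    unfold wc; ring
  have h2 : ∀ i, prefixCount f 1 (i + n) = prefixCount f 1 i + v1 := fun i => by
    have := (h.vals i).2.2.2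
    unfold wc at this; omega
  have e1 := quasiperiodic_mul h1 x n
  have e2 := quasiperiodic_mul h2 x (z - x)
  rw [mul_comm n] at e1
  -- Counting the 1s over `n * (z - x)` letters with either period; `v1 = v0` is prime to `n`.
  have e3 : (z - x) * v1 = n * wc f 1 (z - x) x := by linarith
  rw [hv] at e3
  exact h.isCoprime_zero.symm.dvd_of_dvd_mul_right ⟨_, e3⟩

theorem Twisted.mid_of_not_dvd (hv : v1 = v0) {z : ℤ} (hz : ¬ n ∣ z - x) : wc f 0 n z = v0 := by
  by_contra hc
  exact hz (h.dvd_sub_of_extremal hx hv hc)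

omit hx in
theorem Twisted.eq_of_mid {z : ℤ} (h0 : wc f 0 n z = v0) (h1 : wc f 0 n (z + 1) = v0) :
    f (z + n) = f z := by
  have e0 := wc_shift f 0 n z
  have e1 := h.ind_one z
  have c := letter_cases (f z)
  have c' := letter_cases (f (z + n))
  rcases c with c | c | c <;> rcases c' with c' | c' | c' <;> omega

/-- The words between the exchanged letters are equal. -/
theorem Twisted.interior (hv : v1 = v0) {r : ℤ} (h0 : 0 < r) (h1 : r < n - 1) (q : ℤ) :
    f (x + (q * n + r)) = f (x + r) := by
  have key : ∀ q, f (x + (q * n + r) + n) = f (x + (q * n + r)) := fun q => by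
    apply h.eq_of_mid
    · refine h.mid_of_not_dvd hx hv fun hd => ?_
      rw [show x + (q * n + r) - x = q * n + r by ring, dvd_add_right (dvd_mul_left _ _)] at hd
      exact absurd (Int.le_of_dvd h0 hd) (by omega)
    · refine h.mid_of_not_dvd hx hv fun hd => ?_
      rw [show x + (q * n + r) + 1 - x = q * n + (r + 1) by ring,
        dvd_add_right (dvd_mul_left _ _)] at hd
      exact absurd (Int.le_of_dvd (by omega) hd) (by omega)
  induction q using Int.induction_on with
  | zero => simp
  | succ i ih => rw [← ih, ← key i]; congr 1; ring
  | pred i ih => rw [← ih, ← key (-(i : ℤ) - 1)]; congr 1; ring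

/-- The letters at the borders between these words. -/
theorem Twisted.border (hv : v1 = v0) (q : ℤ) :
    (f (x + q * n) = 0 ∧ f (x + (q * n - 1)) = 2) ∨
    (f (x + q * n) = 2 ∧ f (x + (q * n - 1)) = 0) := by
  have hn := h.one_lt
  have key : ∀ q, ((f (x + q * n) = 0 ∧ f (x + (q * n - 1)) = 2) ∨
      (f (x + q * n) = 2 ∧ f (x + (q * n - 1)) = 0)) ↔
      ((f (x + (q + 1) * n) = 0 ∧ f (x + ((q + 1) * n - 1)) = 2) ∨
      (f (x + (q + 1) * n) = 2 ∧ f (x + ((q + 1) * n - 1)) = 0)) := fun q => by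
    rw [show x + (q + 1) * n = x + q * n + n by ring,
      show x + ((q + 1) * n - 1) = x + q * n + n - 1 by ring,
      show x + (q * n - 1) = x + q * n - 1 by ring]
    have a := h.around (x + q * n)
    have s := h.state (x + q * n)
    simp only [ind_eq_one] at a
    -- Extremal states exchange the two letters at the next border, the middle state copies them.
    rcases s with s | s | s
    · simp [a.2 s.1]
    · have h1 : wc f 0 n (x + q * n + 1) = v0 := h.mid_of_not_dvd hx hv fun hd => by
        rw [show x + q * n + 1 - x = q * n + 1 by ring, dvd_add_right (dvd_mul_left _ _)] at hd
        exact absurd (Int.le_of_dvd one_pos hd) (by omega)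
      have h2 : wc f 0 n (x + q * n - 1) = v0 := h.mid_of_not_dvd hx hv fun hd => by
        rw [show x + q * n - 1 - x = q * n - 1 by ring, dvd_sub_right (dvd_mul_left _ _)] at hd
        exact absurd (Int.le_of_dvd one_pos hd) (by omega)
      have e1 := h.eq_of_mid s.1 h1
      have e2 := h.eq_of_mid h2 (by rw [sub_add_cancel]; exact s.1)
      rw [show x + q * n - 1 + n = x + q * n + n - 1 by ring] at e2
      rw [e1, e2]
    · simp [a.1 s.1]
  induction q using Int.induction_on with
  | zero =>
    have := ((h.around x).1 hx)
    simp only [ind_eq_one] at this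
    left
    simpa [← sub_eq_add_neg] using ⟨this.2.1, this.1⟩
  | succ i ih => exact (key _).1 ih
  | pred i ih => rw [key]; simpa using ih

/-- Words with a straight spectrum in which `0` and `1` are equally frequent. -/
theorem Twisted.eq_twistedLetter (hv : v1 = v0) (i : ℤ) :
    f (x + i) = twistedLetter (2 * v0) v2 (fun q => decide (f (x + q * n) = 2)) i := by
  obtain ⟨y, hy⟩ := h.low
  obtain ⟨p0, p1, p2, ps⟩ := h.pos
  have hn := h.one_lt
  have hL : 2 * v0 + v2 = n := by omega
  set τ : ℤ → Bool := fun q => decide (f (x + q * n) = 2) with hτ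
  have H0 : ∀ q, twistedHeight (2 * v0) v2 τ (q * n) =
      q * v2 - if f (x + q * n) = 2 then 1 else 0 :=
    fun q => by
      have := twistedHeight_mul (k := 2 * v0) (h := v2) τ (by omega) q
      rw [hL] at this
      rw [this]; simp [hτ]
  have H1 : ∀ q r, 0 < r → r < n → twistedHeight (2 * v0) v2 τ (q * n + r) =
      q * v2 + wc f 2 r x := fun q r r0 r1 => by
    have := twistedHeight_of_pos (k := 2 * v0) (h := v2) τ q r0 (by omega)
    rw [hL] at this
    rw [this]
    congr 1
    obtain ⟨b1, b2⟩ := h.two_bounds hx hy r0 r1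
    rw [Int.ediv_eq_iff_of_pos (by omega)]
    constructor <;> linarith
  have fx := (h.around x).1 hx
  have hw1 : wc f 2 1 x = 0 := by rw [wc_one, (ind_eq_of_one.1 fx.2.1).2]
  have hwn : wc f 2 (n - 1) x = v2 - 1 := by
    have := h.two_complement hx hy one_pos hn
    omega
  have e := Int.emod_add_mul_ediv i n
  have r0 := Int.emod_nonneg i (by omega : n ≠ 0)
  have r1 := Int.emod_lt_of_pos i (by omega : 0 < n)
  generalize i % n = r at *
  generalize i / n = q at *
  rw [show i = q * n + r by linarith]
  clear e i
  unfold twistedLetter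
  rcases eq_or_lt_of_le r0 with rfl | r0
  · rw [add_zero, H1 q 1 one_pos hn, H0, hw1]
    rcases h.border hx hv q with ⟨hb, -⟩ | ⟨hb, -⟩
    · rw [hb]
      simp only [Fin.isValue, Fin.reduceEq, if_false]
      rw [if_neg (by omega), if_pos]
      exact ⟨q * v0, by rw [← hL]; ring⟩
    · rw [hb, if_pos rfl, if_pos (by omega)]
  rcases eq_or_lt_of_le (show r ≤ n - 1 by omega) with rfl | r1
  · rw [show q * n + (n - 1) + 1 = (q + 1) * n by ring, H0, H1 _ _ r0 (by omega), hwn]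
    have hb := h.border hx hv (q + 1)
    rw [show (q + 1) * n - 1 = q * n + (n - 1) by ring] at hb
    rcases hb with ⟨hb, hb'⟩ | ⟨hb, hb'⟩
    · rw [hb, hb', if_pos]
      simp only [Fin.isValue, Fin.reduceEq, if_false]
      linarith
    · rw [hb, hb', if_pos rfl, if_neg (by linarith), if_pos]
      exact ⟨(q + 1) * v0, by rw [← hL]; ring⟩
  · rw [h.interior hx hv r0 r1, add_assoc, H1 _ _ r0 (by omega), H1 _ _ (by omega) (by omega),
      wc_succ]
    obtain ⟨a1, a2⟩ := h.two_bounds hx hy r0 (by omega)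
    obtain ⟨a3, a4⟩ := h.two_bounds hx hy (m := r + 1) (by omega) (by omega)
    obtain ⟨b1, b2⟩ := h.zero_bounds hx hy r0 (by omega)
    obtain ⟨b3, b4⟩ := h.zero_bounds hx hy (m := r + 1) (by omega) (by omega)
    -- The prefix of length `R` with counts `A`, `S`, `C` has as many 1s as 0s, or one fewer. So 0
    -- and 1 alternate, and the parity of the number of horizontal steps tells which comes next.
    have key : ∀ S A C R : ℤ, n * C < R * v2 → R * v2 < n * (C + 1) → n * (A - 1) < R * v0 →
        R * v0 < n * A → A + S + C = R → S = A ∨ S = A - 1 := fun S A C R c1 c2 c3 c4 c5 => by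
      have hR : R * n = 2 * (R * v0) + R * v2 := by rw [← hL]; ring
      have d1 : n * (2 * A - 2) < n * (R - C) := by linarith
      have d2 : n * (R - C - 1) < n * (2 * A) := by linarith
      have := lt_of_mul_lt_mul_left d1 (by omega)
      have := lt_of_mul_lt_mul_left d2 (by omega)
      omega
    have k1 := key _ _ _ _ a1 a2 b1 b2 (wc_sum f r x)
    have k2 := key _ _ _ _ a3 a4 b3 b4 (wc_sum f (r + 1) x)
    have ws := wc_sum f r x
    rw [wc_succ, wc_succ] at k2
    have hpar : Even (q * n + r - (q * v2 + wc f 2 r x)) ↔ wc f 1 r x = wc f 0 r x := by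
      rw [show q * n + r - (q * v2 + wc f 2 r x) =
        q * v0 + q * v0 + (wc f 0 r x + wc f 1 r x) by rw [← hL]; linarith]
      rw [Int.even_add, iff_true_left (Even.add_self _)]
      rcases k1 with k1 | k1 <;> rw [k1]
      · simp
      · constructor
        · rintro ⟨c, hc⟩; omega
        · intro hc; omega
    simp only [hpar]
    rcases letter_cases (f (x + r)) with ⟨c, c0, c1, c2⟩ | ⟨c, c0, c1, c2⟩ | ⟨c, c0, c1, c2⟩
    · rw [if_neg (by omega), if_pos (by omega), c]
    · rw [if_neg (by omega), if_neg (by omega), c]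
    · rw [if_pos (by omega), c]

end

end

/-! ### The classification of unbalanced words. -/

/-- Every window of a full period has the same Parikh vector. -/
theorem AtMostThree.add_period {f : ℤ → Fin 3} {N m : ℤ} (hf : ∀ x, f (x + N) = f x)
    (h : AtMostThree f m) : AtMostThree f (m + N) := by
  have e : ∀ x y, vec f (m + N) x = vec f (m + N) y ↔ vec f m x = vec f m y := fun x y => by
    have e1 : ∀ a t, wc f a (m + N) t = wc f a m t + wc f a N 0 := fun a t => by
      rw [wc_add, wc_const_of_periodic a (fun x => by rw [hf]) (t + m) 0]
    simp only [vec_eq_iff, e1, add_left_inj]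
  intro x y z t
  simp only [ne_eq, e]
  exact h x y z t

theorem balancedAt_one {N : ℕ} (f : ℤ → Fin N) : BalancedAt f 1 := fun a x y => by
  rw [wc_one, wc_one]
  have := ind_le_one a (f x)
  have := ind_nonneg a (f y)
  omega

/-- A periodic word that is not balanced, with at most three Parikh vectors at each length, is
up to a permutation of the letters a power of `00212` or a twisted word. -/
theorem classification {f : ℤ → Fin 3} {N : ℕ} (hN : 0 < N) (hf : ∀ x, f (x + N) = f x)
    (hfull : ∀ a, ∃ x, f x = a) (h3 : ∀ m : ℤ, 0 < m → m ≤ N → AtMostThree f m)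
    (hb : ∃ m : ℕ, 0 < m ∧ m ≤ N ∧ ¬ BalancedAt f m) :
    ∃ σ : Equiv.Perm (Fin 3), ∃ x : ℤ,
      (∀ k : ℕ, σ (f (x + 5 * k)) = 0 ∧ σ (f (x + 5 * k + 1)) = 0 ∧ σ (f (x + 5 * k + 2)) = 2 ∧
        σ (f (x + 5 * k + 3)) = 1 ∧ σ (f (x + 5 * k + 4)) = 2) ∨
      ∃ (a h : ℤ) (τ : ℤ → Bool), 0 < a ∧ 0 < h ∧ IsCoprime h (2 * a + h) ∧ 2 * a + h ∣ N ∧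
        τ 0 = false ∧ τ 1 = true ∧ τ (N / (2 * a + h)) = false ∧
        ∀ i, σ (f (x + i)) = twistedLetter (2 * a) h τ i := by
  classical
  obtain ⟨n, ⟨hn0, hnN, hnb⟩, hmin⟩ : ∃ n : ℕ, (0 < n ∧ n ≤ N ∧ ¬ BalancedAt f n) ∧
      ∀ m : ℕ, 0 < m → m < n → BalancedAt f m :=
    ⟨Nat.find hb, Nat.find_spec hb, fun m h0 h1 => by
      have h2 := Nat.find_min hb h1
      have h4 := (Nat.find_spec hb).2.1
      by_contra hc
      exact h2 ⟨h0, by omega, hc⟩⟩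
  have hbal : ∀ m : ℤ, 0 < m → m < n → BalancedAt f m := fun m h0 h1 => by
    obtain ⟨m, rfl⟩ := Int.eq_ofNat_of_zero_le h0.le
    exact hmin m (by omega) (by omega)
  have hn1 : n ≠ 1 := by
    rintro rfl
    exact hnb (balancedAt_one f)
  have hn2 : n ≠ N := by
    rintro rfl
    refine hnb fun a x y => ?_
    rw [wc_const_of_periodic a (fun x => by rw [hf]) x y]; omega
  obtain ⟨σ, v0, v1, v2, hσ⟩ := exists_path_of_not_balanced (by omega) hf
    (h3 n (by omega) (by omega)) hnb
  have hf' : ∀ x, (fun i => σ (f i)) (x + N) = (fun i => σ (f i)) x := fun x => by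
    simp only [hf]
  have h3' : ∀ m : ℤ, 0 < m → m ≤ N → AtMostThree (fun i => σ (f i)) m :=
    fun m h0 h1 => (h3 m h0 h1).perm σ
  have hbal' : ∀ m : ℤ, 0 < m → m < n → BalancedAt (fun i => σ (f i)) m :=
    fun m h0 h1 => (hbal m h0 h1).perm σ
  rcases hσ with hσ | hσ
  · by_cases h2 : n = 2
    · subst h2
      -- Here `N ≥ 3`. If `N = 3`, length 4 is not covered by the hypothesis and reduces to length
      -- 1.
      have h4 : AtMostThree (fun i => σ (f i)) 4 := by
        by_cases hN4 : 4 ≤ N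
        · exact h3' 4 (by norm_num) (by omega)
        · have : N = 3 := by omega
          subst this
          rw [show (4 : ℤ) = 1 + (3 : ℕ) by norm_num]
          exact (h3' 1 (by norm_num) (by omega)).add_period hf'
      obtain ⟨x, hx⟩ := hσ.two hN hf' (h3' 3 (by norm_num) (by omega)) h4
      exact ⟨σ, x, Or.inl hx⟩
    · exact (hσ.false_of_balanced (by omega) hN hf' (hbal' _ (by omega) (by omega))
        (hbal' _ (by omega) (by omega)) (h3' _ (by omega) (by omega))
        (h3' _ (by omega) (by omega))).elim
  · obtain ⟨y, hy⟩ := hfull (σ.symm 1)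
    have hy1 : ind ((fun i => σ (f i)) y) 1 = 1 := ind_eq_one.2 (by simp [hy])
    have htw : Twisted (fun i => σ (f i)) n v0 v1 v2 :=
      { toStraight := hσ
        around := hσ.letters hN hf' (h3' _ (by omega) (by omega)) (h3' _ (by omega) (by omega))
          (h3' _ (by omega) (by omega)) hy1
        balanced := hbal'
        one := ⟨y, hy1⟩
        one_lt := by omega }
    -- Exchanging 0 and 2 preserves the structure, so 1 may be taken as frequent as 0.
    obtain ⟨ρ, a, b, htw, hρ⟩ : ∃ (ρ : Equiv.Perm (Fin 3)) (a b : ℤ),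
        Twisted (fun i => ρ (f i)) n a a b ∧ 2 * a + b = n := by
      obtain ⟨-, -, -, hs⟩ := htw.pos
      rcases htw.frequencies with hv | hv
      · exact ⟨σ, v0, v2, hv ▸ htw, by omega⟩
      · refine ⟨σ.trans (Equiv.swap 0 2), v2, v0, ?_, by omega⟩
        have := htw.swap
        rw [hv] at this
        exact this
    have hfρ : ∀ x, (fun i => ρ (f i)) (x + N) = (fun i => ρ (f i)) x := fun x => by
      simp only [hf]
    obtain ⟨x, hx⟩ := htw.high
    -- The window at `x + N` is high again, so `n` divides `N`.
    have hd := htw.dvd_sub_of_extremal hx rfl (z := x + N) (by rw [wc_periodic_of hfρ]; omega)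
    rw [add_sub_cancel_left] at hd
    have hax := (htw.around x).1 hx
    simp only [ind_eq_one] at hax
    obtain ⟨pa, -, pb, -⟩ := htw.pos
    refine ⟨ρ, x, Or.inr ⟨a, b, fun q => decide (ρ (f (x + q * n)) = 2), pa, pb, ?_, ?_, ?_, ?_, ?_,
      fun i => htw.eq_twistedLetter hx rfl i⟩⟩
    · rw [hρ]; exact htw.isCoprime_two
    · rw [hρ]; exact hd
    · simp [hax.2.1]
    · simp [hax.2.2.2]
    · beta_reduce
      rw [hρ, Int.ediv_mul_cancel hd, hf]
      simp [hax.2.1]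

/-! ### From periodic functions to lists and circular words. -/

/-- The window of length `m` that starts at `x`. -/
def win {α : Type*} (f : ℤ → α) (x : ℤ) (m : ℕ) : List α :=
  (List.range m).map fun i : ℕ => f (x + (i : ℤ))

section win
variable {α : Type*} (f : ℤ → α)

@[simp] theorem length_win (x : ℤ) (m : ℕ) : (win f x m).length = m := by simp [win]

theorem win_zero (x : ℤ) : win f x 0 = [] := rfl

theorem win_succ (x : ℤ) (m : ℕ) : win f x (m + 1) = f x :: win f (x + 1) m := by
  simp only [win, List.range_succ_eq_map, List.map_cons, List.map_map]
  congr 1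
  · simp
  · apply List.map_congr_left
    intro i _
    simp only [Function.comp]
    push_cast; congr 1; ring

theorem win_add (x : ℤ) (m k : ℕ) : win f x (m + k) = win f x m ++ win f (x + m) k := by
  induction m generalizing x with
  | zero => simp [win_zero]
  | succ m ih =>
    rw [show m + 1 + k = m + k + 1 by ring, win_succ, ih, win_succ]
    push_cast
    rw [List.cons_append, show x + 1 + (m : ℤ) = x + (m + 1) by ring]

theorem win_one (x : ℤ) : win f x 1 = [f x] := by rw [win_succ, win_zero]

theorem mem_win {x : ℤ} {m : ℕ} {a : α} : a ∈ win f x m ↔ ∃ i < m, f (x + (i : ℕ)) = a := by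
  simp [win]

theorem map_win {β : Type*} (g : α → β) (x : ℤ) (m : ℕ) :
    (win f x m).map g = win (fun i => g (f i)) x m := by
  simp [win]

theorem win_congr {f g : ℤ → α} {x y : ℤ} {m : ℕ} (h : ∀ i : ℕ, i < m → f (x + i) = g (y + i)) :
    win f x m = win g y m :=
  List.map_congr_left fun i hi => h i (List.mem_range.1 hi)

theorem eq_of_win_eq {f g : ℤ → α} {x y : ℤ} {m : ℕ} (h : win f x m = win g y m) {i : ℕ}
    (hi : i < m) : f (x + i) = g (y + i) :=
  List.map_inj_left.1 h i (List.mem_range.2 hi)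

theorem eq_win_of_append {x : ℤ} {m : ℕ} {s u t : List α} (h : s ++ u ++ t = win f x m) :
    u = win f (x + s.length) u.length := by
  have hl := congrArg List.length h
  simp only [List.length_append, length_win] at hl
  rw [← hl, win_add, win_add] at h
  have h1 := (List.append_inj h (by simp)).1
  exact (List.append_inj h1 (by simp)).2

variable {f} {N : ℕ}

theorem coe_win_eq (hf : ∀ x, f (x + N) = f x) (x y : ℤ) :
    (win f x N : Cycle α) = (win f y N : Cycle α) := by
  refine eq_of_forall_succ_eq (D := fun x => (win f x N : Cycle α)) (fun x => ?_) x y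
  rcases N with _ | N
  · rfl
  · rw [win_succ f x, win_add, win_one]
    have : f (x + 1 + N) = f x := by rw [← hf x]; congr 1; push_cast; ring
    rw [this]
    exact Quotient.sound (List.IsRotated.symm ⟨1, by simp⟩)

theorem rotate_win (hf : ∀ x, f (x + N) = f x) (x : ℤ) (k : ℕ) :
    (win f x N).rotate k = win f (x + k) N := by
  induction k with
  | zero => simp
  | succ k ih =>
    rw [← List.rotate_rotate, ih, Nat.cast_succ, ← add_assoc]
    generalize x + (k : ℤ) = z
    rcases N with _ | N
    · rfl
    · rw [win_succ, List.rotate_cons_succ, List.rotate_zero]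
      have : f (z + 1 + N) = f z := by rw [← hf z]; congr 1; push_cast; ring
      rw [win_add, win_one, this]

theorem exists_eq_win (hf : ∀ x, f (x + N) = f x) {w : List α} {x : ℤ}
    (hw : (w : Cycle α) = (win f x N : Cycle α)) : ∃ y, w = win f y N := by
  obtain ⟨k, hk⟩ := (Quotient.exact hw).symm
  exact ⟨_, hk.symm.trans (rotate_win hf x k)⟩

theorem eq_of_periodic_of_win_eq {f g : ℤ → α} {x y : ℤ} (hN : 0 < N) (hf : ∀ x, f (x + N) = f x)
    (hg : ∀ x, g (x + N) = g x) (h : win f x N = win g y N) (i : ℤ) : f (x + i) = g (y + i) := by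
  have e := Int.emod_add_mul_ediv i N
  have h0 := Int.emod_nonneg i (by omega : (N : ℤ) ≠ 0)
  have h1 := Int.emod_lt_of_pos i (by omega : (0 : ℤ) < N)
  have := eq_of_win_eq h (i := (i % N).toNat) (by omega)
  rw [Int.toNat_of_nonneg h0] at this
  rw [← periodic_mul hf (x + i % N) (i / N), ← periodic_mul hg (y + i % N) (i / N)] at this
  rwa [show x + i % N + i / N * N = x + i by linarith,
    show y + i % N + i / N * N = y + i by linarith] at this

theorem exists_periodic (w : List α) (hw : w ≠ []) :
    ∃ f : ℤ → α, (∀ x, f (x + w.length) = f x) ∧ w = win f 0 w.length := by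
  have hl : 0 < w.length := List.length_pos_iff.2 hw
  have hb : ∀ i : ℤ, (i % w.length).toNat < w.length := fun i => by
    have := Int.emod_nonneg i (by omega : (w.length : ℤ) ≠ 0)
    have := Int.emod_lt_of_pos i (by omega : (0 : ℤ) < w.length)
    omega
  refine ⟨fun i => w[(i % w.length).toNat]'(hb i), fun x => ?_, ?_⟩
  · simp
  · apply List.ext_getElem (by simp)
    intro i h1 h2
    simp only [win, List.getElem_map, List.getElem_range]
    congr 1
    rw [zero_add, Int.emod_eq_of_lt (by omega) (by omega)]; simp

end win

theorem count_win {M : ℕ} (f : ℤ → Fin M) (a : Fin M) (x : ℤ) (m : ℕ) :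
    ((win f x m).count a : ℤ) = wc f a m x := by
  induction m generalizing x with
  | zero => simp [win_zero, wc_zero]
  | succ m ih =>
    rw [win_succ, List.count_cons]
    push_cast
    rw [wc_succ', ih, ind]
    simp only [beq_iff_eq]; ring

theorem parikh_win_eq_iff {M : ℕ} (f g : ℤ → Fin M) (x y : ℤ) (m : ℕ) :
    parikh (win f x m) = parikh (win g y m) ↔ vec f m x = vec g m y := by
  simp only [funext_iff, parikh, vec, ← count_win, Nat.cast_inj]

section circ
variable {M N : ℕ} {f : ℤ → Fin M}

/-- Representatives are exactly the windows of length `N`, and a shorter window is a prefix of one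
of them. -/
theorem circSpec_win (hf : ∀ x, f (x + N) = f x) {m : ℕ} (hm : m ≤ N) :
    circSpec m (win f 0 N : CircWord M) = Set.range fun x => parikh (win f x m) := by
  ext p
  constructor
  · rintro ⟨w, hw, u, ⟨s, t, hu⟩, rfl, rfl⟩
    obtain ⟨y, rfl⟩ := exists_eq_win hf hw
    exact ⟨_, congrArg parikh (eq_win_of_append f hu).symm⟩
  · rintro ⟨x, rfl⟩
    refine ⟨win f x N, coe_win_eq hf _ _, win f x m, ?_, length_win _ _ _, rfl⟩
    obtain ⟨k, rfl⟩ := Nat.exists_eq_add_of_le hm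
    rw [win_add]
    exact (List.prefix_append _ _).isInfix

/-- A set has at most three elements if there are no four distinct elements. -/
theorem encard_le_three_iff {α : Type*} {s : Set α} : s.encard ≤ 3 ↔
    ∀ x ∈ s, ∀ y ∈ s, ∀ z ∈ s, ∀ t ∈ s, x ≠ y → x ≠ z → y ≠ z → t = x ∨ t = y ∨ t = z := by
  constructor
  · intro h x hx y hy z hz t ht hxy hxz hyz
    have h3 : ({x, y, z} : Set α).encard = 3 := Set.encard_eq_three.2 ⟨x, y, z, hxy, hxz, hyz, rfl⟩
    have hs : ({x, y, z} : Set α) ⊆ s := by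
      rintro a (rfl | rfl | rfl) <;> assumption
    have := (Set.toFinite {x, y, z}).eq_of_subset_of_encard_le hs (by rw [h3]; exact h)
    rw [← this] at ht
    simpa using ht
  · intro h
    by_contra hc
    push Not at hc
    have h4 : (4 : ℕ∞) ≤ s.encard := by
      have := Order.add_one_le_of_lt hc
      exact this
    obtain ⟨r, hr, hr4⟩ := Set.exists_subset_encard_eq h4
    have hrne : r.Nonempty := by
      rw [← Set.encard_pos, hr4]; norm_num
    obtain ⟨t, ht⟩ := hrne
    have h3 : (r \ {t}).encard = 3 := by
      have := Set.encard_sdiff_singleton_add_one ht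
      rw [hr4] at this
      have h41 : (4 : ℕ∞) = 3 + 1 := by norm_num
      rw [h41] at this
      exact ENat.add_left_injective_of_ne_top (n := 1) (by norm_num) this
    obtain ⟨x, y, z, hxy, hxz, hyz, e⟩ := Set.encard_eq_three.1 h3
    have hx : x ∈ r \ {t} := by rw [e]; simp
    have hy : y ∈ r \ {t} := by rw [e]; simp
    have hz : z ∈ r \ {t} := by rw [e]; simp
    rcases h x (hr hx.1) y (hr hy.1) z (hr hz.1) t (hr ht) hxy hxz hyz with rfl | rfl | rfl
    · exact hx.2 rfl
    · exact hy.2 rfl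
    · exact hz.2 rfl

theorem circAb_le_three_iff (hf : ∀ x, f (x + N) = f x) {m : ℕ} (hm : m ≤ N) :
    circAb m (win f 0 N : CircWord M) ≤ 3 ↔ AtMostThree f m := by
  rw [circAb, circSpec_win hf hm, encard_le_three_iff]
  simp only [Set.forall_mem_range, ne_eq, parikh_win_eq_iff]
  rfl

theorem IsCircBalanced.wc_le (hf : ∀ x, f (x + N) = f x)
    (h : IsCircBalanced (win f 0 N : CircWord M)) {m d : ℕ} (hd : d + m ≤ N) (a : Fin M) (x : ℤ) :
    wc f a m x ≤ wc f a m (x + d) + 1 ∧ wc f a m (x + d) ≤ wc f a m x + 1 := by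
  have h1 : win f x m <:+: win f x N := by
    obtain ⟨k, rfl⟩ := Nat.exists_eq_add_of_le (show m ≤ N by omega)
    rw [win_add]
    exact (List.prefix_append _ _).isInfix
  have h2 : win f (x + d) m <:+: win f x N := by
    obtain ⟨k, rfl⟩ := Nat.exists_eq_add_of_le hd
    exact ⟨win f x d, win f (x + (d + m : ℕ)) k, by rw [win_add, win_add]⟩
  have := (h _ (coe_win_eq hf x 0)).2 _ _ h1 h2 (by simp) a
  rw [parikh, parikh, count_win, count_win, abs_le] at this
  omega

/-- Factors are only compared within one representative, so two windows that overlap around the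
circle need an argument. -/
theorem isCircBalanced_win_iff (hN : 0 < N) (hf : ∀ x, f (x + N) = f x) :
    IsCircBalanced (win f 0 N : CircWord M) ↔ ∀ m : ℕ, m ≤ N → BalancedAt f m := by
  constructor
  · intro h m hm a x y
    -- Two windows of at most half the period fit into one representative that starts with one or
    -- the other.
    have key : ∀ (m : ℕ) (x y : ℤ), 2 * m ≤ N → wc f a m x ≤ wc f a m y + 1 := fun m x y hm => by
      have hmod : wc f a m (x + (y - x) % N) = wc f a m y := by
        have := periodic_mul (f := wc f a m) (fun x => wc_periodic a (fun x => by rw [hf]) m x)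
          (x + (y - x) % N) ((y - x) / N)
        rw [← this]
        congr 1
        linarith [Int.emod_add_mul_ediv (y - x) N]
      have h0 := Int.emod_nonneg (y - x) (by omega : (N : ℤ) ≠ 0)
      have h1 := Int.emod_lt_of_pos (y - x) (by omega : (0 : ℤ) < N)
      rw [← hmod]
      obtain ⟨d, hd⟩ := Int.eq_ofNat_of_zero_le h0
      rw [hd] at h1 ⊢
      by_cases hdm : d + m ≤ N
      · exact (h.wc_le hf hdm a x).1
      · have := (h.wc_le hf (m := m) (d := N - d) (by omega) a (x + d)).2
        rwa [show x + (d : ℤ) + ((N - d : ℕ) : ℤ) = x + N by push_cast [show d ≤ N by omega]; ring,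
          wc_periodic a (fun x => by rw [hf])] at this
    by_cases hm2 : 2 * m ≤ N
    · exact key m x y hm2
    -- Longer windows have short complements in a period, for which the inequality is reversed.
    · have := key (N - m) (y + m) (x + m) (by omega)
      have e1 := wc_add f a m (N - m : ℕ) x
      have e2 := wc_add f a m (N - m : ℕ) y
      rw [show (m : ℤ) + (N - m : ℕ) = N by omega] at e1 e2
      have e3 := wc_const_of_periodic a (fun x => by rw [hf]) x y (q := N) (f := f)
      omega
  · intro h w hw
    obtain ⟨z, rfl⟩ := exists_eq_win hf hw
    refine ⟨fun hc => ?_, ?_⟩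
    · have := congrArg List.length hc
      simp at this; omega
    · rintro u v ⟨s, t, hu⟩ ⟨s', t', hv⟩ huv a
      have hm : u.length ≤ N := by
        have := congrArg List.length hu
        simp at this; omega
      have eu := eq_win_of_append f hu
      have ev := eq_win_of_append f hv
      rw [parikh, parikh, eu, ev, count_win, count_win, ← huv, abs_le]
      have h1 := h _ hm a (z + s.length) (z + s'.length)
      have h2 := h _ hm a (z + s'.length) (z + s.length)
      constructor <;> omega

end circ

theorem parikh_singleton_injective {M : ℕ} : Function.Injective fun a : Fin M => parikh [a] := by
  intro a b h
  have := congrFun h a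
  simp only [parikh, List.count_singleton, beq_self_eq_true, if_true] at this
  by_contra hc
  simp [Ne.symm hc] at this

theorem mem_fullWords_three {w : Word 3} : w ∈ fullWords 3 ↔ ∀ a, a ∈ w := by
  have h1 : spec 1 w = (fun a : Fin 3 => parikh [a]) '' {a | a ∈ w} := by
    ext p
    constructor
    · rintro ⟨u, hu, hl, rfl⟩
      obtain ⟨a, rfl⟩ := List.length_eq_one_iff.1 hl
      exact ⟨a, hu.subset (by simp), rfl⟩
    · rintro ⟨a, ha, rfl⟩
      obtain ⟨s, t, rfl⟩ := List.append_of_mem ha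
      exact ⟨[a], ⟨s, t, by simp⟩, rfl, rfl⟩
  have h2 : (Set.univ : Set (Fin 3)).encard = 3 := by
    rw [Set.encard_univ]; simp
  simp only [fullWords, ab, Set.mem_ofPred_eq]
  rw [h1, parikh_singleton_injective.encard_image]
  constructor
  · intro h a
    have : {a | a ∈ w} = Set.univ := (Set.toFinite _).eq_of_subset_of_encard_le
      (Set.subset_univ _) (by rw [h2, h]; norm_num)
    exact this.symm.subset (Set.mem_univ a)
  · intro h
    have : {a | a ∈ w} = Set.univ := Set.eq_univ_of_forall h
    rw [this, h2]; norm_num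

section
variable {N : ℕ} {f : ℤ → Fin 3}

theorem mem_circ_fullWords_iff (hN : 0 < N) (hf : ∀ x, f (x + N) = f x) :
    (win f 0 N : CircWord 3) ∈ circ (fullWords 3) ↔ ∀ a, ∃ x, f x = a := by
  constructor
  · rintro ⟨w, hw, e⟩ a
    obtain ⟨y, rfl⟩ := exists_eq_win hf e
    obtain ⟨i, -, hi⟩ := (mem_win f).1 (mem_fullWords_three.1 hw a)
    exact ⟨_, hi⟩
  · intro h
    refine ⟨_, mem_fullWords_three.2 fun a => ?_, rfl⟩
    obtain ⟨x, rfl⟩ := h a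
    have h0 := Int.emod_nonneg x (by omega : (N : ℤ) ≠ 0)
    have h1 := Int.emod_lt_of_pos x (by omega : (0 : ℤ) < N)
    refine (mem_win f).2 ⟨(x % N).toNat, by omega, ?_⟩
    rw [Int.toNat_of_nonneg h0, zero_add, ← periodic_mul hf (x % N) (x / N)]
    congr 1
    linarith [Int.emod_add_mul_ediv x N]

/-- That no bound below 3 works is automatic: at length 1 the three letters give three vectors. -/
theorem mem_abelianBounded_iff (hN : 0 < N) (hf : ∀ x, f (x + N) = f x) :
    (win f 0 N : CircWord 3) ∈ abelianBoundedCircWords 3 3 ↔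
      (∀ a, ∃ x, f x = a) ∧ ∀ m : ℤ, 0 < m → m ≤ N → AtMostThree f m := by
  rw [abelianBoundedCircWords, Set.mem_ofPred_eq, mem_circ_fullWords_iff hN hf]
  refine and_congr_right fun hfull => ?_
  have hlen : (win f 0 N : CircWord 3).length = N := by
    rw [Cycle.length_coe, length_win]
  rw [IsAbelianBounded, hlen]
  constructor
  · intro h m h0 h1
    obtain ⟨m, rfl⟩ := Int.eq_ofNat_of_zero_le h0.le
    exact (circAb_le_three_iff hf (by omega)).1 (h.1 m (by omega) (by omega))
  · intro h
    refine ⟨fun m h0 h1 => (circAb_le_three_iff hf (by omega)).2 (h m (by omega) (by omega)),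
      fun q hq => ?_⟩
    have h1 := hq 1 le_rfl hN
    rw [circAb, circSpec_win hf hN] at h1
    have h2 : (Set.range fun x => parikh (win f x 1)) = Set.range fun a : Fin 3 => parikh [a] := by
      ext p
      simp only [win_one]
      constructor
      · rintro ⟨x, rfl⟩; exact ⟨f x, rfl⟩
      · rintro ⟨a, rfl⟩
        obtain ⟨x, rfl⟩ := hfull a
        exact ⟨x, rfl⟩
    rw [h2, ← Set.image_univ, parikh_singleton_injective.encard_image, Set.encard_univ] at h1
    simp only [ENat.card_eq_coe_fintype_card, Fintype.card_fin] at h1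
    exact_mod_cast h1

theorem mem_balanced_iff (hN : 0 < N) (hf : ∀ x, f (x + N) = f x) :
    (win f 0 N : CircWord 3) ∈ balancedCircWords 3 ↔
      (∀ a, ∃ x, f x = a) ∧ ∀ m : ℕ, m ≤ N → BalancedAt f m := by
  rw [balancedCircWords, Set.mem_ofPred_eq, mem_circ_fullWords_iff hN hf,
    isCircBalanced_win_iff hN hf]

/-- Circular words that contain all letters are represented by periodic functions. -/
theorem exists_rep_of_mem_circ_fullWords {c : CircWord 3} (hc : c ∈ circ (fullWords 3)) :
    ∃ (N : ℕ) (f : ℤ → Fin 3), 0 < N ∧ (∀ x, f (x + N) = f x) ∧ c = (win f 0 N : CircWord 3) := by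
  obtain ⟨w, hw, rfl⟩ := hc
  have hne : w ≠ [] := by
    rintro rfl
    simpa using mem_fullWords_three.1 hw 0
  obtain ⟨f, hf, e⟩ := exists_periodic w hne
  exact ⟨w.length, f, List.length_pos_iff.2 hne, hf, congrArg _ e⟩

end

/-! ### Balanced words and the exceptional word. -/

/-- Balanced words have at most three Parikh vectors at each length. -/
theorem BalancedAt.atMostThree {f : ℤ → Fin 3} {m : ℤ} (h : BalancedAt f m) : AtMostThree f m := by
  intro x y z t hxy hxz hyz
  have hd : ∀ a, ∃ c, ∀ s, s = x ∨ s = y ∨ s = z ∨ s = t → wc f a m s = c ∨ wc f a m s = c + 1 :=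
    fun a => by
      refine ⟨min (min (wc f a m x) (wc f a m y)) (min (wc f a m z) (wc f a m t)), ?_⟩
      have h1 := fun s => h a s x
      have h2 := fun s => h a s y
      have h3 := fun s => h a s z
      have h4 := fun s => h a s t
      rintro s hs
      have := h1 s; have := h2 s; have := h3 s; have := h4 s
      rcases hs with rfl | rfl | rfl | rfl <;> omega
  obtain ⟨c0, hc0⟩ := hd 0
  obtain ⟨c1, hc1⟩ := hd 1
  obtain ⟨c2, hc2⟩ := hd 2
  have key : ∃ A B C : Fin 3 → ℤ, ∀ s, s = x ∨ s = y ∨ s = z ∨ s = t →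
      vec f m s = A ∨ vec f m s = B ∨ vec f m s = C := by
    have e : ∀ s p q r, wc f 0 m s = p → wc f 1 m s = q → wc f 2 m s = r →
        vec f m s = ![p, q, r] := by
      rintro s _ _ _ rfl rfl rfl
      funext a; fin_cases a <;> rfl
    -- The excess of `m` over `c0 + c1 + c2` is the number of letters at their upper value. If it is
    -- at most one, the vector is fixed by one letter that may be up; otherwise by one that may be
    -- down.
    by_cases hj : m ≤ c0 + c1 + c2 + 1
    · refine ⟨![m - c1 - c2, c1, c2], ![c0, m - c0 - c2, c2], ![c0, c1, m - c0 - c1],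
        fun s hs => ?_⟩
      have h0 := hc0 s hs
      have h1 := hc1 s hs
      have h2 := hc2 s hs
      have h3 := wc_sum f m s
      have h4 : (wc f 1 m s = c1 ∧ wc f 2 m s = c2) ∨ (wc f 0 m s = c0 ∧ wc f 2 m s = c2) ∨
          (wc f 0 m s = c0 ∧ wc f 1 m s = c1) := by clear hc0 hc1 hc2 hd h e; omega
      rcases h4 with h4 | h4 | h4
      · exact Or.inl (e _ _ _ _ (by omega) h4.1 h4.2)
      · exact Or.inr (Or.inl (e _ _ _ _ h4.1 (by omega) h4.2))
      · exact Or.inr (Or.inr (e _ _ _ _ h4.1 h4.2 (by omega)))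
    · refine ⟨![m - c1 - c2 - 2, c1 + 1, c2 + 1], ![c0 + 1, m - c0 - c2 - 2, c2 + 1],
        ![c0 + 1, c1 + 1, m - c0 - c1 - 2], fun s hs => ?_⟩
      have h0 := hc0 s hs
      have h1 := hc1 s hs
      have h2 := hc2 s hs
      have h3 := wc_sum f m s
      have h4 : (wc f 1 m s = c1 + 1 ∧ wc f 2 m s = c2 + 1) ∨
          (wc f 0 m s = c0 + 1 ∧ wc f 2 m s = c2 + 1) ∨
          (wc f 0 m s = c0 + 1 ∧ wc f 1 m s = c1 + 1) := by clear hc0 hc1 hc2 hd h e; omega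
      rcases h4 with h4 | h4 | h4
      · exact Or.inl (e _ _ _ _ (by omega) h4.1 h4.2)
      · exact Or.inr (Or.inl (e _ _ _ _ h4.1 (by omega) h4.2))
      · exact Or.inr (Or.inr (e _ _ _ _ h4.1 h4.2 (by omega)))
  obtain ⟨A, B, C, hk⟩ := key
  have hx := hk x (by simp)
  have hy := hk y (by simp)
  have hz := hk z (by simp)
  have ht := hk t (by simp)
  clear hk hc0 hc1 hc2 hd h
  generalize vec f m x = p at *
  generalize vec f m y = q at *
  generalize vec f m z = r at *
  generalize vec f m t = s at *
  grind

theorem wc_comp_add {M : ℕ} (f : ℤ → Fin M) (x : ℤ) (a : Fin M) (m y : ℤ) :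
    wc (fun i => f (i + x)) a m y = wc f a m (y + x) := by
  have := eq_of_forall_succ_eq
    (D := fun y => prefixCount (fun i => f (i + x)) a y - prefixCount f a (y + x)) (fun y => by
      rw [show y + 1 + x = y + x + 1 by ring, prefixCount_succ, prefixCount_succ]; ring)
    (y + m) y
  unfold wc
  rw [show y + x + m = y + m + x by ring]
  linarith

/-- Words that are equal up to a shift and a permutation of the letters. -/
theorem BalancedAt.of_shift {f g : ℤ → Fin 3} {σ : Equiv.Perm (Fin 3)} {x m : ℤ}
    (h : ∀ i, f (x + i) = σ (g i)) (hf : BalancedAt f m) : BalancedAt g m := by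
  intro a p q
  have e : ∀ y, wc g a m y = wc f (σ a) m (y + x) := fun y => by
    rw [← wc_comp_add, ← wc_perm σ g]
    congr 1
    funext i
    rw [add_comm i x, h]
  rw [e, e]
  exact hf _ _ _

/-- The periodic word with period `00212`. -/
def exceptionalWord (i : ℤ) : Fin 3 :=
  if i % 5 = 2 ∨ i % 5 = 4 then 2 else if i % 5 = 3 then 1 else 0

theorem exceptionalWord_add_five (i : ℤ) : exceptionalWord (i + 5) = exceptionalWord i := by
  simp [exceptionalWord]

theorem exceptionalWord_cases (i : ℤ) :
    (i % 5 = 0 ∧ exceptionalWord i = 0 ∧ exceptionalWord (i + 1) = 0 ∧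
      exceptionalWord (i + 2) = 2) ∨
    (i % 5 = 1 ∧ exceptionalWord i = 0 ∧ exceptionalWord (i + 1) = 2 ∧
      exceptionalWord (i + 2) = 1) ∨
    (i % 5 = 2 ∧ exceptionalWord i = 2 ∧ exceptionalWord (i + 1) = 1 ∧
      exceptionalWord (i + 2) = 2) ∨
    (i % 5 = 3 ∧ exceptionalWord i = 1 ∧ exceptionalWord (i + 1) = 2 ∧
      exceptionalWord (i + 2) = 0) ∨
    (i % 5 = 4 ∧ exceptionalWord i = 2 ∧ exceptionalWord (i + 1) = 0 ∧
      exceptionalWord (i + 2) = 0) := by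
  unfold exceptionalWord
  have h : i % 5 = 0 ∨ i % 5 = 1 ∨ i % 5 = 2 ∨ i % 5 = 3 ∨ i % 5 = 4 := by omega
  rcases h with h | h | h | h | h
  · have h1 : (i + 1) % 5 = 1 := by omega
    have h2 : (i + 2) % 5 = 2 := by omega
    simp [h, h1, h2]
  · have h1 : (i + 1) % 5 = 2 := by omega
    have h2 : (i + 2) % 5 = 3 := by omega
    simp [h, h1, h2]
  · have h1 : (i + 1) % 5 = 3 := by omega
    have h2 : (i + 2) % 5 = 4 := by omega
    simp [h, h1, h2]
  · have h1 : (i + 1) % 5 = 4 := by omega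
    have h2 : (i + 2) % 5 = 0 := by omega
    simp [h, h1, h2]
  · have h1 : (i + 1) % 5 = 0 := by omega
    have h2 : (i + 2) % 5 = 1 := by omega
    simp [h, h1, h2]

theorem atMostThree_of_cases {f : ℤ → Fin 3} {m : ℤ} {A B C : Fin 3 → ℤ}
    (h : ∀ x, vec f m x = A ∨ vec f m x = B ∨ vec f m x = C) : AtMostThree f m := by
  intro x y z t
  have hx := h x
  have hy := h y
  have hz := h z
  have ht := h t
  clear h
  generalize vec f m x = p at *
  generalize vec f m y = q at *
  generalize vec f m z = r at *
  generalize vec f m t = s at *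
  grind

theorem vec_eq_of {f : ℤ → Fin 3} {m x p q r : ℤ} (h0 : wc f 0 m x = p) (h1 : wc f 1 m x = q)
    (h2 : wc f 2 m x = r) : vec f m x = ![p, q, r] := by
  subst h0 h1 h2
  funext a; fin_cases a <;> rfl

/-- Lengths matter modulo 5 only; 1 and 4 are balanced, 4 because it is a period without one letter,
while 2 and 3 are listed. -/
theorem atMostThree_exceptionalWord {m : ℤ} (hm : 0 < m) : AtMostThree exceptionalWord m := by
  have h0 : AtMostThree exceptionalWord 0 := fun x y z t h => by
    exact absurd (vec_eq_iff.2 ⟨by simp [wc_zero], by simp [wc_zero], by simp [wc_zero]⟩) h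
  have h2 : AtMostThree exceptionalWord 2 := by
    refine atMostThree_of_cases (A := ![2, 0, 0]) (B := ![1, 0, 1]) (C := ![0, 1, 1]) fun x => ?_
    rcases exceptionalWord_cases x with ⟨-, a, b, -⟩ | ⟨-, a, b, -⟩ | ⟨-, a, b, -⟩ | ⟨-, a, b, -⟩ |
      ⟨-, a, b, -⟩
    · left; apply vec_eq_of <;> rw [wc_two, a, b] <;> rfl
    · right; left; apply vec_eq_of <;> rw [wc_two, a, b] <;> rfl
    · right; right; apply vec_eq_of <;> rw [wc_two, a, b] <;> rfl
    · right; right; apply vec_eq_of <;> rw [wc_two, a, b] <;> rfl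
    · right; left; apply vec_eq_of <;> rw [wc_two, a, b] <;> rfl
  have h3 : AtMostThree exceptionalWord 3 := by
    refine atMostThree_of_cases (A := ![2, 0, 1]) (B := ![1, 1, 1]) (C := ![0, 1, 2]) fun x => ?_
    rcases exceptionalWord_cases x with ⟨-, a, b, c⟩ | ⟨-, a, b, c⟩ | ⟨-, a, b, c⟩ | ⟨-, a, b, c⟩ |
      ⟨-, a, b, c⟩
    · left; apply vec_eq_of <;> rw [wc_three, a, b, c] <;> rfl
    · right; left; apply vec_eq_of <;> rw [wc_three, a, b, c] <;> rfl
    · right; right; apply vec_eq_of <;> rw [wc_three, a, b, c] <;> rfl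
    · right; left; apply vec_eq_of <;> rw [wc_three, a, b, c] <;> rfl
    · left; apply vec_eq_of <;> rw [wc_three, a, b, c] <;> rfl
  have h4 : BalancedAt exceptionalWord 4 := fun a x y => by
    have e : ∀ t, wc exceptionalWord a 4 t = wc exceptionalWord a 5 0 -
        ind (exceptionalWord (t + 5 - 1)) a := fun t => by
      rw [← wc_const_of_periodic a (fun x => by rw [exceptionalWord_add_five]) t 0, ← wc_pred]
      norm_num
    rw [e, e]
    have := ind_nonneg a (exceptionalWord (x + 5 - 1))
    have := ind_le_one a (exceptionalWord (y + 5 - 1))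
    omega
  obtain ⟨m, rfl⟩ := Int.eq_ofNat_of_zero_le hm.le
  have key : ∀ k r : ℕ, AtMostThree exceptionalWord r →
      AtMostThree exceptionalWord (r + 5 * k : ℕ) := fun k r hr => by
    induction k with
    | zero => exact hr
    | succ k ih =>
      have := ih.add_period exceptionalWord_add_five
      rwa [show ((r + 5 * (k + 1) : ℕ) : ℤ) = (r + 5 * k : ℕ) + 5 by push_cast; ring]
  have hr : m % 5 < 5 := Nat.mod_lt _ (by norm_num)
  rw [← Nat.mod_add_div m 5]
  apply key
  generalize m % 5 = r at *
  interval_cases r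
  · exact h0
  · exact (balancedAt_one _).atMostThree
  · exact h2
  · exact h3
  · exact h4.atMostThree

theorem wordPow_win {M : ℕ} {g : ℤ → Fin M} {L : ℕ} (hg : ∀ x, g (x + L) = g x) (y : ℤ) (p : ℕ) :
    wordPow (win g y L) p = win g y (L * p) := by
  induction p with
  | zero => rfl
  | succ p ih =>
    rw [wordPow, List.replicate_succ, List.flatten_cons, ← wordPow, ih,
      show L * (p + 1) = L + L * p by ring, win_add]
    congr 1
    exact win_congr fun i _ => by rw [show y + (L : ℤ) + i = y + i + L by ring, hg]

/-- Exchanging 1 and 2 turns 00212 into 00121, a rotation of 01210. -/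
theorem mem_exceptionalPrimitive {d : CircWord 3} : d ∈ exceptionalPrimitive ↔
    ∃ σ : Equiv.Perm (Fin 3), d = (win (fun i => σ (exceptionalWord i)) 0 5 : CircWord 3) := by
  have e : (([0, 1, 2, 1, 0] : Word 3) : CircWord 3) =
      (win (fun i => Equiv.swap 1 2 (exceptionalWord i)) 0 5 : CircWord 3) := by
    have : win (fun i => Equiv.swap 1 2 (exceptionalWord i)) 0 5 = [0, 0, 1, 2, 1] := by decide
    rw [this]
    exact Quotient.sound ⟨4, by decide⟩
  have e2 : ∀ σ : Equiv.Perm (Fin 3),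
      Cycle.map σ (([0, 1, 2, 1, 0] : Word 3) : CircWord 3) =
        (win (fun i => σ (Equiv.swap 1 2 (exceptionalWord i))) 0 5 : CircWord 3) := fun σ => by
    rw [e, Cycle.map_coe, map_win]
  constructor
  · rintro ⟨σ, d, hd, rfl⟩
    refine ⟨(Equiv.swap 1 2).trans σ, ?_⟩
    rw [Set.mem_singleton_iff.1 hd, e2]
    rfl
  · rintro ⟨σ, rfl⟩
    refine ⟨(Equiv.swap 1 2).trans σ, _, rfl, ?_⟩
    rw [e2]
    simp

theorem mem_exceptional_iff {N : ℕ} {f : ℤ → Fin 3} (hN : 0 < N) (hf : ∀ x, f (x + N) = f x) :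
    (win f 0 N : CircWord 3) ∈ exceptionalCircWords ↔
      ∃ (σ : Equiv.Perm (Fin 3)) (x : ℤ), ∀ i, f (x + i) = σ (exceptionalWord i) := by
  have hper : ∀ (σ : Equiv.Perm (Fin 3)) (x : ℤ),
      (fun i => σ (exceptionalWord i)) (x + (5 : ℕ)) = (fun i => σ (exceptionalWord i)) x :=
    fun σ x => by simp only [Nat.cast_ofNat, exceptionalWord_add_five]
  have hper' : ∀ (σ : Equiv.Perm (Fin 3)) (p : ℕ) (x : ℤ),
      (fun i => σ (exceptionalWord i)) (x + (5 * p : ℕ)) = (fun i => σ (exceptionalWord i)) x :=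
    fun σ p x => by
      have := periodic_mul (f := fun i => σ (exceptionalWord i)) (hper σ) x p
      rwa [show (p : ℤ) * (5 : ℕ) = (5 * p : ℕ) by push_cast; ring] at this
  constructor
  · rintro ⟨d, hd, p, hp, h⟩
    obtain ⟨σ, rfl⟩ := mem_exceptionalPrimitive.1 hd
    obtain ⟨v, hv, e⟩ := h _ rfl
    obtain ⟨y, rfl⟩ := exists_eq_win (hper σ) hv
    rw [wordPow_win (hper σ)] at e
    have hl := congrArg List.length e
    rw [length_win, length_win] at hl
    subst hl
    have := eq_of_periodic_of_win_eq hN hf (hper' σ p) e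
    refine ⟨σ, -y, fun i => ?_⟩
    have := this (-y + i)
    rwa [zero_add, add_neg_cancel_left] at this
  · rintro ⟨σ, x, h⟩
    -- The letter 1 occurs once in 00212, so every period is a multiple of 5.
    have h5 : (5 : ℤ) ∣ N := by
      have h1 : exceptionalWord (3 + N) = exceptionalWord 3 := by
        apply σ.injective
        rw [← h, ← h, ← add_assoc, hf]
      have h2 : exceptionalWord 3 = 1 := rfl
      rw [h2] at h1
      rcases exceptionalWord_cases (3 + N) with ⟨a, b, -⟩ | ⟨a, b, -⟩ | ⟨a, b, -⟩ | ⟨a, b, -⟩ |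
        ⟨a, b, -⟩
      · rw [b] at h1; exact absurd h1 (by decide)
      · rw [b] at h1; exact absurd h1 (by decide)
      · rw [b] at h1; exact absurd h1 (by decide)
      · omega
      · rw [b] at h1; exact absurd h1 (by decide)
    obtain ⟨p, rfl⟩ : ∃ p, N = 5 * p := ⟨N / 5, by omega⟩
    refine ⟨_, mem_exceptionalPrimitive.2 ⟨σ, rfl⟩, p, by omega, fun w hw => ?_⟩
    obtain ⟨y, rfl⟩ := exists_eq_win hf hw
    refine ⟨win (fun i => σ (exceptionalWord i)) (y - x) 5, coe_win_eq (hper σ) _ _, ?_⟩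
    rw [wordPow_win (hper σ)]
    refine win_congr fun i _ => ?_
    rw [show y + (i : ℤ) = x + (y - x + i) by ring, h]

/-- The factors 00 and 21 differ by two in the letter 0. -/
theorem exceptionalWord_not_balanced : ¬ BalancedAt exceptionalWord 2 := fun h => by
  have := h 0 0 2
  rw [wc_two, wc_two] at this
  revert this
  decide

theorem eq_exceptionalWord_of_nat {N : ℕ} {f : ℤ → Fin 3} (hf : ∀ x, f (x + N) = f x) {x : ℤ}
    (h : ∀ k : ℕ, f (x + 5 * k) = 0 ∧ f (x + 5 * k + 1) = 0 ∧ f (x + 5 * k + 2) = 2 ∧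
      f (x + 5 * k + 3) = 1 ∧ f (x + 5 * k + 4) = 2) (hN : 0 < N) (i : ℤ) :
    f (x + i) = exceptionalWord i := by
  have key : ∀ j : ℤ, 0 ≤ j → f (x + j) = exceptionalWord j := fun j hj => by
    have h0 := h (j / 5).toNat
    rw [Int.toNat_of_nonneg (by omega)] at h0
    have e : j = 5 * (j / 5) + j % 5 := (Int.mul_ediv_add_emod j 5).symm
    have hr : j % 5 = 0 ∨ j % 5 = 1 ∨ j % 5 = 2 ∨ j % 5 = 3 ∨ j % 5 = 4 := by omega
    unfold exceptionalWord
    rcases hr with hr | hr | hr | hr | hr <;> rw [hr] <;> rw [hr] at e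
    · rw [show x + j = x + 5 * (j / 5) by omega, h0.1]; rfl
    · rw [show x + j = x + 5 * (j / 5) + 1 by omega, h0.2.1]; rfl
    · rw [show x + j = x + 5 * (j / 5) + 2 by omega, h0.2.2.1]; rfl
    · rw [show x + j = x + 5 * (j / 5) + 3 by omega, h0.2.2.2.1]; rfl
    · rw [show x + j = x + 5 * (j / 5) + 4 by omega, h0.2.2.2.2]; rfl
  -- The shift is a period of both functions and makes the index nonnegative.
  have h1 := key (i + (5 * |i|) * N) (by nlinarith [neg_abs_le i, abs_nonneg i])
  rw [← add_assoc, periodic_mul hf,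
    show i + 5 * |i| * (N : ℤ) = i + (|i| * N) * 5 by ring,
    periodic_mul exceptionalWord_add_five] at h1
  exact h1

/-! ### Heights of twisted paths and their words. -/

section height
variable {k h : ℤ} {τ : ℤ → Bool}

theorem ediv_succ_cases {k h : ℤ} (hk : 0 < k) (hh : 0 < h) (x : ℤ) :
    h * (x + 1) / (k + h) = h * x / (k + h) ∨ h * (x + 1) / (k + h) = h * x / (k + h) + 1 := by
  have e1 := Int.emod_add_mul_ediv (h * x) (k + h)
  have r0 := Int.emod_nonneg (h * x) (by omega : k + h ≠ 0)
  have r1 := Int.emod_lt_of_pos (h * x) (by omega : 0 < k + h)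
  generalize h * x / (k + h) = q at *
  by_cases hc : h * x % (k + h) + h < k + h
  · left
    rw [Int.ediv_eq_iff_of_pos (by omega)]
    constructor <;> nlinarith
  · right
    rw [Int.ediv_eq_iff_of_pos (by omega)]
    constructor <;> nlinarith

/-- The height just before a lattice point. -/
theorem twistedHeight_mul_sub_one (hk : 0 < k) (hh : 0 < h) (q : ℤ) :
    twistedHeight k h τ (q * (k + h) - 1) = q * h - 1 := by
  rw [show q * (k + h) - 1 = (q - 1) * (k + h) + (k + h - 1) by ring,
    twistedHeight_of_pos τ _ (by omega) (by omega),
    (Int.ediv_eq_iff_of_pos (by omega) : h * (k + h - 1) / (k + h) = h - 1 ↔ _).2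
      (by constructor <;> nlinarith)]
  ring

theorem twistedHeight_mul_add_one (hk : 0 < k) (hh : 0 < h) (q : ℤ) :
    twistedHeight k h τ (q * (k + h) + 1) = q * h := by
  rw [twistedHeight_of_pos τ _ (by omega) (by omega), mul_one,
    Int.ediv_eq_zero_of_lt (by omega) (by omega), add_zero]

/-- The residues modulo `n` in a form adapted to the borders. -/
theorem residue_cases {n : ℤ} (hn : 2 ≤ n) (x : ℤ) :
    ∃ q, x = q * n ∨ x = q * n - 1 ∨ ∃ r, 0 < r ∧ r < n - 1 ∧ x = q * n + r := by
  have e := Int.emod_add_mul_ediv x n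
  have r0 := Int.emod_nonneg x (by omega : n ≠ 0)
  have r1 := Int.emod_lt_of_pos x (by omega : 0 < n)
  rcases eq_or_lt_of_le r0 with r0 | r0
  · exact ⟨x / n, Or.inl (by linarith)⟩
  rcases eq_or_lt_of_le (show x % n ≤ n - 1 by omega) with r1 | r1
  · exact ⟨x / n + 1, Or.inr (Or.inl (by linarith))⟩
  · exact ⟨x / n, Or.inr (Or.inr ⟨x % n, r0, r1, by linarith⟩)⟩

theorem twistedHeight_succ (hk : 0 < k) (hh : 0 < h) (x : ℤ) :
    twistedHeight k h τ (x + 1) = twistedHeight k h τ x ∨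
    twistedHeight k h τ (x + 1) = twistedHeight k h τ x + 1 := by
  obtain ⟨q, rfl | rfl | ⟨r, r0, r1, rfl⟩⟩ := residue_cases (show 2 ≤ k + h by omega) x
  · rw [twistedHeight_mul_add_one hk hh, twistedHeight_mul τ (by omega)]
    split <;> omega
  · rw [sub_add_cancel, twistedHeight_mul_sub_one hk hh, twistedHeight_mul τ (by omega)]
    split <;> omega
  · rw [add_assoc, twistedHeight_of_pos τ q r0 (by omega),
      twistedHeight_of_pos τ q (by omega) (by omega)]
    rcases ediv_succ_cases hk hh r with e | e <;> rw [e] <;> omega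

theorem twistedStep_mul (hk : 0 < k) (hh : 0 < h) (q : ℤ) :
    twistedStep k h τ (q * (k + h)) = if τ q = true then 1 else 0 := by
  rw [twistedStep, twistedHeight_mul_add_one hk hh, twistedHeight_mul τ (by omega)]
  split
  · rw [if_pos (by omega)]
  · rw [if_neg (by omega)]

theorem twistedStep_mul_sub_one (hk : 0 < k) (hh : 0 < h) (q : ℤ) :
    twistedStep k h τ (q * (k + h) - 1) = if τ q = true then 0 else 1 := by
  rw [twistedStep, sub_add_cancel, twistedHeight_mul_sub_one hk hh, twistedHeight_mul τ (by omega)]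
  split
  · rw [if_neg (by omega)]
  · rw [if_pos (by omega)]

theorem twistedStep_of_pos (τ' : ℤ → Bool) (q q' : ℤ) {r : ℤ} (r0 : 0 < r) (r1 : r < k + h - 1) :
    twistedStep k h τ (q * (k + h) + r) = twistedStep k h τ' (q' * (k + h) + r) := by
  simp only [twistedStep, add_assoc]
  rw [twistedHeight_of_pos τ q r0 (by omega), twistedHeight_of_pos τ q (by omega) (by omega),
    twistedHeight_of_pos τ' q' r0 (by omega), twistedHeight_of_pos τ' q' (by omega) (by omega)]
  simp only [add_lt_add_iff_left]

end height

/-- After `t` steps the path has height `⌊h * t / (k + h)⌋`; the hypothesis on `y` is this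
invariant. -/
theorem lowerPath_eq_win {k h : ℕ} (hk : 0 < k) (hh : 0 < h) (n x y : ℕ)
    (hy : (y : ℤ) = h * (x + y) / (k + h)) :
    lowerPath k h n x y = win (twistedStep k h fun _ => false) (x + y) n := by
  have hH : ∀ t, twistedHeight k h (fun _ => false) t = h * t / (k + h) := fun t => by
    simp [twistedHeight]
  induction n generalizing x y with
  | zero => simp [lowerPath, win_zero]
  | succ n ih =>
    have h1 := ediv_succ_cases (k := k) (h := h) (by omega) (by omega) (x + y)
    -- Adding `h * (y + 1)` to both sides turns the test of the path into a test on the floor.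
    have hc : k * (y + 1) ≤ h * x ↔ ((y : ℤ) + 1) ≤ h * (x + y + 1) / (k + h) := by
      rw [Int.le_ediv_iff_mul_le (by omega), ← Nat.cast_le (α := ℤ)]
      push_cast
      constructor <;> intro _ <;> linarith
    rw [lowerPath, win_succ, twistedStep, hH, hH, ← hy]
    by_cases hle : k * (y + 1) ≤ h * x
    · have h2 := hc.1 hle
      rw [if_pos hle, if_pos (by omega), ih x (y + 1)]
      · push_cast; rw [← add_assoc]
      · push_cast; rw [← add_assoc]; omega
    · have h2 := fun h' => hle (hc.2 h')
      rw [if_neg hle, if_neg (by omega), ih (x + 1) y]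
      · push_cast; rw [show (x : ℤ) + 1 + y = x + y + 1 by ring]
      · push_cast; rw [show (x : ℤ) + 1 + y = x + y + 1 by ring]; omega

theorem christoffel_eq_win {k h : ℕ} (hk : 0 < k) (hh : 0 < h) :
    christoffel k h = win (twistedStep k h fun _ => false) 0 (k + h) := by
  have := lowerPath_eq_win hk hh (k + h) 0 0 (by simp)
  simpa [christoffel] using this

/-- The word between the first and the last letter of a Christoffel word. -/
theorem christoffel_eq {k h : ℕ} (hk : 0 < k) (hh : 0 < h) :
    christoffel k h = [0] ++ win (twistedStep k h fun _ => false) 1 (k + h - 2) ++ [1] := by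
  rw [christoffel_eq_win hk hh]
  conv_lhs => rw [show k + h = 1 + (k + h - 2) + 1 by omega]
  rw [win_add, win_add, win_one, win_one]
  have h1 := twistedStep_mul (k := k) (h := h) (τ := fun _ => false) (by omega) (by omega) 0
  have h2 := twistedStep_mul_sub_one (k := k) (h := h) (τ := fun _ => false) (by omega) (by omega) 1
  rw [show (0 : ℤ) + (1 + (k + h - 2) : ℕ) = 1 * (k + h) - 1 by omega, h2]
  rw [zero_mul] at h1
  rw [h1]
  simp

section twist
variable {k h : ℕ} (hk : 0 < k) (hh : 0 < h) (τ : ℤ → Bool)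
include hk hh

omit hk hh in
theorem win_interior (q : ℤ) : win (twistedStep k h τ) (q * (k + h) + 1) (k + h - 2) =
    win (twistedStep k h fun _ => false) 1 (k + h - 2) :=
  win_congr fun i hi => by
    rw [add_assoc, twistedStep_of_pos (fun _ => false) q 0 (by omega) (by omega), zero_mul,
      zero_add]

/-- Each entry of `s` contributes a border, whose two letters straddle a lattice point, and the
block after it; hence the window starts one place before `q * (k + h)`. -/
theorem flatMap_eq_win (s : List Bool) (q : ℤ)
    (hs : ∀ i : ℕ, (hi : i < s.length) → τ (q + i) = s[i]) :
    s.flatMap (fun t => (if t then [0, 1] else [1, 0]) ++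
      win (twistedStep k h fun _ => false) 1 (k + h - 2)) =
      win (twistedStep k h τ) (q * (k + h) - 1) ((k + h) * s.length) := by
  induction s generalizing q with
  | nil => simp [win_zero]
  | cons t s ih =>
    have ht : τ q = t := by
      have h0 := hs 0 (by simp)
      rw [Nat.cast_zero, add_zero] at h0
      exact h0
    rw [List.flatMap_cons, ih (q + 1) (fun i hi => by
      have := hs (i + 1) (by simpa using hi)
      simpa [add_assoc, add_comm (1 : ℤ)] using this), List.length_cons,
      show (k + h) * (s.length + 1) = 1 + 1 + (k + h - 2) + (k + h) * s.length by
        rw [mul_add]; omega,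
      win_add, win_add, win_add, win_one, win_one]
    rw [show q * ((k : ℤ) + h) - 1 + ((1 + 1 + (k + h - 2) : ℕ)) = (q + 1) * (k + h) - 1 by
        rw [add_mul]; omega,
      show q * ((k : ℤ) + h) - 1 + (1 + 1 : ℕ) = q * (k + h) + 1 by push_cast; ring,
      show q * ((k : ℤ) + h) - 1 + (1 : ℕ) = q * (k + h) by push_cast; ring,
      win_interior τ, twistedStep_mul (by omega) (by omega),
      twistedStep_mul_sub_one (by omega) (by omega), ht]
    cases t <;> simp

theorem twist_eq_win (s : List Bool) (h0 : τ 0 = false) (h1 : τ (s.length + 1) = false)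
    (hs : ∀ i : ℕ, (hi : i < s.length) → τ (1 + i) = s[i]) :
    twist (win (twistedStep k h fun _ => false) 1 (k + h - 2)) s =
      win (twistedStep k h τ) 0 ((k + h) * (s.length + 1)) := by
  rw [twist, flatMap_eq_win hk hh τ s 1 hs,
    show (k + h) * (s.length + 1) = 1 + (k + h - 2) + (k + h) * s.length + 1 by
      rw [mul_add]; omega, win_add, win_add, win_add, win_one, win_one]
  rw [show (0 : ℤ) + ((1 + (k + h - 2) + (k + h) * s.length : ℕ) : ℤ) =
      (s.length + 1) * (k + h) - 1 by
        push_cast [show 2 ≤ k + h by omega]; ring,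
    show (0 : ℤ) + ((1 + (k + h - 2) : ℕ) : ℤ) = 1 * (k + h) - 1 by omega,
    twistedStep_mul_sub_one (by omega) (by omega), h1]
  have e0 := twistedStep_mul (k := k) (h := h) (τ := τ) (by omega) (by omega) 0
  have e1 := win_interior (k := k) (h := h) τ 0
  rw [zero_mul] at e0 e1
  rw [e0, h0]
  simp only [Nat.cast_one]
  rw [e1]
  simp

/-- The flag of `phiAux` is the parity of the number of horizontal steps made so far; `τ 0 = false`
starts it at height 0. -/
theorem phi_win (h0 : τ 0 = false) (m : ℕ) :
    phi (win (twistedStep k h τ) 0 m) = win (twistedLetter k h τ) 0 m := by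
  have key : ∀ (m : ℕ) (x : ℤ), phiAux (!decide (Even (x - twistedHeight k h τ x)))
      (win (twistedStep k h τ) x m) = win (twistedLetter k h τ) x m := fun m => by
    induction m with
    | zero => intro x; rfl
    | succ m ih =>
      intro x
      rw [win_succ, win_succ, phiAux, ← ih (x + 1), twistedStep, twistedLetter]
      rcases twistedHeight_succ (τ := τ) (k := k) (h := h) (by omega) (by omega) x with e | e
      · have he' : Even (x - twistedHeight k h τ x + 1) ↔ ¬Even (x - twistedHeight k h τ x) :=
          Int.even_add_one
        rw [e, if_neg (lt_irrefl _), if_neg (lt_irrefl _), if_neg (by decide),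
          show x + 1 - twistedHeight k h τ x = x - twistedHeight k h τ x + 1 by ring]
        by_cases he : Even (x - twistedHeight k h τ x) <;> simp [he, he']
      · rw [e, if_pos (lt_add_one _), if_pos (lt_add_one _), if_pos rfl]
        simp
  have := key m 0
  have e := twistedHeight_mul (k := k) (h := h) τ (by omega) 0
  rw [zero_mul, if_neg (by simp [h0])] at e
  rw [e] at this
  simpa [phi] using this

end twist

/-! ### Spectra of twisted words. -/

/-- The remainders of `A` and `B` produce a carry or not. Without a carry, a divisible sum has both
remainders zero; a carry requires that of `A` to be nonzero. -/
theorem add_ediv_cases {L : ℤ} (hL : 0 < L) (A B : ℤ) :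
    ((A + B) / L = A / L + B / L ∧ (L ∣ A + B → L ∣ B)) ∨
    ((A + B) / L = A / L + B / L + 1 ∧ ¬ L ∣ A) := by
  have e1 := Int.emod_add_mul_ediv A L
  have e2 := Int.emod_add_mul_ediv B L
  have e3 := Int.emod_add_mul_ediv (A + B) L
  have r0 := Int.emod_nonneg A hL.ne'
  have r1 := Int.emod_nonneg B hL.ne'
  have s0 := Int.emod_lt_of_pos A hL
  have s1 := Int.emod_lt_of_pos B hL
  by_cases h : A % L + B % L < L
  · have e : (A + B) / L = A / L + B / L := by
      rw [Int.ediv_eq_iff_of_pos hL]; constructor <;> nlinarith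
    refine Or.inl ⟨e, fun hd => ?_⟩
    rw [e, Int.emod_eq_zero_of_dvd hd, mul_add] at e3
    exact Int.dvd_of_emod_eq_zero (by linarith)
  · have e : (A + B) / L = A / L + B / L + 1 := by
      rw [Int.ediv_eq_iff_of_pos hL]; constructor <;> nlinarith
    refine Or.inr ⟨e, fun hd => ?_⟩
    have := Int.emod_eq_zero_of_dvd hd
    omega

section counts
variable {k h : ℤ} (hk : 0 < k) (hh : 0 < h) (τ : ℤ → Bool)
include hk hh

/-- As 0 and 1 alternate, `t` horizontal steps comprise `(t + 1) / 2` letters 0 and `t / 2` letters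
1. -/
theorem ind_twistedLetter (x : ℤ) :
    ind (twistedLetter k h τ x) 2 = twistedHeight k h τ (x + 1) - twistedHeight k h τ x ∧
    ind (twistedLetter k h τ x) 0 = (x + 1 - twistedHeight k h τ (x + 1) + 1) / 2 -
      (x - twistedHeight k h τ x + 1) / 2 ∧
    ind (twistedLetter k h τ x) 1 = (x + 1 - twistedHeight k h τ (x + 1)) / 2 -
      (x - twistedHeight k h τ x) / 2 := by
  rw [twistedLetter]
  rcases twistedHeight_succ (τ := τ) hk hh x with e | e <;> rw [e]
  · rw [if_neg (lt_irrefl _)]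
    by_cases he : Even (x - twistedHeight k h τ x)
    · rw [if_pos he]
      rw [Int.even_iff] at he
      rw [show ind (0 : Fin 3) 2 = 0 from rfl, show ind (0 : Fin 3) 0 = 1 from rfl,
        show ind (0 : Fin 3) 1 = 0 from rfl]
      omega
    · rw [if_neg he]
      rw [Int.even_iff] at he
      rw [show ind (1 : Fin 3) 2 = 0 from rfl, show ind (1 : Fin 3) 0 = 0 from rfl,
        show ind (1 : Fin 3) 1 = 1 from rfl]
      omega
  · rw [if_pos (lt_add_one _), show ind (2 : Fin 3) 2 = 1 from rfl,
      show ind (2 : Fin 3) 0 = 0 from rfl, show ind (2 : Fin 3) 1 = 0 from rfl]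
    omega

theorem wc_twistedLetter (m y : ℤ) :
    wc (twistedLetter k h τ) 2 m y = twistedHeight k h τ (y + m) - twistedHeight k h τ y ∧
    wc (twistedLetter k h τ) 0 m y = (y + m - twistedHeight k h τ (y + m) + 1) / 2 -
      (y - twistedHeight k h τ y + 1) / 2 ∧
    wc (twistedLetter k h τ) 1 m y = (y + m - twistedHeight k h τ (y + m)) / 2 -
      (y - twistedHeight k h τ y) / 2 := by
  have e2 := eq_of_forall_succ_eq
    (D := fun x => prefixCount (twistedLetter k h τ) 2 x - twistedHeight k h τ x)
    (fun x => by rw [prefixCount_succ, (ind_twistedLetter hk hh τ x).1]; ring) (y + m) y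
  have e0 := eq_of_forall_succ_eq
    (D := fun x => prefixCount (twistedLetter k h τ) 0 x - (x - twistedHeight k h τ x + 1) / 2)
    (fun x => by rw [prefixCount_succ, (ind_twistedLetter hk hh τ x).2.1]; ring) (y + m) y
  have e1 := eq_of_forall_succ_eq
    (D := fun x => prefixCount (twistedLetter k h τ) 1 x - (x - twistedHeight k h τ x) / 2)
    (fun x => by rw [prefixCount_succ, (ind_twistedLetter hk hh τ x).2.2]; ring) (y + m) y
  unfold wc
  exact ⟨by linarith, by linarith, by linarith⟩

/-- Away from the multiples of `k + h`, windows of equal length rise by two consecutive amounts. -/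
theorem twistedHeight_sub (hc : IsCoprime h (k + h)) {m : ℤ} (hm : ¬ k + h ∣ m) (y : ℤ) :
    twistedHeight k h τ (y + m) - twistedHeight k h τ y = h * m / (k + h) ∨
    twistedHeight k h τ (y + m) - twistedHeight k h τ y = h * m / (k + h) + 1 := by
  have hL : 0 < k + h := by omega
  have hB : ¬ k + h ∣ h * m := fun hd => hm (hc.symm.dvd_of_dvd_mul_left hd)
  have key := add_ediv_cases hL (h * y) (h * m)
  unfold twistedHeight
  rw [mul_add]
  -- A lattice point at the start excludes a carry, so lowering it may add one; a lattice point at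
  -- the end forces a carry, so lowering it may remove one.
  by_cases hy : k + h ∣ y
  · have hym : ¬ k + h ∣ y + m := fun hd => hm ((dvd_add_right hy).1 hd)
    have hA : k + h ∣ h * y := hy.mul_left _
    rw [if_neg (fun hd : k + h ∣ y + m ∧ _ => hym hd.1)]
    split <;> rcases key with key | key <;> omega
  · rw [if_neg (fun hd : k + h ∣ y ∧ _ => hy hd.1)]
    by_cases hym : k + h ∣ y + m
    · have hA : k + h ∣ h * y + h * m := by rw [← mul_add]; exact hym.mul_left _
      split <;> rcases key with key | key <;> omega
    · rw [if_neg (fun hd : k + h ∣ y + m ∧ _ => hym hd.1)]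
      omega

theorem twistedHeight_add_mul {y : ℤ} (hy : ¬ k + h ∣ y) (j : ℤ) :
    twistedHeight k h τ (y + j * (k + h)) = twistedHeight k h τ y + j * h := by
  have hL : 0 < k + h := by omega
  have hym : ¬ k + h ∣ y + j * (k + h) := fun hd =>
    hy ((dvd_add_left (dvd_mul_left _ _)).1 hd)
  unfold twistedHeight
  rw [if_neg (fun hd : k + h ∣ y ∧ _ => hy hd.1),
    if_neg (fun hd : k + h ∣ y + j * (k + h) ∧ _ => hym hd.1),
    show h * (y + j * (k + h)) = h * y + (k + h) * (j * h) by ring,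
    Int.add_mul_ediv_left _ _ hL.ne']
  ring

end counts

section even
variable {a h : ℤ} (ha : 0 < a) (hh : 0 < h) (τ : ℤ → Bool)
include ha hh

theorem vec_twistedLetter_of_not_dvd {y : ℤ} (hy : ¬ 2 * a + h ∣ y) (j : ℤ) :
    vec (twistedLetter (2 * a) h τ) (j * (2 * a + h)) y = ![j * a, j * a, j * h] := by
  obtain ⟨e2, e0, e1⟩ := wc_twistedLetter (by omega : 0 < 2 * a) hh τ (j * (2 * a + h)) y
  have e := twistedHeight_add_mul (by omega : 0 < 2 * a) hh τ hy j
  rw [e] at e0 e1 e2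
  have en : j * (2 * a + h) = 2 * (j * a) + j * h := by ring
  apply vec_eq_of <;> omega

theorem vec_twistedLetter_mul (j q : ℤ) :
    vec (twistedLetter (2 * a) h τ) (j * (2 * a + h)) (q * (2 * a + h)) =
      if τ q = τ (q + j) then ![j * a, j * a, j * h]
      else if τ q = true then ![j * a - 1, j * a, j * h + 1]
      else ![j * a + 1, j * a, j * h - 1] := by
  obtain ⟨e2, e0, e1⟩ := wc_twistedLetter (by omega : 0 < 2 * a) hh τ (j * (2 * a + h))
    (q * (2 * a + h))
  rw [show q * (2 * a + h) + j * (2 * a + h) = (q + j) * (2 * a + h) by ring,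
    twistedHeight_mul τ (by omega), twistedHeight_mul τ (by omega)] at e0 e1 e2
  have en : (q + j) * (2 * a + h) = 2 * (q * a) + 2 * (j * a) + q * h + j * h := by ring
  have en' : q * (2 * a + h) = 2 * (q * a) + q * h := by ring
  have en'' : (q + j) * h = q * h + j * h := by ring
  cases hq : τ q <;> cases hj : τ (q + j) <;>
    simp only [hq, hj, if_true, if_false, Bool.false_eq_true, reduceCtorEq] at * <;>
    apply vec_eq_of <;> omega

/-- At multiples of `2 * a + h` only lattice points can deviate, by one step up or down. At other
lengths there are two possible heights: one leaves an even number of horizontal letters, split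
equally between 0 and 1, the other an odd number, split in two ways. -/
theorem atMostThree_twistedLetter (hc : IsCoprime h (2 * a + h)) (m : ℤ) :
    AtMostThree (twistedLetter (2 * a) h τ) m := by
  by_cases hm : 2 * a + h ∣ m
  · obtain ⟨j, rfl⟩ := hm
    rw [mul_comm (2 * a + h) j]
    refine atMostThree_of_cases (A := ![j * a, j * a, j * h]) (B := ![j * a - 1, j * a, j * h + 1])
      (C := ![j * a + 1, j * a, j * h - 1]) fun y => ?_
    by_cases hy : 2 * a + h ∣ y
    · obtain ⟨q, rfl⟩ := hy
      rw [mul_comm _ q, vec_twistedLetter_mul ha hh]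
      split_ifs <;> simp
    · exact Or.inl (vec_twistedLetter_of_not_dvd ha hh τ hy j)
  · have hd := twistedHeight_sub (by omega : 0 < 2 * a) hh τ hc hm
    have hw := wc_twistedLetter (by omega : 0 < 2 * a) hh τ m
    generalize h * m / (2 * a + h) = c at hd
    obtain ⟨e, he | he⟩ := Int.even_or_odd' (m - c - 1)
    · refine atMostThree_of_cases (A := ![e, e, c + 1]) (B := ![e + 1, e, c])
        (C := ![e, e + 1, c]) fun y => ?_
      obtain ⟨e2, e0, e1⟩ := hw y
      rcases hd y with hy | hy
      · rcases Int.even_or_odd' (y - twistedHeight (2 * a) h τ y) with ⟨z, hz | hz⟩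
        · exact Or.inr (Or.inl (vec_eq_of (by omega) (by omega) (by omega)))
        · exact Or.inr (Or.inr (vec_eq_of (by omega) (by omega) (by omega)))
      · exact Or.inl (vec_eq_of (by omega) (by omega) (by omega))
    · refine atMostThree_of_cases (A := ![e + 1, e + 1, c]) (B := ![e + 1, e, c + 1])
        (C := ![e, e + 1, c + 1]) fun y => ?_
      obtain ⟨e2, e0, e1⟩ := hw y
      rcases hd y with hy | hy
      · exact Or.inl (vec_eq_of (by omega) (by omega) (by omega))
      · rcases Int.even_or_odd' (y - twistedHeight (2 * a) h τ y) with ⟨z, hz | hz⟩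
        · exact Or.inr (Or.inl (vec_eq_of (by omega) (by omega) (by omega)))
        · exact Or.inr (Or.inr (vec_eq_of (by omega) (by omega) (by omega)))

theorem exists_twistedLetter_eq (b : Fin 3) : ∃ x, twistedLetter (2 * a) h τ x = b := by
  by_contra! hc
  have h1 := vec_twistedLetter_of_not_dvd ha hh τ (y := 1)
    (fun hd => by have := Int.le_of_dvd one_pos hd; omega) 1
  have h2 : wc (twistedLetter (2 * a) h τ) b (1 * (2 * a + h)) 1 = 0 :=
    (eq_of_forall_succ_eq (D := fun m => wc (twistedLetter (2 * a) h τ) b m 1)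
      (fun m => by rw [wc_succ, ind_eq_zero.2 (hc _), add_zero]) _ 0).trans (wc_zero _ _ _)
  have h3 : vec (twistedLetter (2 * a) h τ) (1 * (2 * a + h)) 1 b = 0 := h2
  rw [h1] at h3
  fin_cases b <;> simp at h3 <;> omega

/-- The mark is switched on and later off again; the windows between the lattice points at these
switches have `h - 1` and `h + 1` letters 2. -/
theorem twistedLetter_not_balanced {q P : ℤ} (h0 : τ 0 = false) (hq : τ q = true)
    (hq0 : 0 ≤ q) (hqP : q ≤ P) (hP : τ P = false) :
    ¬ BalancedAt (twistedLetter (2 * a) h τ) (2 * a + h) := fun hb => by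
  obtain ⟨x, -, -, hx0, hx1⟩ := exists_switch (p := fun z => τ z = false) h0 (by simp [hq]) hq0
  obtain ⟨y, -, -, hy0, hy1⟩ := exists_switch (p := fun z => τ z = true) hq (by simp [hP]) hqP
  have e1 := congrFun (vec_twistedLetter_mul ha hh τ 1 x) 2
  have e2 := congrFun (vec_twistedLetter_mul ha hh τ 1 y) 2
  rw [Bool.not_eq_false] at hx1
  rw [Bool.not_eq_true] at hy1
  simp only [hx0, hx1, hy0, hy1, one_mul, vec] at e1 e2
  have := hb 2 (y * (2 * a + h)) (x * (2 * a + h))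
  simp at e1 e2
  omega

/-- No renaming of the exceptional word is a twisted word. -/
theorem twistedLetter_ne_exceptionalWord (hc : IsCoprime h (2 * a + h)) (π : Equiv.Perm (Fin 3))
    (x : ℤ) : ¬ ∀ i, twistedLetter (2 * a) h τ (x + i) = π (exceptionalWord i) := fun hx => by
  have h2 : ¬ 2 * a + h ∣ 2 := fun hd => by have := Int.le_of_dvd two_pos hd; omega
  have e0 : ∀ b, wc (twistedLetter (2 * a) h τ) b 2 x = ind (π 0) b + ind (π 0) b := fun b => by
    have h0 := hx 0
    rw [add_zero] at h0
    rw [wc_two, h0, hx 1]; rfl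
  have e1 : ∀ b, wc (twistedLetter (2 * a) h τ) b 2 (x + 2) = ind (π 2) b + ind (π 1) b :=
    fun b => by rw [wc_two, hx 2, add_assoc, hx (2 + 1)]; rfl
  have hw := wc_twistedLetter (by omega : 0 < 2 * a) hh τ 2
  have hd := twistedHeight_sub (by omega : 0 < 2 * a) hh τ hc h2
  -- Consecutive horizontal letters alternate between 0 and 1, so only 2 can be doubled.
  have hb : π 0 = 2 := by
    have e := e0 (π 0)
    rw [ind_eq_one.2 rfl] at e
    obtain ⟨w2, w0, w1⟩ := hw x
    have hd := twistedHeight_succ (τ := τ) (by omega : 0 < 2 * a) hh x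
    have hd' := twistedHeight_succ (τ := τ) (by omega : 0 < 2 * a) hh (x + 1)
    rw [add_assoc] at hd'
    norm_num at hd'
    rcases letter_cases (π 0) with hl | hl | hl
    · rw [hl.1] at e; omega
    · rw [hl.1] at e; omega
    · exact hl.1
  have n1 : π 1 ≠ 2 := fun hn => absurd (π.injective (hb.trans hn.symm)) (by decide)
  have n2 : π 2 ≠ 2 := fun hn => absurd (π.injective (hb.trans hn.symm)) (by decide)
  have f0 := e0 2
  have f1 := e1 2
  rw [ind_eq_one.2 hb] at f0
  rw [ind_eq_zero.2 n1, ind_eq_zero.2 n2] at f1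
  -- The windows at `x` and `x + 2` have two 2s and none, but at length 2, which is below `2 * a +
  -- h`, the heights differ by at most one.
  have := hd x
  have := hd (x + 2)
  have := (hw x).1
  have := (hw (x + 2)).1
  omega

end even

/-! ### Twisted words as periodic functions. -/

/-- The shift adds `2 * a * P` horizontal steps, an even number, so the alternation of 0 and 1 is
unaffected. -/
theorem twistedLetter_add_mul {a h : ℤ} (ha : 0 < a) (hh : 0 < h) {τ : ℤ → Bool} {P : ℤ}
    (hτ : ∀ q, τ (q + P) = τ q) (x : ℤ) :
    twistedLetter (2 * a) h τ (x + (2 * a + h) * P) = twistedLetter (2 * a) h τ x := by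
  have hL : 2 * a + h ≠ 0 := by omega
  have key : ∀ x, twistedHeight (2 * a) h τ (x + (2 * a + h) * P) =
      twistedHeight (2 * a) h τ x + P * h := fun x => by
    unfold twistedHeight
    rw [show h * (x + (2 * a + h) * P) = h * x + (2 * a + h) * (P * h) by ring,
      Int.add_mul_ediv_left _ _ hL, Int.add_mul_ediv_left _ _ hL, hτ]
    simp only [dvd_add_left (dvd_mul_right (2 * a + h) P)]
    ring
  unfold twistedLetter
  rw [show x + (2 * a + h) * P + 1 = x + 1 + (2 * a + h) * P by ring, key, key,
    show x + (2 * a + h) * P - (twistedHeight (2 * a) h τ x + P * h) =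
      x - twistedHeight (2 * a) h τ x + 2 * (P * a) by ring]
  simp [Int.even_add]

/-- The periodic marking of the borders given by a list. -/
def borderMark (s : List Bool) (q : ℤ) : Bool :=
  (false :: s).getD (q % (s.length + 1)).toNat false

theorem borderMark_add (s : List Bool) (q : ℤ) :
    borderMark s (q + (s.length + 1)) = borderMark s q := by
  simp [borderMark]

theorem borderMark_zero (s : List Bool) : borderMark s 0 = false := by
  simp [borderMark]

theorem borderMark_length (s : List Bool) : borderMark s (s.length + 1) = false := by
  simp [borderMark]

theorem borderMark_get (s : List Bool) (i : ℕ) (hi : i < s.length) :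
    borderMark s (1 + i) = s[i] := by
  rw [borderMark, Int.emod_eq_of_lt (by omega) (by omega),
    show (1 + (i : ℤ)).toNat = i + 1 by omega]
  simp [hi]

theorem isCoprime_add_iff {a h : ℕ} :
    IsCoprime (h : ℤ) (2 * a + h) ↔ Nat.Coprime (2 * a) h := by
  rw [show (2 * (a : ℤ) + h) = ((2 * a : ℕ) : ℤ) + h by push_cast; rfl,
    ← Nat.isCoprime_iff_coprime, isCoprime_comm]
  simpa using IsCoprime.add_mul_right_left_iff (x := ((2 * a : ℕ) : ℤ)) (y := (h : ℤ)) (z := 1)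

theorem phi_twist {a h : ℕ} (ha : 0 < a) (hh : 0 < h) {τ : ℤ → Bool} {s : List Bool} {Q : Word 2}
    (hQ : christoffel (2 * a) h = [0] ++ Q ++ [1]) (h0 : τ 0 = false)
    (h1 : τ (s.length + 1) = false) (hs : ∀ i : ℕ, (hi : i < s.length) → τ (1 + i) = s[i]) :
    phi (twist Q s) = win (twistedLetter (2 * a) h τ) 0 ((2 * a + h) * (s.length + 1)) := by
  have hk : 0 < 2 * a := by omega
  rw [christoffel_eq hk hh] at hQ
  have hQ' := (List.append_right_inj _).1 ((List.append_left_inj _).1 hQ)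
  rw [← hQ', twist_eq_win hk hh τ s h0 h1 hs, phi_win hk hh τ h0]
  push_cast
  rfl

theorem exists_of_mem_twisted {c : CircWord 3}
    (hc : c ∈ permImages (circ (phi '' twistedWords))) :
    ∃ (σ : Equiv.Perm (Fin 3)) (a h : ℤ) (τ : ℤ → Bool) (q P : ℤ) (N : ℕ), 0 < a ∧ 0 < h ∧
      IsCoprime h (2 * a + h) ∧ τ 0 = false ∧ τ q = true ∧ 0 ≤ q ∧ q ≤ P ∧ τ P = false ∧
      2 * a + h ≤ N ∧ (∀ x, twistedLetter (2 * a) h τ (x + N) = twistedLetter (2 * a) h τ x) ∧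
      c = (win (fun i => σ (twistedLetter (2 * a) h τ i)) 0 N : CircWord 3) := by
  obtain ⟨σ, d, ⟨w, ⟨v, ⟨k, h, hk, hh, hkh, ⟨a, rfl⟩, Q, hQ, s, hs, rfl⟩, rfl⟩, rfl⟩, rfl⟩ := hc
  rw [← two_mul] at hQ hkh
  obtain ⟨i, hi, hit⟩ := List.getElem_of_mem hs
  have ha : 0 < a := by omega
  refine ⟨σ, a, h, borderMark s, 1 + i, s.length + 1, (2 * a + h) * (s.length + 1), by omega,
    by omega, isCoprime_add_iff.2 hkh, borderMark_zero s, (borderMark_get s i hi).trans hit,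
    by omega, by omega, borderMark_length s, ?_, fun x => ?_, ?_⟩
  · push_cast
    nlinarith
  · push_cast
    exact twistedLetter_add_mul (by omega) (by omega) (borderMark_add s) x
  · rw [phi_twist ha hh hQ (borderMark_zero s) (borderMark_length s) (borderMark_get s),
      Cycle.map_coe, map_win]

theorem mem_twisted {N : ℕ} {f : ℤ → Fin 3} (hN : 0 < N) (hf : ∀ x, f (x + N) = f x)
    {σ : Equiv.Perm (Fin 3)} {x a h : ℤ} {τ : ℤ → Bool} (ha : 0 < a) (hh : 0 < h)
    (hc : IsCoprime h (2 * a + h)) (hd : 2 * a + h ∣ N) (h0 : τ 0 = false) (h1 : τ 1 = true)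
    (hP : τ (N / (2 * a + h)) = false) (hx : ∀ i, σ (f (x + i)) = twistedLetter (2 * a) h τ i) :
    (win f 0 N : CircWord 3) ∈ permImages (circ (phi '' twistedWords)) := by
  lift a to ℕ using ha.le
  lift h to ℕ using hh.le
  have hL : (2 * (a : ℤ) + h) = ((2 * a + h : ℕ) : ℤ) := by push_cast; rfl
  rw [hL, Int.natCast_dvd_natCast] at hd
  obtain ⟨P, rfl⟩ := hd
  rw [hL, Nat.cast_mul, Int.mul_ediv_cancel_left _ (by omega)] at hP
  -- `P = 1` would make the border at 1 both marked and unmarked.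
  obtain ⟨p, rfl⟩ : ∃ p, P = p + 2 := ⟨P - 2, by
    rcases P with _ | _ | P
    · simp at hN
    · simp [h1] at hP
    · rfl⟩
  set s : List Bool := (List.range (p + 1)).map fun i : ℕ => τ (1 + i) with hs
  have hl : s.length = p + 1 := by simp [hs]
  have hQ := christoffel_eq (show 0 < 2 * a by omega) (show 0 < h by omega)
  have e := phi_twist (τ := τ) (s := s) (by omega) (by omega) hQ h0
    (by rw [hl, ← hP]; congr 1) (fun i hi => by simp [hs])
  refine ⟨σ⁻¹, _, ⟨_, ⟨_, ⟨2 * a, h, by omega, by omega, isCoprime_add_iff.1 hc, even_two_mul a, _,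
    hQ, s, ?_, rfl⟩, rfl⟩, rfl⟩, ?_⟩
  · rw [hs, List.mem_map]
    exact ⟨0, by simp, by simpa using h1⟩
  · rw [e, Cycle.map_coe, map_win, coe_win_eq hf 0 x, hl]
    congr 1
    refine win_congr fun i _ => ?_
    rw [zero_add, ← hx]
    simp

theorem exists_of_mem_exceptional {c : CircWord 3} (hc : c ∈ exceptionalCircWords) :
    ∃ (σ : Equiv.Perm (Fin 3)) (N : ℕ), 2 ≤ N ∧
      (∀ x, exceptionalWord (x + N) = exceptionalWord x) ∧
      c = (win (fun i => σ (exceptionalWord i)) 0 N : CircWord 3) := by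
  obtain ⟨d, hd, p, hp, h⟩ := hc
  obtain ⟨σ, rfl⟩ := mem_exceptionalPrimitive.1 hd
  obtain ⟨w, rfl⟩ := Quotient.exists_rep c
  obtain ⟨v, hv, e⟩ := h w rfl
  have hper : ∀ x, exceptionalWord (x + (5 * p : ℕ)) = exceptionalWord x := fun x => by
    have := periodic_mul exceptionalWord_add_five x p
    rwa [show (p : ℤ) * 5 = (5 * p : ℕ) by push_cast; ring] at this
  have hper' : ∀ x, (fun i => σ (exceptionalWord i)) (x + (5 : ℕ)) =
      (fun i => σ (exceptionalWord i)) x :=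
    fun x => by simp only [Nat.cast_ofNat, exceptionalWord_add_five]
  obtain ⟨y, rfl⟩ := exists_eq_win hper' hv
  rw [wordPow_win hper'] at e
  refine ⟨σ, 5 * p, by omega, hper, ?_⟩
  rw [e]
  exact coe_win_eq (fun x => by simp only [hper]) y 0

/-! ### The inclusions and the disjointness. -/

theorem exceptional_subset_abelianBounded :
    exceptionalCircWords ⊆ abelianBoundedCircWords 3 3 := by
  intro c hc
  obtain ⟨σ, N, hN, hper, rfl⟩ := exists_of_mem_exceptional hc
  rw [mem_abelianBounded_iff (by omega) (fun x => by simp only [hper])]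
  refine ⟨fun b => ?_, fun m hm _ => (atMostThree_exceptionalWord hm).perm σ⟩
  obtain ⟨x, hx⟩ : ∃ x, exceptionalWord x = σ.symm b := by
    generalize σ.symm b = b
    fin_cases b
    exacts [⟨0, rfl⟩, ⟨3, rfl⟩, ⟨2, rfl⟩]
  exact ⟨x, by simp only [hx, Equiv.apply_symm_apply]⟩

theorem twisted_subset_abelianBounded :
    permImages (circ (phi '' twistedWords)) ⊆ abelianBoundedCircWords 3 3 := by
  intro c hc
  obtain ⟨σ, a, h, τ, q, P, N, ha, hh, hco, -, -, -, -, -, hN, hper, rfl⟩ :=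
    exists_of_mem_twisted hc
  rw [mem_abelianBounded_iff (by omega) (fun x => by simp only [hper])]
  refine ⟨fun b => ?_, fun m _ _ => (atMostThree_twistedLetter ha hh τ hco m).perm σ⟩
  obtain ⟨x, hx⟩ := exists_twistedLetter_eq ha hh τ (σ.symm b)
  exact ⟨x, by simp only [hx, Equiv.apply_symm_apply]⟩

theorem balanced_subset_abelianBounded :
    balancedCircWords 3 ⊆ abelianBoundedCircWords 3 3 := by
  intro c hc
  obtain ⟨N, f, hN, hf, rfl⟩ := exists_rep_of_mem_circ_fullWords hc.1
  rw [mem_balanced_iff hN hf] at hc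
  rw [mem_abelianBounded_iff hN hf]
  refine ⟨hc.1, fun m h0 hm => ?_⟩
  lift m to ℕ using h0.le
  exact (hc.2 m (by omega)).atMostThree

theorem abelianBounded_subset : abelianBoundedCircWords 3 3 ⊆
    balancedCircWords 3 ∪ permImages (circ (phi '' twistedWords)) ∪ exceptionalCircWords := by
  intro c hc
  obtain ⟨N, f, hN, hf, rfl⟩ := exists_rep_of_mem_circ_fullWords hc.1
  obtain ⟨hfull, h3⟩ := (mem_abelianBounded_iff hN hf).1 hc
  by_cases hb : ∃ m : ℕ, 0 < m ∧ m ≤ N ∧ ¬ BalancedAt f m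
  · obtain ⟨σ, x, h | ⟨a, h, τ, ha, hh, hco, hd, h0, h1, hP, hx⟩⟩ :=
      classification hN hf hfull h3 hb
    · refine Or.inr ((mem_exceptional_iff hN hf).2 ⟨σ.symm, x, fun i => ?_⟩)
      rw [← eq_exceptionalWord_of_nat (f := fun i => σ (f i)) (fun x => by simp only [hf]) h hN i]
      simp only [Equiv.symm_apply_apply]
    · exact Or.inl (Or.inr (mem_twisted hN hf ha hh hco hd h0 h1 hP hx))
  · push Not at hb
    refine Or.inl (Or.inl ((mem_balanced_iff hN hf).2 ⟨hfull, fun m hm => ?_⟩))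
    rcases m.eq_zero_or_pos with rfl | h0
    · intro a x y
      rw [Nat.cast_zero, wc_zero, wc_zero]
      exact zero_le_one
    · exact hb m h0 hm

theorem disjoint_balanced_twisted :
    Disjoint (balancedCircWords 3) (permImages (circ (phi '' twistedWords))) := by
  refine Set.disjoint_left.2 fun c hb hc => ?_
  obtain ⟨σ, a, h, τ, q, P, N, ha, hh, -, h0, hq, hq0, hqP, hP, hN, hper, rfl⟩ :=
    exists_of_mem_twisted hc
  rw [mem_balanced_iff (by omega) (fun x => by simp only [hper])] at hb
  refine twistedLetter_not_balanced ha hh τ h0 hq hq0 hqP hP ?_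
  refine BalancedAt.of_shift (x := 0) (σ := σ) (fun i => by rw [zero_add]) ?_
  have := hb.2 (2 * a + h).toNat (by omega)
  rwa [Int.toNat_of_nonneg (by omega)] at this

theorem disjoint_balanced_exceptional :
    Disjoint (balancedCircWords 3) exceptionalCircWords := by
  refine Set.disjoint_left.2 fun c hb hc => ?_
  obtain ⟨σ, N, hN, hper, rfl⟩ := exists_of_mem_exceptional hc
  rw [mem_balanced_iff (by omega) (fun x => by simp only [hper])] at hb
  exact exceptionalWord_not_balanced
    (BalancedAt.of_shift (x := 0) (σ := σ) (fun i => by rw [zero_add]) (hb.2 2 hN))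

theorem disjoint_twisted_exceptional :
    Disjoint (permImages (circ (phi '' twistedWords))) exceptionalCircWords := by
  refine Set.disjoint_left.2 fun c hc he => ?_
  obtain ⟨σ, a, h, τ, q, P, N, ha, hh, hco, -, -, -, -, -, hN, hper, rfl⟩ :=
    exists_of_mem_twisted hc
  obtain ⟨π, x, hx⟩ := (mem_exceptional_iff (by omega) (fun x => by simp only [hper])).1 he
  refine twistedLetter_ne_exceptionalWord ha hh τ hco (π.trans σ.symm) x fun i => ?_
  rw [Equiv.trans_apply, ← hx i, Equiv.symm_apply_apply]

end CircularWords

theorem theorem2 :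
    CircularWords.abelianBoundedCircWords 3 3 =
        CircularWords.balancedCircWords 3 ∪
          CircularWords.permImages
            (CircularWords.circ (CircularWords.phi '' CircularWords.twistedWords)) ∪
          CircularWords.exceptionalCircWords ∧
      Disjoint (CircularWords.balancedCircWords 3)
        (CircularWords.permImages
          (CircularWords.circ (CircularWords.phi '' CircularWords.twistedWords))) ∧
      Disjoint (CircularWords.balancedCircWords 3) CircularWords.exceptionalCircWords ∧
      Disjoint
        (CircularWords.permImages
          (CircularWords.circ (CircularWords.phi '' CircularWords.twistedWords)))
        CircularWords.exceptionalCircWords := by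
  exact ⟨(CircularWords.abelianBounded_subset).antisymm (Set.union_subset (Set.union_subset
    CircularWords.balanced_subset_abelianBounded CircularWords.twisted_subset_abelianBounded)
    CircularWords.exceptional_subset_abelianBounded),
    CircularWords.disjoint_balanced_twisted, CircularWords.disjoint_balanced_exceptional,
    CircularWords.disjoint_twisted_exceptional⟩
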